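/- Let $X=[\underline x,\overline x]$ (firm types) and $Y=[\underline y,\overline y]$ (worker types) with $\underline x<\overline x$, $\underline y<\overline y$. Let $F$ and $G$ be probability distributions on $X$ and $Y$ with continuous, strictly positive densities (we also write $F$, $G$ for their cdfs), and let $v:X\times Y\to\mathbb R$ be twice continuously differentiable with $v_{xz}>0$ and $v_{zz}<0$ on $X\times Y$; a firm $x$ whose workforce has mean skill $z$ produces $v(x,z)$. A distribution $H$ on $Y$ majorizes $G$ if $\int_{\underline y}^{y}H(t)\,dt\le\int_{\underline y}^{y}G(t)\,dt$ for all $y\in Y$, with equality at $y=\overline y$. An assignment is a probability measure $J$ on $X\times Y$ whose $X$-marginal is $F$ and whose $Y$-marginal $J_Y$ majorizes $G$. A competitive equilibrium is an assignment $J$ together with Lipschitz functions $p:X\to\mathbb R$, $q:Y\to\mathbb R$, $q$ convex, such that $p(x)+q(z)=v(x,z)$ on the support of $J$, $p(x)+q(z)\ge v(x,z)$ on $X\times Y$, and $\int q\,dJ_Y=\int q\,dG$. An equilibrium matching is the quantile matching $T=J_Y^{-1}\circ F:X\to Y$ of a competitive equilibrium $(J;p,q)$, where $J_Y^{-1}$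 is the generalized inverse of the cdf of $J_Y$ (at $0$: its right limit). Let $S=G^{-1}\circ F$. For an increasing $T:X\to Y$, constraint (F) is $$\int_{\underline x}^{x}T\,dF\ \ge\ \int_{\underline x}^{x}S\,dF\quad\text{for all }x\in X,\text{ with equality at }x=\overline x .$$ A compression interval of such a $T$ is a maximal open interval on which the inequality in (F) is strict. "Increasing" means weakly increasing unless it is said to be strict. Then: 1. There is a unique equilibrium matching $T$. It is continuous and strictly increasing. In every competitive equilibrium each firm $x$ hires the workforce mean $T(x)$: the unique equilibrium assignment is the distribution of $(x,T(x))$ with $x\sim F$, and its support is $\{(x,T(x)):x\in X\}$. 2. $T$ is the unique increasing map $X\to Y$ satisfying (F) such that $x\mapsto v_z(x,T(x))$ is increasing on $X$ and constant on each compression interval of $T$. 3. Functions $(p,q)$ are equilibrium prices (for the equilibrium assignment) if and only if there is $c\in\mathbb R$ with $$p(x)=\int_{\underline x}^{x}v_x(\tilde x,T(\tilde x))\,d\tilde x+c\qquad(x\in X),$$ $$q(y)=\begin{cases} v(\underline x,T(\underline x))+\int_{T(\underline x)}^{y}v_z(T^{-1}(\tilde y),\tilde y)\,d\tilde y-c,&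 y\in[T(\underline x),T(\overline x)],\\ q(T(\underline x))-(T(\underline x)-y)\,v_z(\underline x,T(\underline x)),& y\in[\underline y,T(\underline x)),\\ q(T(\overline x))+(y-T(\overline x))\,v_z(\overline x,T(\overline x)),& y\in(T(\overline x),\overline y]. \end{cases}$$ -/

import Mathlib

open MeasureTheory ProbabilityTheory Set

/-- The primitives of the mean-measurable matching model. Firm types live in `X = [xlo, xhi]`
and have density `f`; worker types live in `Y = [ylo, yhi]` and have density `g`. A firm `x`
whose workforce has mean skill `z` produces `v x z`. Only the values of `f` on `X`, of `g` on `Y`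
and of `v` on `X × Y` matter. -/
structure Economy where
  xlo : ℝ
  xhi : ℝ
  ylo : ℝ
  yhi : ℝ
  x_lt : xlo < xhi
  y_lt : ylo < yhi
  f : ℝ → ℝ
  g : ℝ → ℝ
  f_cont : ContinuousOn f (Icc xlo xhi)
  g_cont : ContinuousOn g (Icc ylo yhi)
  f_pos : ∀ x ∈ Icc xlo xhi, 0 < f x
  g_pos : ∀ y ∈ Icc ylo yhi, 0 < g y
  f_int : ∫ x in xlo..xhi, f x = 1
  g_int : ∫ y in ylo..yhi, g y = 1
  v : ℝ → ℝ → ℝ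

/-- `H` majorizes `G` on `[lo, hi]`, for distributions `H`, `G` on `[lo, hi]`
(equivalently, `G` is a mean-preserving spread of `H`). -/
def Majorizes (lo hi : ℝ) (H G : Measure ℝ) : Prop :=
  (∀ y ∈ Icc lo hi, ∫ t in lo..y, cdf H t ≤ ∫ t in lo..y, cdf G t) ∧
    ∫ t in lo..hi, cdf H t = ∫ t in lo..hi, cdf G t

namespace Economy

/-- Firm types. -/
def X (E : Economy) : Set ℝ := Icc E.xlo E.xhi

/-- Worker types. -/
def Y (E : Economy) : Set ℝ := Icc E.ylo E.yhi

/-- The distribution of firm types. -/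
noncomputable def F (E : Economy) : Measure ℝ :=
  (volume.restrict E.X).withDensity (fun x => ENNReal.ofReal (E.f x))

/-- The distribution of worker types. -/
noncomputable def G (E : Economy) : Measure ℝ :=
  (volume.restrict E.Y).withDensity (fun y => ENNReal.ofReal (E.g y))

/-- The partial derivative `v_x` on `X × Y` (one-sided at the edges). -/
noncomputable def vx (E : Economy) (x z : ℝ) : ℝ := derivWithin (fun s => E.v s z) E.X x

/-- The partial derivative `v_z` on `X × Y` (one-sided at the edges). -/
noncomputable def vz (E : Economy) (x z : ℝ) : ℝ := derivWithin (fun t => E.v x t) E.Y z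

/-- The second partial derivative `v_xz`. -/
noncomputable def vxz (E : Economy) (x z : ℝ) : ℝ := derivWithin (fun t => E.vx x t) E.Y z

/-- The second partial derivative `v_zz`. -/
noncomputable def vzz (E : Economy) (x z : ℝ) : ℝ := derivWithin (fun t => E.vz x t) E.Y z

/-- An assignment: a distribution over (firm, workforce mean) pairs whose first marginal is the
distribution of firms and whose second marginal majorizes the distribution of workers. -/
def IsAssignment (E : Economy) (J : Measure (ℝ × ℝ)) : Prop :=
  IsProbabilityMeasure J ∧ J (E.X ×ˢ E.Y)ᶜ = 0 ∧ J.fst = E.F ∧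
    Majorizes E.ylo E.yhi J.snd E.G

/-- Competitive equilibrium `(J; p, q)`: an assignment with Lipschitz profits `p` on `X` and
Lipschitz convex wages `q` on `Y`, zero profit on the support of `J`, no profitable entry,
and total wages paid equal to total wages received. -/
def IsCompetitiveEquilibrium (E : Economy) (J : Measure (ℝ × ℝ)) (p q : ℝ → ℝ) : Prop :=
  E.IsAssignment J ∧
    (∃ K, LipschitzOnWith K p E.X) ∧ (∃ K, LipschitzOnWith K q E.Y) ∧
    (∀ x z, (x, z) ∈ J.support → p x + q z = E.v x z) ∧
    (∀ x ∈ E.X, ∀ z ∈ E.Y, E.v x z ≤ p x + q z) ∧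
    ConvexOn ℝ E.Y q ∧ ∫ z, q z ∂J.snd = ∫ y, q y ∂E.G

/-- The quantile matching `x ↦ H⁻¹(F(x))` from the distribution of firms to a distribution `H`
on `Y`. The clause `0 < cdf H z` only matters at the lowest firm type, where `F(x) = 0`: it makes
`H⁻¹(0)` the lower end of the support of `H`, that is, the right limit of `H⁻¹` at `0`. -/
noncomputable def quantileMatching (E : Economy) (H : Measure ℝ) (x : ℝ) : ℝ :=
  sInf {z | z ∈ E.Y ∧ cdf E.F x ≤ cdf H z ∧ 0 < cdf H z}

/-- The segregation matching `S = G⁻¹ ∘ F`. -/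
noncomputable def S (E : Economy) (x : ℝ) : ℝ := E.quantileMatching E.G x

/-- `T` (as a function on `X`) is an equilibrium matching: the quantile matching from the
distribution of firms to the distribution of workforce means of a competitive equilibrium. -/
def IsEquilibriumMatching (E : Economy) (T : ℝ → ℝ) : Prop :=
  ∃ J p q, E.IsCompetitiveEquilibrium J p q ∧ ∀ x ∈ E.X, T x = E.quantileMatching J.snd x

/-- The distribution of `(x, T x)`, where `x` is distributed as the firms. -/
noncomputable def inducedAssignment (E : Economy) (T : ℝ → ℝ) : Measure (ℝ × ℝ) :=
  E.F.map (fun x => (x, T x))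

/-- The majorization constraint on a matching `T`. -/
def IsFeasible (E : Economy) (T : ℝ → ℝ) : Prop :=
  (∀ x ∈ E.X, ∫ t in E.xlo..x, E.S t ∂E.F ≤ ∫ t in E.xlo..x, T t ∂E.F) ∧
    ∫ t in E.xlo..E.xhi, T t ∂E.F = ∫ t in E.xlo..E.xhi, E.S t ∂E.F

/-- The segregation set of a matching. -/
def segregationSet (E : Economy) (T : ℝ → ℝ) : Set ℝ :=
  {x | x ∈ E.X ∧ ∫ t in E.xlo..x, T t ∂E.F = ∫ t in E.xlo..x, E.S t ∂E.F}

/-- The compression set of a matching. -/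
def compressionSet (E : Economy) (T : ℝ → ℝ) : Set ℝ :=
  {x | x ∈ E.X ∧ ∫ t in E.xlo..x, E.S t ∂E.F < ∫ t in E.xlo..x, T t ∂E.F}

/-- `(a, b)` is a compression interval: a maximal open interval in the compression set. -/
def IsCompressionInterval (E : Economy) (T : ℝ → ℝ) (a b : ℝ) : Prop :=
  a < b ∧ Ioo a b ⊆ E.compressionSet T ∧ a ∈ E.segregationSet T ∧ b ∈ E.segregationSet T

/-- `T` is an increasing matching of firms to workforce means that satisfies the majorization
constraint, and `x ↦ v_z(x, T x)` is increasing on `X` and constant on each compression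
interval. -/
def IsMarginallySorted (E : Economy) (T : ℝ → ℝ) : Prop :=
  MapsTo T E.X E.Y ∧ MonotoneOn T E.X ∧ E.IsFeasible T ∧
    MonotoneOn (fun x => E.vz x (T x)) E.X ∧
    ∀ a b, E.IsCompressionInterval T a b →
      ∀ x ∈ Ioo a b, ∀ x' ∈ Ioo a b, E.vz x (T x) = E.vz x' (T x')

/-- The inverse of (the restriction to `X` of) a matching. -/
noncomputable def inverseMatching (E : Economy) (T : ℝ → ℝ) : ℝ → ℝ :=
  Function.invFunOn T E.X

/-- The envelope formulas for prices `(p, q)` with constant `c`. -/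
def EnvelopePrices (E : Economy) (T p q : ℝ → ℝ) (c : ℝ) : Prop :=
  (∀ x ∈ E.X, p x = (∫ s in E.xlo..x, E.vx s (T s)) + c) ∧
  (∀ y ∈ Icc (T E.xlo) (T E.xhi),
    q y = E.v E.xlo (T E.xlo) + (∫ t in (T E.xlo)..y, E.vz (E.inverseMatching T t) t) - c) ∧
  (∀ y ∈ Ico E.ylo (T E.xlo),
    q y = q (T E.xlo) - (T E.xlo - y) * E.vz E.xlo (T E.xlo)) ∧
  (∀ y ∈ Ioc (T E.xhi) E.yhi,
    q y = q (T E.xhi) + (y - T E.xhi) * E.vz E.xhi (T E.xhi))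

end Economy

/-! ### Integrals of monotone weights -/

/-! Everything turns on one first-order condition, `IsMarginallySorted`. Put K(x) = ∫ (T - S) dF
over [xlo, x] (`excess`) and w(x) = v_z(x, T(x)). Constraint (F) says that K ≥ 0 and that K vanishes
at both ends, so for every increasing w an integration by parts gives ∫ w dK = -∫ K dw ≤ 0, with
equality exactly when w is constant on each interval where K > 0. The layer-cake form of this fact
(`integral_monotone_mul_nonpos`, `integral_monotone_mul_eq_zero`,
`eq_of_integral_monotone_mul_eq_zero`) allows w to jump and is used throughout.

Uniqueness. For two marginally sorted matchings it yields two variational inequalities. Their sum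
contradicts strict concavity of v in z unless the matchings agree on a dense set, and monotonicity
extends the agreement to all of X (`IsMarginallySorted.eqOn`).

Existence. With D(x, ·) the inverse of v_z(x, ·), the unknown w solves a generalized isotonic
regression of S. For each constant level l, maximize ∫ (S - D(·, l)) dF over the upper limit of
integration. Maximizers move right as l grows, and w(x) is the supremum of the levels with a
maximizer other than the right endpoint at or to the left of x. An envelope argument
(`IroningProblem.cumul_eq_gap`) identifies -K(x) with the shortfall of x from optimality at its own
level, which gives the sign of K and the constancy of w at once. Since S is strictly increasing and
v_xz > 0, the resulting T is strictly increasing.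

From equilibrium to sorting. At an optimal workforce v_z is a subgradient of the convex wage q.
Strict concavity and v_xz > 0 then force the support of J to be the graph of a continuous increasing
T (`exists_matching`). Integrating the subgradient inequality from T(x) to S(x) and using equality
of the wage bills gives ∫ w dK ≥ 0. This is the equality case above, so T is marginally sorted
(`IsCompetitiveEquilibrium.isMarginallySorted`). The same slack argument makes q affine between T(x)
and S(x), which at the extreme firms gives the linear tails of the wage formula.

From sorting to equilibrium. The primitive of v_z along the graph of T is a convex wage. It is
affine between T(x) and S(x) because w is constant on compression intervals, so the wage bills agree
(`integral_wage_eq`). The envelope formulas determine prices up to one constant. -/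

theorem exists_threshold_of_monotone {a b : ℝ} (hab : a ≤ b) {w : ℝ → ℝ} (hw : Monotone w) (l : ℝ) :
    ∃ c ∈ Icc a b, (∀ x ∈ Icc a b, x < c → w x ≤ l) ∧ ∀ x ∈ Icc a b, c < x → l < w x := by
  by_cases hne : (Icc a b ∩ {x | w x ≤ l}).Nonempty
  · have hbdd : BddAbove (Icc a b ∩ {x | w x ≤ l}) := ⟨b, fun x hx => hx.1.2⟩
    refine ⟨sSup (Icc a b ∩ {x | w x ≤ l}), ⟨?_, ?_⟩, ?_, ?_⟩
    · obtain ⟨x, hx⟩ := hne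
      exact hx.1.1.trans (le_csSup hbdd hx)
    · exact csSup_le hne fun x hx => hx.1.2
    · intro x _ hxc
      obtain ⟨y, hy, hxy⟩ := exists_lt_of_lt_csSup hne hxc
      exact (hw hxy.le).trans hy.2
    · intro x hx hcx
      by_contra h
      exact absurd (le_csSup hbdd ⟨hx, not_lt.mp h⟩) (not_le.mpr hcx)
  · refine ⟨a, ⟨le_rfl, hab⟩, fun x hx hxa => absurd hx.1 (not_le.mpr hxa), fun x hx _ => ?_⟩
    by_contra h
    exact hne ⟨x, hx, not_lt.mp h⟩

/-- The part of the integral of `k` over the superlevel set of `w` at level `l`. -/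
noncomputable def superlevelIntegral (w k : ℝ → ℝ) (a b l : ℝ) : ℝ :=
  ∫ x in a..b, (if l < w x then k x else 0)

theorem exists_superlevelIntegral_eq {a b : ℝ} (hab : a ≤ b) {w : ℝ → ℝ} (hw : Monotone w)
    (k : ℝ → ℝ) (l : ℝ) :
    ∃ c ∈ Icc a b, (∀ x ∈ Icc a b, x < c → w x ≤ l) ∧ (∀ x ∈ Icc a b, c < x → l < w x) ∧
      superlevelIntegral w k a b l = ∫ x in c..b, k x := by
  obtain ⟨c, hc, h1, h2⟩ := exists_threshold_of_monotone hab hw l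
  refine ⟨c, hc, h1, h2, ?_⟩
  unfold superlevelIntegral
  rw [intervalIntegral.integral_of_le hab, intervalIntegral.integral_of_le hc.2]
  have : ∀ᵐ x ∂(volume.restrict (Ioc a b)),
      (if l < w x then k x else 0) = (Ioc c b).indicator k x := by
    rw [ae_restrict_iff' measurableSet_Ioc]
    have : ∀ᵐ x : ℝ, x ≠ c := by simp [ae_iff]
    filter_upwards [this] with x hxc hx
    rcases lt_or_gt_of_ne hxc with h | h
    · rw [if_neg (not_lt.mpr (h1 x (Ioc_subset_Icc_self hx) h)), indicator_of_notMem]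
      exact fun h' => absurd h'.1 (not_lt.mpr h.le)
    · rw [if_pos (h2 x (Ioc_subset_Icc_self hx) h), indicator_of_mem]
      exact ⟨h, hx.2⟩
  rw [integral_congr_ae this, setIntegral_indicator measurableSet_Ioc]
  congr 2
  ext x
  simp only [mem_inter_iff, mem_Ioc]
  constructor
  · rintro ⟨_, h⟩; exact h
  · rintro h; exact ⟨⟨hc.1.trans_lt h.1, h.2⟩, h⟩

theorem integrable_superlevel {a b : ℝ} (hab : a ≤ b) {w k : ℝ → ℝ} (hw : Monotone w)
    (hk : IntervalIntegrable k volume a b) (l l' : ℝ) :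
    Integrable (Function.uncurry fun l x : ℝ => if l < w x then k x else 0)
      ((volume.restrict (uIoc l l')).prod (volume.restrict (Ioc a b))) := by
  have hk' : Integrable k (volume.restrict (Ioc a b)) := by
    rwa [intervalIntegrable_iff_integrableOn_Ioc_of_le hab] at hk
  have : IsFiniteMeasure (volume.restrict (uIoc l l')) := ⟨by simp [uIoc]⟩
  have h1 : Integrable (fun p : ℝ × ℝ => k p.2)
      ((volume.restrict (uIoc l l')).prod (volume.restrict (Ioc a b))) := hk'.comp_snd _
  have hm : MeasurableSet {p : ℝ × ℝ | p.1 < w p.2} :=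
    measurableSet_lt measurable_fst (hw.measurable.comp measurable_snd)
  refine (h1.indicator hm).congr (Filter.Eventually.of_forall fun p => ?_)
  simp only [Function.uncurry, indicator, mem_ofPred_eq]

theorem intervalIntegrable_superlevelIntegral {a b : ℝ} (hab : a ≤ b) {w k : ℝ → ℝ}
    (hw : Monotone w) (hk : IntervalIntegrable k volume a b) (l l' : ℝ) :
    IntervalIntegrable (superlevelIntegral w k a b) volume l l' := by
  rw [intervalIntegrable_iff]
  have := (integrable_superlevel hab hw hk l l').integral_prod_left
  refine this.congr (Filter.Eventually.of_forall fun y => ?_)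
  simp only [superlevelIntegral, Function.uncurry]
  rw [intervalIntegral.integral_of_le hab]

theorem Monotone.intervalIntegrable_mul {a b : ℝ} (hab : a ≤ b) {w k : ℝ → ℝ} (hw : Monotone w)
    (hk : IntervalIntegrable k volume a b) :
    IntervalIntegrable (fun x => w x * k x) volume a b := by
  rw [intervalIntegrable_iff_integrableOn_Ioc_of_le hab] at hk ⊢
  refine Integrable.bdd_mul (c := max |w a| |w b|) hk hw.measurable.aestronglyMeasurable ?_
  rw [ae_restrict_iff' measurableSet_Ioc]
  refine Filter.Eventually.of_forall fun x hx => ?_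
  exact abs_le_max_abs_abs (hw hx.1.le) (hw hx.2)

/-- Layer cake and Fubini: w - w(a) is the length of the set of levels in (w(a), w(b)] below it, and
subtracting w(a) costs nothing because k has integral zero. This stands in for integration by parts
and needs no regularity of w. -/
theorem integral_monotone_mul_eq {a b : ℝ} (hab : a ≤ b) {w k : ℝ → ℝ} (hw : Monotone w)
    (hk : IntervalIntegrable k volume a b) (hk0 : ∫ x in a..b, k x = 0) :
    ∫ x in a..b, w x * k x = ∫ l in w a..w b, superlevelIntegral w k a b l := by
  have h1 : ∀ x ∈ Icc a b,
      (w x - w a) * k x = ∫ l in w a..w b, (if l < w x then k x else 0) := by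
    intro x hx
    have hax := hw hx.1
    have hxb := hw hx.2
    rw [intervalIntegral.integral_of_le (hax.trans hxb)]
    have : ∀ᵐ l ∂(volume.restrict (Ioc (w a) (w b))),
        (if l < w x then k x else 0) = (Ioc (w a) (w x)).indicator (fun _ => k x) l := by
      rw [ae_restrict_iff' measurableSet_Ioc]
      have : ∀ᵐ l : ℝ, l ≠ w x := by simp [ae_iff]
      filter_upwards [this] with l hl hl'
      rcases lt_or_gt_of_ne hl with h | h
      · rw [if_pos h, indicator_of_mem]
        exact ⟨hl'.1, h.le⟩
      · rw [if_neg (not_lt.mpr h.le), indicator_of_notMem]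
        exact fun h' => absurd h'.2 (not_le.mpr h)
    rw [integral_congr_ae this, setIntegral_indicator measurableSet_Ioc,
      inter_eq_self_of_subset_right (Ioc_subset_Ioc_right hxb)]
    simp [hax]
  have hwk := hw.intervalIntegrable_mul hab hk
  have h2 : ∫ x in a..b, w x * k x = ∫ x in a..b, (w x - w a) * k x := by
    simp_rw [sub_mul]
    rw [intervalIntegral.integral_sub hwk (hk.const_mul _), intervalIntegral.integral_const_mul,
      hk0, mul_zero, sub_zero]
  have h3 : ∫ x in a..b, (w x - w a) * k x =
      ∫ x in a..b, ∫ l in w a..w b, (if l < w x then k x else 0) := by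
    refine intervalIntegral.integral_congr fun x hx => ?_
    rw [uIcc_of_le hab] at hx
    exact h1 x hx
  rw [h2, h3, intervalIntegral.integral_of_le hab]
  rw [← intervalIntegral_integral_swap (integrable_superlevel hab hw hk (w a) (w b))]
  simp only [superlevelIntegral, intervalIntegral.integral_of_le hab]

section Weights

variable {a b : ℝ} {w k : ℝ → ℝ}

/-- A superlevel set of a monotone function is, up to its left endpoint, an interval reaching b.
Since k has total integral zero, each layer is minus the primitive of k at the threshold, so the
sign of the primitive controls every layer. -/
theorem superlevelIntegral_eq_neg (hab : a ≤ b) (hw : Monotone w)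
    (hk : IntervalIntegrable k volume a b) (hk0 : ∫ x in a..b, k x = 0) (l : ℝ) :
    ∃ c ∈ Icc a b, (∀ x ∈ Icc a b, x < c → w x ≤ l) ∧ (∀ x ∈ Icc a b, c < x → l < w x) ∧
      superlevelIntegral w k a b l = - ∫ x in a..c, k x := by
  obtain ⟨c, hc, h1, h2, h3⟩ := exists_superlevelIntegral_eq hab hw k l
  refine ⟨c, hc, h1, h2, ?_⟩
  rw [h3, eq_neg_iff_add_eq_zero, add_comm, ← hk0]
  refine intervalIntegral.integral_add_adjacent_intervals (hk.mono_set ?_) (hk.mono_set ?_)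
  · rw [uIcc_of_le hab, uIcc_of_le hc.1]; exact Icc_subset_Icc_right hc.2
  · rw [uIcc_of_le hab, uIcc_of_le hc.2]; exact Icc_subset_Icc_left hc.1

/-- `w` extended from `[a, b]` to a function that is constant outside. -/
noncomputable def clampExtend (a b : ℝ) (w : ℝ → ℝ) (x : ℝ) : ℝ := w (max a (min x b))

theorem clamp_mem (hab : a ≤ b) (x : ℝ) : max a (min x b) ∈ Icc a b :=
  ⟨le_max_left _ _, max_le hab (min_le_right _ _)⟩

theorem clamp_eq {x : ℝ} (hx : x ∈ Icc a b) : max a (min x b) = x := by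
  rw [min_eq_left hx.2, max_eq_right hx.1]

theorem continuous_clamp (a b : ℝ) : Continuous fun x : ℝ => max a (min x b) := by fun_prop

theorem clampExtend_eq {x : ℝ} (hx : x ∈ Icc a b) : clampExtend a b w x = w x := by
  rw [clampExtend, clamp_eq hx]

theorem monotone_clampExtend (hab : a ≤ b) (hw : MonotoneOn w (Icc a b)) :
    Monotone (clampExtend a b w) := fun x y hxy =>
  hw (clamp_mem hab x) (clamp_mem hab y) (max_le_max le_rfl (min_le_min hxy le_rfl))

theorem continuous_clampExtend (hab : a ≤ b) (hw : ContinuousOn w (Icc a b)) :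
    Continuous (clampExtend a b w) :=
  hw.comp_continuous (continuous_clamp a b) (clamp_mem hab)

theorem integral_clampExtend_mul (hab : a ≤ b) :
    ∫ x in a..b, w x * k x = ∫ x in a..b, clampExtend a b w x * k x := by
  refine intervalIntegral.integral_congr fun x hx => ?_
  rw [uIcc_of_le hab] at hx
  simp only [clampExtend_eq hx]

theorem MonotoneOn.intervalIntegrable_mul (hab : a ≤ b) (hw : MonotoneOn w (Icc a b))
    (hk : IntervalIntegrable k volume a b) :
    IntervalIntegrable (fun x => w x * k x) volume a b := by
  refine ((monotone_clampExtend hab hw).intervalIntegrable_mul hab hk).congr fun x hx => ?_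
  rw [uIoc_of_le hab] at hx
  simp only [clampExtend_eq (Ioc_subset_Icc_self hx)]

/-- Integrating an increasing weight against `k`, where the primitive of `k` is nonnegative and
vanishes at both ends. -/
theorem integral_monotone_mul_nonpos (hab : a ≤ b) (hw : MonotoneOn w (Icc a b))
    (hk : IntervalIntegrable k volume a b) (hk0 : ∫ x in a..b, k x = 0)
    (hK : ∀ x ∈ Icc a b, 0 ≤ ∫ t in a..x, k t) : ∫ x in a..b, w x * k x ≤ 0 := by
  have hw' := monotone_clampExtend hab hw
  rw [integral_clampExtend_mul hab, integral_monotone_mul_eq hab hw' hk hk0]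
  have h0 : 0 ≤ ∫ l in clampExtend a b w a..clampExtend a b w b,
      - superlevelIntegral (clampExtend a b w) k a b l := by
    refine intervalIntegral.integral_nonneg (hw' hab) fun l _ => ?_
    obtain ⟨c, hc, -, -, h⟩ := superlevelIntegral_eq_neg hab hw' hk hk0 l
    rw [h, neg_neg]
    exact hK c hc
  rw [intervalIntegral.integral_neg] at h0
  linarith

theorem continuousOn_primitive (hab : a ≤ b) (hk : IntervalIntegrable k volume a b) :
    ContinuousOn (fun x => ∫ t in a..x, k t) (Icc a b) := by
  have := intervalIntegral.continuousOn_primitive_interval' hk left_mem_uIcc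
  rwa [uIcc_of_le hab] at this

/-- Every layer vanishes separately. At the threshold c of level l the weight passes from at most l
to above l, so it is not constant across c. A positive primitive at c would remain positive nearby
and force constancy there. -/
theorem integral_monotone_mul_eq_zero (hab : a ≤ b) (hw : MonotoneOn w (Icc a b))
    (hk : IntervalIntegrable k volume a b) (hk0 : ∫ x in a..b, k x = 0)
    (hK : ∀ x ∈ Icc a b, 0 ≤ ∫ t in a..x, k t)
    (hconst : ∀ x ∈ Icc a b, ∀ y ∈ Icc a b, x < y → (∀ t ∈ Icc x y, 0 < ∫ s in a..t, k s) →
      w x = w y) : ∫ x in a..b, w x * k x = 0 := by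
  have hw' := monotone_clampExtend hab hw
  rw [integral_clampExtend_mul hab, integral_monotone_mul_eq hab hw' hk hk0]
  have : ∀ l, superlevelIntegral (clampExtend a b w) k a b l = 0 := by
    intro l
    obtain ⟨c, hc, h1, h2, h⟩ := superlevelIntegral_eq_neg hab hw' hk hk0 l
    rw [h, neg_eq_zero]
    by_contra hne
    have hpos : 0 < ∫ t in a..c, k t := lt_of_le_of_ne (hK c hc) (Ne.symm hne)
    have hac : a < c := by
      rcases hc.1.lt_or_eq with h | h
      · exact h
      · rw [← h] at hpos; simp at hpos
    have hcb : c < b := by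
      rcases hc.2.lt_or_eq with h | h
      · exact h
      · rw [h, hk0] at hpos; simp at hpos
    have hcont : ContinuousAt (fun x => ∫ t in a..x, k t) c :=
      (continuousOn_primitive hab hk).continuousAt (Icc_mem_nhds hac hcb)
    have hev := (hcont.eventually (lt_mem_nhds hpos)).and (Ioo_mem_nhds hac hcb)
    obtain ⟨e, he, hball⟩ := Metric.eventually_nhds_iff.mp hev
    have hx : c - e / 2 ∈ Ioo a b := (hball (by simp [abs_of_pos he]; linarith)).2
    have hy : c + e / 2 ∈ Ioo a b := (hball (by simp [abs_of_pos he]; linarith)).2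
    have heq := hconst _ (Ioo_subset_Icc_self hx) _ (Ioo_subset_Icc_self hy) (by linarith)
      (fun t ht => (hball (by
        rw [Real.dist_eq]
        exact lt_of_le_of_lt (abs_le.mpr ⟨by linarith [ht.1], by linarith [ht.2]⟩)
          (half_lt_self he))).1)
    have e1 := h1 _ (Ioo_subset_Icc_self hx) (by linarith)
    have e2 := h2 _ (Ioo_subset_Icc_self hy) (by linarith)
    rw [clampExtend_eq (Ioo_subset_Icc_self hx)] at e1
    rw [clampExtend_eq (Ioo_subset_Icc_self hy)] at e2
    linarith
  simp [this]

/-- The equality case. If w(x) < w(y), the levels strictly between have their thresholds in [x, y],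
where the primitive is positive. These layers are strictly negative and the others nonpositive, so
the integral would be negative. -/
theorem eq_of_integral_monotone_mul_eq_zero (hab : a ≤ b) (hw : MonotoneOn w (Icc a b))
    (hk : IntervalIntegrable k volume a b) (hk0 : ∫ x in a..b, k x = 0)
    (hK : ∀ x ∈ Icc a b, 0 ≤ ∫ t in a..x, k t) (h0 : 0 ≤ ∫ x in a..b, w x * k x)
    {x y : ℝ} (hx : x ∈ Icc a b) (hy : y ∈ Icc a b) (hxy : x < y)
    (hpos : ∀ t ∈ Icc x y, 0 < ∫ s in a..t, k s) : w x = w y := by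
  have hw' := monotone_clampExtend hab hw
  rw [integral_clampExtend_mul hab, integral_monotone_mul_eq hab hw' hk hk0] at h0
  by_contra hne
  have hlt : clampExtend a b w x < clampExtend a b w y := by
    rw [clampExtend_eq hx, clampExtend_eq hy]
    exact lt_of_le_of_ne (hw hx hy hxy.le) hne
  have hneg : ∀ l, superlevelIntegral (clampExtend a b w) k a b l ≤ 0 := fun l => by
    obtain ⟨c, hc, -, -, h⟩ := superlevelIntegral_eq_neg hab hw' hk hk0 l
    rw [h]
    linarith [hK c hc]
  have hlt0 : ∀ l ∈ Ioo (clampExtend a b w x) (clampExtend a b w y),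
      0 < - superlevelIntegral (clampExtend a b w) k a b l := fun l hl => by
    obtain ⟨c, hc, h1, h2, h⟩ := superlevelIntegral_eq_neg hab hw' hk hk0 l
    rw [h, neg_neg]
    refine hpos c ⟨?_, ?_⟩
    · by_contra hcx
      exact absurd (h2 x hx (not_le.mp hcx)) (not_lt.mpr hl.1.le)
    · by_contra hcy
      exact absurd (h1 y hy (not_le.mp hcy)) (not_le.mpr hl.2)
  have hint := intervalIntegrable_superlevelIntegral hab hw' hk
  have p1 := intervalIntegral.intervalIntegral_pos_of_pos_on (hint _ _).neg hlt0 hlt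
  have p2 : 0 ≤ ∫ l in clampExtend a b w a..clampExtend a b w x,
      - superlevelIntegral (clampExtend a b w) k a b l :=
    intervalIntegral.integral_nonneg (hw' hx.1) fun l _ => by linarith [hneg l]
  have p3 : 0 ≤ ∫ l in clampExtend a b w y..clampExtend a b w b,
      - superlevelIntegral (clampExtend a b w) k a b l :=
    intervalIntegral.integral_nonneg (hw' hy.2) fun l _ => by linarith [hneg l]
  have s1 := intervalIntegral.integral_add_adjacent_intervals
    (hint (clampExtend a b w a) (clampExtend a b w x)) (hint _ (clampExtend a b w y))
  have s2 := intervalIntegral.integral_add_adjacent_intervals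
    (hint (clampExtend a b w a) (clampExtend a b w y)) (hint _ (clampExtend a b w b))
  simp only [Pi.neg_apply, intervalIntegral.integral_neg] at p1 p2 p3
  linarith

end Weights

/-! ### Recovering a function from bounds on its increments -/

/-- A function whose increments are squeezed between values of `ρ` is a primitive of the diagonal
of `ρ`. -/
theorem sub_eq_integral_of_squeeze {a b : ℝ} {q : ℝ → ℝ} {ρ : ℝ → ℝ → ℝ}
    (hρ : ContinuousOn (Function.uncurry ρ) (Icc a b ×ˢ Icc a b))
    (h : ∀ x ∈ Icc a b, ∀ y ∈ Icc a b, x < y → ∃ t ∈ Icc x y, ∃ u ∈ Icc x y,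
      ρ t x * (y - x) ≤ q y - q x ∧ q y - q x ≤ ρ u y * (y - x)) {y : ℝ} (hy : y ∈ Icc a b) :
    q y - q a = ∫ t in a..y, ρ t t := by
  have hab : a ≤ b := hy.1.trans hy.2
  -- Both bounds on the difference quotient are values of ρ at points near (x, x), so joint
  -- continuity of ρ gives the derivative.
  have hder : ∀ x ∈ Icc a b, HasDerivWithinAt q (ρ x x) (Icc a b) x := by
    intro x hx
    rw [hasDerivWithinAt_iff_isLittleO, Asymptotics.isLittleO_iff]
    intro c hc
    obtain ⟨d, hd, hcont⟩ := Metric.continuousWithinAt_iff.mp (hρ (x, x) ⟨hx, hx⟩) c hc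
    have hclose : ∀ t ∈ Icc a b, ∀ s ∈ Icc a b, |t - x| < d → |s - x| < d →
        |ρ t s - ρ x x| < c := by
      intro t ht s hs htd hsd
      have := hcont (x := (t, s)) ⟨ht, hs⟩ (by
        rw [Prod.dist_eq, Real.dist_eq, Real.dist_eq]; exact max_lt htd hsd)
      rwa [Real.dist_eq] at this
    filter_upwards [self_mem_nhdsWithin,
      mem_nhdsWithin_of_mem_nhds (Metric.ball_mem_nhds x hd)] with z hz hzd
    rw [Metric.mem_ball, Real.dist_eq] at hzd
    simp only [smul_eq_mul, Real.norm_eq_abs]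
    have hx0 : |x - x| < d := by simpa using hd
    rcases lt_trichotomy x z with hlt | heq | hlt
    · obtain ⟨t, ht, u, hu, h1, h2⟩ := h x hx z hz hlt
      rw [abs_of_pos (by linarith)] at hzd
      have b1 := hclose t ⟨hx.1.trans ht.1, ht.2.trans hz.2⟩ x hx
        (by rw [abs_of_nonneg (by linarith [ht.1])]; linarith [ht.2]) hx0
      have b2 := hclose u ⟨hx.1.trans hu.1, hu.2.trans hz.2⟩ z hz
        (by rw [abs_of_nonneg (by linarith [hu.1])]; linarith [hu.2])
        (by rw [abs_of_nonneg (by linarith)]; linarith)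
      rw [abs_lt] at b1 b2
      rw [abs_of_pos (show 0 < z - x by linarith), abs_le]
      constructor <;> nlinarith
    · subst heq; simp
    · obtain ⟨t, ht, u, hu, h1, h2⟩ := h z hz x hx hlt
      rw [abs_of_neg (by linarith)] at hzd
      have b1 := hclose t ⟨hz.1.trans ht.1, ht.2.trans hx.2⟩ z hz
        (by rw [abs_of_nonpos (by linarith [ht.2])]; linarith [ht.1])
        (by rw [abs_of_nonpos (by linarith)]; linarith)
      have b2 := hclose u ⟨hz.1.trans hu.1, hu.2.trans hx.2⟩ x hx
        (by rw [abs_of_nonpos (by linarith [hu.2])]; linarith [hu.1]) hx0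
      rw [abs_lt] at b1 b2
      rw [abs_of_neg (show z - x < 0 by linarith), abs_le]
      constructor <;> nlinarith
  have hr : ContinuousOn (fun t => ρ t t) (Icc a b) :=
    hρ.comp (f := fun t => (t, t)) (by fun_prop) fun t ht => ⟨ht, ht⟩
  symm
  refine intervalIntegral.integral_eq_sub_of_hasDeriv_right_of_le hy.1
    (fun x hx => ((hder x ⟨hx.1, hx.2.trans hy.2⟩).continuousWithinAt).mono
      (Icc_subset_Icc_right hy.2)) (fun x hx => ?_) ?_
  · have hxI : x ∈ Icc a b := ⟨hx.1.le, hx.2.le.trans hy.2⟩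
    exact ((hder x hxI).hasDerivAt (Icc_mem_nhds hx.1 (hx.2.trans_le hy.2))).hasDerivWithinAt
  · exact (hr.mono (by rw [uIcc_of_le hy.1]; exact Icc_subset_Icc_right hy.2)).intervalIntegrable

/-- A function with a continuous selection of subgradients is a primitive of it. -/
theorem sub_eq_integral_of_subgradient {a b : ℝ} {q r : ℝ → ℝ} (hr : ContinuousOn r (Icc a b))
    (h : ∀ x ∈ Icc a b, ∀ y ∈ Icc a b, r x * (y - x) ≤ q y - q x) {y : ℝ} (hy : y ∈ Icc a b) :
    q y - q a = ∫ t in a..y, r t := by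
  refine sub_eq_integral_of_squeeze (ρ := fun _ x => r x)
    (hr.comp continuousOn_snd fun p hp => hp.2) (fun x hx y hy hxy => ?_) hy
  exact ⟨x, ⟨le_rfl, hxy.le⟩, x, ⟨le_rfl, hxy.le⟩, h x hx y hy, by linarith [h y hy x hx]⟩

/-- The inverse of a strictly increasing continuous function on an interval is continuous. -/
theorem StrictMonoOn.continuousOn_rightInverse {a b : ℝ} {T R : ℝ → ℝ}
    (hT : StrictMonoOn T (Icc a b)) (hR : ∀ y ∈ Icc (T a) (T b), R y ∈ Icc a b ∧ T (R y) = y) :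
    ContinuousOn R (Icc (T a) (T b)) := by
  intro y hy
  refine tendsto_order.mpr ⟨fun l hl => ?_, fun l hl => ?_⟩
  · rcases lt_or_ge l a with h | h
    · filter_upwards [self_mem_nhdsWithin] with z hz
      exact h.trans_le (hR z hz).1.1
    · have hlI : l ∈ Icc a b := ⟨h, hl.le.trans (hR y hy).1.2⟩
      have hlt : T l < y := by
        have := hT hlI (hR y hy).1 hl
        rwa [(hR y hy).2] at this
      filter_upwards [self_mem_nhdsWithin, mem_nhdsWithin_of_mem_nhds (Ioi_mem_nhds hlt)]
        with z hz hz'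
      rw [← hT.lt_iff_lt hlI (hR z hz).1, (hR z hz).2]
      exact hz'
  · rcases lt_or_ge b l with h | h
    · filter_upwards [self_mem_nhdsWithin] with z hz
      exact (hR z hz).1.2.trans_lt h
    · have hlI : l ∈ Icc a b := ⟨(hR y hy).1.1.trans hl.le, h⟩
      have hlt : y < T l := by
        have := hT (hR y hy).1 hlI hl
        rwa [(hR y hy).2] at this
      filter_upwards [self_mem_nhdsWithin, mem_nhdsWithin_of_mem_nhds (Iio_mem_nhds hlt)]
        with z hz hz'
      rw [← hT.lt_iff_lt (hR z hz).1 hlI, (hR z hz).2]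
      exact hz'

/-! ### Generalized isotonic regression on an interval -/

/-- Data of a generalized isotonic regression: find an increasing `w` such that the integral of
`(S t - D t (w t)) * f t` over `[a, x]` is nonpositive, vanishes at `b`, and `w` is constant where
it is negative. -/
structure IroningProblem where
  a : ℝ
  b : ℝ
  hab : a < b
  f : ℝ → ℝ
  S : ℝ → ℝ
  D : ℝ → ℝ → ℝ
  lo : ℝ
  hi : ℝ
  hf : Continuous f
  hS : Continuous S
  hD : Continuous (Function.uncurry D)
  hf0 : ∀ x ∈ Icc a b, 0 < f x
  hDanti : ∀ x, StrictAnti (D x)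
  hlo : ∀ x ∈ Icc a b, S x < D x lo
  hhi : ∀ x ∈ Icc a b, D x hi < S x

namespace IroningProblem

variable (P : IroningProblem)

/-- The objective at a constant level `l`. -/
noncomputable def obj (l x : ℝ) : ℝ := ∫ t in P.a..x, (P.S t - P.D t l) * P.f t

theorem continuous_integrand : Continuous (Function.uncurry fun l t : ℝ =>
    (P.S t - P.D t l) * P.f t) := by
  have h1 : Continuous fun p : ℝ × ℝ => P.D p.2 p.1 :=
    P.hD.comp (continuous_snd.prodMk continuous_fst)
  exact ((P.hS.comp continuous_snd).sub h1).mul (P.hf.comp continuous_snd)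

theorem continuous_integrand_level (l : ℝ) : Continuous fun t : ℝ =>
    (P.S t - P.D t l) * P.f t :=
  P.continuous_integrand.comp (continuous_const.prodMk continuous_id)

theorem continuous_obj : Continuous (Function.uncurry P.obj) := by
  have h : Continuous (Function.uncurry fun (p : ℝ × ℝ) t => (P.S t - P.D t p.1) * P.f t) :=
    P.continuous_integrand.comp
      ((continuous_fst.comp continuous_fst).prodMk continuous_snd)
  exact intervalIntegral.continuous_parametric_intervalIntegral_of_continuous h continuous_snd

theorem obj_sub (l x y : ℝ) :
    P.obj l y - P.obj l x = ∫ t in x..y, (P.S t - P.D t l) * P.f t :=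
  intervalIntegral.integral_interval_sub_left
    ((P.continuous_integrand_level l).intervalIntegrable _ _)
    ((P.continuous_integrand_level l).intervalIntegrable _ _)

theorem hasDerivAt_obj (l x : ℝ) : HasDerivAt (P.obj l) ((P.S x - P.D x l) * P.f x) x :=
  intervalIntegral.integral_hasDerivAt_right
    ((P.continuous_integrand_level l).intervalIntegrable _ _)
    ((P.continuous_integrand_level l).stronglyMeasurableAtFilter _ _)
    (P.continuous_integrand_level l).continuousAt

/-- `s` maximizes the objective at level `l`. -/
def IsArgmax (l s : ℝ) : Prop := s ∈ Icc P.a P.b ∧ ∀ t ∈ Icc P.a P.b, P.obj l t ≤ P.obj l s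

theorem exists_isArgmax (l : ℝ) : ∃ s, P.IsArgmax l s := by
  have hc : Continuous (P.obj l) := P.continuous_obj.comp (continuous_const.prodMk continuous_id)
  obtain ⟨s, hs, h⟩ := isCompact_Icc.exists_isMaxOn (nonempty_Icc.mpr P.hab.le) hc.continuousOn
  exact ⟨s, hs, fun t ht => h ht⟩

theorem isClosed_isArgmax : IsClosed {p : ℝ × ℝ | P.IsArgmax p.1 p.2} := by
  have : {p : ℝ × ℝ | P.IsArgmax p.1 p.2} = {p : ℝ × ℝ | p.2 ∈ Icc P.a P.b} ∩
      ⋂ t ∈ Icc P.a P.b, {p : ℝ × ℝ | P.obj p.1 t ≤ P.obj p.1 p.2} := by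
    ext p
    simp [IsArgmax]
  rw [this]
  refine (isClosed_Icc.preimage continuous_snd).inter (isClosed_biInter fun t _ => ?_)
  exact isClosed_le (P.continuous_obj.comp (continuous_fst.prodMk continuous_const))
    P.continuous_obj

/-- Compactness of K turns a limit of levels into a limit of maximizers along a subsequence. It lets
maximizers be carried to the supremum that defines `sol`. -/
theorem isClosed_levels {K : Set ℝ} (hK : IsCompact K) :
    IsClosed {l | ∃ s ∈ K, P.IsArgmax l s} := by
  refine IsSeqClosed.isClosed fun u l hu hl => ?_
  choose s hsK hs using hu
  obtain ⟨s0, hs0, φ, hφ, hlim⟩ := hK.tendsto_subseq hsK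
  refine ⟨s0, hs0, ?_⟩
  exact P.isClosed_isArgmax.mem_of_tendsto ((hl.comp hφ.tendsto_atTop).prodMk_nhds hlim)
    (Filter.Eventually.of_forall fun n => hs (φ n))

theorem integrand_lt {l l' t : ℝ} (hl : l < l') (ht : t ∈ Icc P.a P.b) :
    (P.S t - P.D t l) * P.f t < (P.S t - P.D t l') * P.f t :=
  mul_lt_mul_of_pos_right (by linarith [P.hDanti t hl]) (P.hf0 t ht)

/-- Monotone comparative statics: a higher level lowers D and so raises the integrand strictly. The
gain from moving right is then strictly larger, and no maximizer at the higher level lies left of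
one at the lower level. -/
theorem IsArgmax.le_of_lt {P : IroningProblem} {l l' s s' : ℝ} (h : P.IsArgmax l s)
    (h' : P.IsArgmax l' s') (hl : l < l') : s ≤ s' := by
  by_contra hs
  rw [not_le] at hs
  have h1 : 0 ≤ P.obj l s - P.obj l s' := sub_nonneg.mpr (h.2 s' h'.1)
  have h2 : P.obj l' s - P.obj l' s' ≤ 0 := sub_nonpos.mpr (h'.2 s h.1)
  rw [P.obj_sub] at h1 h2
  have h3 : ∫ t in s'..s, (P.S t - P.D t l) * P.f t < ∫ t in s'..s, (P.S t - P.D t l') * P.f t := by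
    refine intervalIntegral.integral_lt_integral_of_continuousOn_of_le_of_exists_lt hs
      (P.continuous_integrand_level l).continuousOn (P.continuous_integrand_level l').continuousOn
      (fun t ht => ?_) ⟨s, right_mem_Icc.mpr hs.le, P.integrand_lt hl h.1⟩
    exact (P.integrand_lt hl ⟨h'.1.1.trans ht.1.le, ht.2.trans h.1.2⟩).le
  linarith

/-- First-order condition. As D(s, ·) is strictly decreasing, an interior point maximizes at no more
than one level, which is what excludes jumps of `sol`. -/
theorem IsArgmax.eq_of_mem_Ioo {P : IroningProblem} {l s : ℝ} (h : P.IsArgmax l s)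
    (hs : s ∈ Ioo P.a P.b) : P.S s = P.D s l := by
  have hmax : IsLocalMax (P.obj l) s := by
    filter_upwards [Icc_mem_nhds hs.1 hs.2] with t ht
    exact h.2 t ht
  have := hmax.hasDerivAt_eq_zero (P.hasDerivAt_obj l s)
  rcases mul_eq_zero.mp this with h' | h'
  · linarith
  · exact absurd h' (P.hf0 s h.1).ne'

theorem isArgmax_lo : P.IsArgmax P.lo P.a := by
  refine ⟨left_mem_Icc.mpr P.hab.le, fun t ht => ?_⟩
  rw [← sub_nonpos, P.obj_sub]
  have : 0 ≤ ∫ s in P.a..t, -((P.S s - P.D s P.lo) * P.f s) := by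
    refine intervalIntegral.integral_nonneg ht.1 fun s hs => ?_
    have hs' : s ∈ Icc P.a P.b := ⟨hs.1, hs.2.trans ht.2⟩
    nlinarith [P.hf0 s hs', P.hlo s hs']
  rw [intervalIntegral.integral_neg] at this
  linarith

theorem IsArgmax.eq_right {P : IroningProblem} {s : ℝ} (h : P.IsArgmax P.hi s) : s = P.b := by
  by_contra hne
  have hsb : s < P.b := lt_of_le_of_ne h.1.2 hne
  have h1 := sub_nonpos.mpr (h.2 P.b (right_mem_Icc.mpr P.hab.le))
  rw [P.obj_sub] at h1
  have : 0 < ∫ t in s..P.b, (P.S t - P.D t P.hi) * P.f t := by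
    refine intervalIntegral.intervalIntegral_pos_of_pos_on
      ((P.continuous_integrand_level _).intervalIntegrable _ _) (fun t ht => ?_) hsb
    have ht' : t ∈ Icc P.a P.b := ⟨h.1.1.trans ht.1.le, ht.2.le⟩
    exact mul_pos (by linarith [P.hhi t ht']) (P.hf0 t ht')
  linarith

/-! ### The solution as a supremum of levels, and its continuity -/

/-- The levels at which some maximizer other than `b` lies to the left of `x`. -/
def levels (x : ℝ) : Set ℝ := {l | ∃ s, P.IsArgmax l s ∧ s ≤ x ∧ s < P.b}

/-- The solution of the isotonic regression. -/
noncomputable def sol (x : ℝ) : ℝ := sSup (P.levels x)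

/-- At level `hi` the only maximizer is b, and above it maximizers cannot move back. The clause `s <
P.b` in `levels` discards b itself, without which the supremum at x = b would run over arbitrarily
high levels. -/
theorem bddAbove_levels (x : ℝ) : BddAbove (P.levels x) := by
  refine ⟨P.hi, ?_⟩
  rintro l ⟨s, hs, -, hsb⟩
  by_contra hl
  obtain ⟨s', hs'⟩ := P.exists_isArgmax P.hi
  have := hs'.le_of_lt hs (not_le.mp hl)
  rw [hs'.eq_right] at this
  linarith

theorem lo_mem_levels {x : ℝ} (hx : P.a ≤ x) : P.lo ∈ P.levels x :=
  ⟨P.a, P.isArgmax_lo, hx, P.hab⟩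

theorem le_sol {l s x : ℝ} (h : P.IsArgmax l s) (hsx : s ≤ x) (hsb : s < P.b) : l ≤ P.sol x :=
  le_csSup (P.bddAbove_levels x) ⟨s, h, hsx, hsb⟩

theorem sol_le {l s x : ℝ} (hx : P.a ≤ x) (h : P.IsArgmax l s) (hxs : x < s) : P.sol x ≤ l := by
  refine csSup_le ⟨_, P.lo_mem_levels hx⟩ ?_
  rintro l' ⟨s', hs', hs'x, -⟩
  by_contra hl
  have := h.le_of_lt hs' (not_le.mp hl)
  linarith

theorem sol_eq {l s s' x : ℝ} (h : P.IsArgmax l s) (h' : P.IsArgmax l s') (hx : s ≤ x)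
    (hx' : x < s') : P.sol x = l :=
  le_antisymm (P.sol_le (h.1.1.trans hx) h' hx') (P.le_sol h hx ((hx.trans_lt hx').trans_le h'.1.2))

theorem sol_mono {x y : ℝ} (hx : P.a ≤ x) (hxy : x ≤ y) : P.sol x ≤ P.sol y := by
  refine csSup_le ⟨_, P.lo_mem_levels hx⟩ ?_
  rintro l ⟨s, hs, hsx, hsb⟩
  exact P.le_sol hs (hsx.trans hxy) hsb

theorem le_of_sol_lt {l s x : ℝ} (hx : x ≤ P.b) (hl : P.sol x < l) (h : P.IsArgmax l s) :
    x ≤ s ∧ (x < P.b → x < s) := by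
  have key : ∀ _ : s ≤ x, ¬ s < P.b := fun hsx hsb => absurd (P.le_sol h hsx hsb) (not_le.mpr hl)
  constructor
  · by_contra hs
    exact key (not_le.mp hs).le ((not_le.mp hs).trans_le hx)
  · intro hxb
    by_contra hs
    exact key (not_lt.mp hs) ((not_lt.mp hs).trans_lt hxb)

/-- With `exists_isArgmax_right`, this places a maximizer at level w(x) on each side of x. Levels in
`levels x` have maximizers at or left of x, levels above the supremum have them at or right of x,
and both properties survive the limit. Between two such maximizers w is constant by `sol_eq`, except
possibly at the right one. -/
theorem exists_isArgmax_left {x : ℝ} (hx : x ∈ Icc P.a P.b) :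
    ∃ s ≤ x, P.IsArgmax (P.sol x) s := by
  have hcl := P.isClosed_levels (isCompact_Icc (a := P.a) (b := x))
  have hmem : P.sol x ∈ closure (P.levels x) :=
    csSup_mem_closure ⟨_, P.lo_mem_levels hx.1⟩ (P.bddAbove_levels x)
  have hsub : P.levels x ⊆ {l | ∃ s ∈ Icc P.a x, P.IsArgmax l s} := by
    rintro l ⟨s, hs, hsx, -⟩
    exact ⟨s, ⟨hs.1.1, hsx⟩, hs⟩
  obtain ⟨s, hs, h⟩ := closure_minimal hsub hcl hmem
  exact ⟨s, hs.2, h⟩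

theorem exists_isArgmax_right {x : ℝ} (hx : x ∈ Icc P.a P.b) :
    ∃ s, x ≤ s ∧ P.IsArgmax (P.sol x) s := by
  have hcl := P.isClosed_levels (isCompact_Icc (a := x) (b := P.b))
  have hmem : P.sol x ∈ closure (Ioi (P.sol x)) := by
    rw [closure_Ioi]; exact self_mem_Ici
  have hsub : Ioi (P.sol x) ⊆ {l | ∃ s ∈ Icc x P.b, P.IsArgmax l s} := by
    intro l hl
    obtain ⟨s, hs⟩ := P.exists_isArgmax l
    exact ⟨s, ⟨(P.le_of_sol_lt hx.2 hl hs).1, hs.1.2⟩, hs⟩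
  obtain ⟨s, hs, h⟩ := closure_minimal hsub hcl hmem
  exact ⟨s, hs.1, h⟩

/-- A jump from below at x would make x a maximizer at a whole range of levels, against the
first-order condition. From above, each level m > w(x) has a maximizer strictly right of x when x <
b, and w ≤ m up to that maximizer. At the two ends the missing side is supplied by monotonicity. -/
theorem continuousOn_sol : ContinuousOn P.sol (Icc P.a P.b) := by
  intro x hx
  refine tendsto_order.mpr ⟨fun l hl => ?_, fun l hl => ?_⟩
  · have : ∃ s < x, ∀ y, s ≤ y → l < P.sol y ∨ x = P.a := by
      rcases hx.1.eq_or_lt with h | hax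
      · exact ⟨x - 1, by linarith, fun y _ => Or.inr h.symm⟩
      obtain ⟨l', ⟨s', hs', hs'x, hs'b⟩, hl'⟩ := exists_lt_of_lt_csSup
        ⟨_, P.lo_mem_levels hx.1⟩ hl
      rcases hs'x.lt_or_eq with h | h
      · exact ⟨s', h, fun y hy => Or.inl (hl'.trans_le (P.le_sol hs' hy hs'b))⟩
      · obtain ⟨m, hm, hm'⟩ := exists_between hl'
        obtain ⟨s, hs⟩ := P.exists_isArgmax m
        have hss : s ≤ s' := hs.le_of_lt hs' hm'
        rcases hss.lt_or_eq with h2 | h2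
        · exact ⟨s, h ▸ h2, fun y hy => Or.inl (hm.trans_le (P.le_sol hs hy (h2.trans hs'b)))⟩
        -- The interior point x would maximize at the two distinct levels m and l'.
        · exfalso
          subst h2
          have hi : s ∈ Ioo P.a P.b := ⟨h ▸ hax, hs'b⟩
          have e1 := hs.eq_of_mem_Ioo hi
          have e2 := hs'.eq_of_mem_Ioo hi
          have := P.hDanti s hm'
          linarith
    obtain ⟨s, hsx, h⟩ := this
    filter_upwards [self_mem_nhdsWithin, mem_nhdsWithin_of_mem_nhds (Ioi_mem_nhds hsx)]
      with y hy hsy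
    rcases h y (le_of_lt hsy) with h' | h'
    · exact h'
    · exact hl.trans_le (P.sol_mono hx.1 (h' ▸ hy.1))
  · rcases hx.2.lt_or_eq with hxb | hxb
    · obtain ⟨m, hm, hm'⟩ := exists_between hl
      obtain ⟨s, hs⟩ := P.exists_isArgmax m
      have hxs := (P.le_of_sol_lt hx.2 hm hs).2 hxb
      filter_upwards [self_mem_nhdsWithin, mem_nhdsWithin_of_mem_nhds (Iio_mem_nhds hxs)]
        with y hy hys
      exact (P.sol_le hy.1 hs hys).trans_lt hm'
    · filter_upwards [self_mem_nhdsWithin] with y hy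
      exact (P.sol_mono hy.1 (hxb ▸ hy.2)).trans_lt hl

/-- The solution, extended continuously to the whole line. -/
noncomputable def solExt : ℝ → ℝ := clampExtend P.a P.b P.sol

theorem solExt_eq {x : ℝ} (hx : x ∈ Icc P.a P.b) : P.solExt x = P.sol x := clampExtend_eq hx

theorem continuous_solExt : Continuous P.solExt :=
  continuous_clampExtend P.hab.le P.continuousOn_sol

theorem monotone_solExt : Monotone P.solExt :=
  monotone_clampExtend P.hab.le fun _ hx _ _ hxy => P.sol_mono hx.1 hxy

/-- The allocation `D x (w x)` that belongs to the solution `w`. -/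
noncomputable def alloc (x : ℝ) : ℝ := P.D x (P.solExt x)

theorem continuous_alloc : Continuous P.alloc :=
  P.hD.comp (continuous_id.prodMk P.continuous_solExt)

/-- The cumulated difference between the data and the allocation. -/
noncomputable def cumul (x : ℝ) : ℝ := ∫ t in P.a..x, (P.S t - P.alloc t) * P.f t

theorem continuous_cumul_integrand : Continuous fun t => (P.S t - P.alloc t) * P.f t :=
  (P.hS.sub P.continuous_alloc).mul P.hf

theorem hasDerivAt_cumul (x : ℝ) : HasDerivAt P.cumul ((P.S x - P.alloc x) * P.f x) x :=
  intervalIntegral.integral_hasDerivAt_right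
    (P.continuous_cumul_integrand.intervalIntegrable _ _)
    (P.continuous_cumul_integrand.stronglyMeasurableAtFilter _ _)
    P.continuous_cumul_integrand.continuousAt

theorem cumul_sub (x y : ℝ) :
    P.cumul y - P.cumul x = ∫ t in x..y, (P.S t - P.alloc t) * P.f t :=
  intervalIntegral.integral_interval_sub_left
    (P.continuous_cumul_integrand.intervalIntegrable _ _)
    (P.continuous_cumul_integrand.intervalIntegrable _ _)

/-! ### The shortfall from optimality equals the cumulated difference -/

/-- The shortfall of `x` from the maximal objective at level `w x`. -/
noncomputable def gap (x : ℝ) : ℝ :=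
  P.obj (P.solExt x) x - sSup (P.obj (P.solExt x) '' Icc P.a P.b)

theorem IsArgmax.sSup_eq {P : IroningProblem} {l s : ℝ} (h : P.IsArgmax l s) :
    sSup (P.obj l '' Icc P.a P.b) = P.obj l s := by
  refine IsGreatest.csSup_eq ⟨⟨s, h.1, rfl⟩, ?_⟩
  rintro _ ⟨t, ht, rfl⟩
  exact h.2 t ht

theorem continuous_gap : Continuous P.gap := by
  have h1 : Continuous fun l => sSup (P.obj l '' Icc P.a P.b) :=
    isCompact_Icc.continuous_sSup P.continuous_obj
  exact (P.continuous_obj.comp (P.continuous_solExt.prodMk continuous_id)).sub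
    (h1.comp P.continuous_solExt)

theorem gap_eq {x s : ℝ} (hx : x ∈ Icc P.a P.b) (h : P.IsArgmax (P.sol x) s) :
    P.gap x = P.obj (P.sol x) x - P.obj (P.sol x) s := by
  rw [gap, P.solExt_eq hx, h.sSup_eq]

theorem gap_nonpos {x : ℝ} (hx : x ∈ Icc P.a P.b) : P.gap x ≤ 0 := by
  obtain ⟨s, -, h⟩ := P.exists_isArgmax_left hx
  rw [P.gap_eq hx h]
  linarith [h.2 x hx]

theorem integral_const_level {l x y : ℝ} (hxy : x ≤ y) (hx : P.a ≤ x) (hy : y ≤ P.b)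
    (h : ∀ t ∈ Ico x y, P.sol t = l) :
    P.obj l y - P.obj l x = P.cumul y - P.cumul x := by
  rw [P.obj_sub, P.cumul_sub]
  rw [intervalIntegral.integral_of_le hxy, intervalIntegral.integral_of_le hxy,
    integral_Ioc_eq_integral_Ioo, integral_Ioc_eq_integral_Ioo]
  refine setIntegral_congr_fun measurableSet_Ioo fun t ht => ?_
  simp only [alloc]
  rw [P.solExt_eq ⟨hx.trans ht.1.le, ht.2.le.trans hy⟩, h t ⟨ht.1.le, ht.2⟩]

theorem alloc_eq_of_isArgmax {x : ℝ} (hx : x ∈ Ioo P.a P.b) (h : P.IsArgmax (P.sol x) x) :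
    P.alloc x = P.S x := by
  rw [alloc, P.solExt_eq (Ioo_subset_Icc_self hx), h.eq_of_mem_Ioo hx]

/-- If `w` increases immediately to the right of `x`, then arbitrarily close to the right of `x`
there are maximizers at their own level. -/
theorem exists_isArgmax_between {x y : ℝ} (hx : P.a ≤ x) (hxy : x < y) (hy : y ≤ P.b)
    (h : P.sol x < P.sol y) :
    ∃ s, x < s ∧ s ≤ y ∧ P.IsArgmax (P.sol y) s ∧ P.gap y = P.cumul y - P.cumul s ∧
      (y < P.b → P.alloc s = P.S s) := by
  have hyI : y ∈ Icc P.a P.b := ⟨hx.trans hxy.le, hy⟩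
  obtain ⟨s, hsy, hs⟩ := P.exists_isArgmax_left hyI
  obtain ⟨s', hs'y, hs'⟩ := P.exists_isArgmax_right hyI
  have hxs : x < s := (P.le_of_sol_lt (hxy.le.trans hy) h hs).2 (hxy.trans_le hy)
  -- The points of [s, y) lie between two maximizers at the level of y. There the objective at that
  -- level and `cumul` have equal increments.
  have hconst : ∀ t ∈ Ico s y, P.sol t = P.sol y := fun t ht =>
    P.sol_eq hs hs' ht.1 (ht.2.trans_le hs'y)
  refine ⟨s, hxs, hsy, hs, ?_, fun hyb => ?_⟩
  · rw [P.gap_eq hyI hs]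
    exact P.integral_const_level hsy hs.1.1 hy hconst
  · have hsol : P.sol s = P.sol y := by
      rcases hsy.lt_or_eq with h' | h'
      · exact hconst s ⟨le_rfl, h'⟩
      · rw [h']
    exact P.alloc_eq_of_isArgmax ⟨hx.trans_lt hxs, hsy.trans_lt hyb⟩ (hsol ▸ hs)

/-- If w is constant just to the right of x, the maximum does not change there and `gap` moves with
`cumul`. Otherwise points s at which S = `alloc` accumulate at x from the right. Then x maximizes at
its own level and the claimed derivative is zero. It is attained because gap(y) is an increment of
`cumul` over an interval [s, y] inside (x, y], hence o(y - x). -/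
theorem hasDerivWithinAt_gap {x : ℝ} (hx : x ∈ Ico P.a P.b) :
    HasDerivWithinAt P.gap ((P.S x - P.alloc x) * P.f x) (Ici x) x := by
  have hxI : x ∈ Icc P.a P.b := ⟨hx.1, hx.2.le⟩
  by_cases hflat : ∃ y, x < y ∧ y ≤ P.b ∧ P.sol y = P.sol x
  · obtain ⟨y, hxy, hyb, hy⟩ := hflat
    have hconst : ∀ t ∈ Icc x y, P.sol t = P.sol x := fun t ht =>
      le_antisymm (hy ▸ P.sol_mono (hx.1.trans ht.1) ht.2) (P.sol_mono hx.1 ht.1)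
    have heq : ∀ t ∈ Icc x y, P.gap t = P.cumul t - P.cumul x + P.gap x := by
      intro t ht
      obtain ⟨s, -, hs⟩ := P.exists_isArgmax_left hxI
      have htI : t ∈ Icc P.a P.b := ⟨hx.1.trans ht.1, ht.2.trans hyb⟩
      rw [P.gap_eq hxI hs, P.gap_eq htI (s := s) ((hconst t ht).symm ▸ hs), hconst t ht,
        ← P.integral_const_level (l := P.sol x) ht.1 hx.1 htI.2
          (fun u hu => hconst u ⟨hu.1, hu.2.le.trans ht.2⟩)]
      ring
    have hd : HasDerivWithinAt (fun t => P.cumul t - P.cumul x + P.gap x)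
        ((P.S x - P.alloc x) * P.f x) (Ici x) x :=
      (((P.hasDerivAt_cumul x).sub_const _).add_const _).hasDerivWithinAt
    refine hd.congr_of_eventuallyEq ?_ (heq x ⟨le_rfl, hxy.le⟩)
    filter_upwards [self_mem_nhdsWithin, mem_nhdsWithin_of_mem_nhds (Iio_mem_nhds hxy)] with t ht ht'
    exact heq t ⟨ht, le_of_lt ht'⟩
  · have hinc : ∀ y, x < y → y ≤ P.b → P.sol x < P.sol y := fun y hxy hyb =>
      lt_of_le_of_ne (P.sol_mono hx.1 hxy.le) fun h => hflat ⟨y, hxy, hyb, h.symm⟩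
    have hgapx : P.gap x = 0 := by
      obtain ⟨s, hsx, hs⟩ := P.exists_isArgmax_left hxI
      obtain ⟨s', hs'x, hs'⟩ := P.exists_isArgmax_right hxI
      have : s' = x := by
        by_contra hne
        have hlt : x < s' := lt_of_le_of_ne hs'x (Ne.symm hne)
        obtain ⟨y, hxy, hys⟩ := exists_between hlt
        have := P.sol_eq hs hs' (hsx.trans hxy.le) hys
        exact absurd this (hinc y hxy (hys.le.trans hs'.1.2)).ne'
      subst this
      rw [P.gap_eq hxI hs', sub_self]
    -- A nonzero value would persist near x, where points with S = `alloc` exist.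
    have hzero : P.S x - P.alloc x = 0 := by
      by_contra hne
      have hev : ∀ᶠ t in nhds x, P.S t - P.alloc t ≠ 0 :=
        (P.hS.sub P.continuous_alloc).continuousAt.eventually_ne hne
      obtain ⟨e, he, hball⟩ := Metric.eventually_nhds_iff.mp hev
      obtain ⟨y, hxy, hy⟩ := exists_between (lt_min hx.2 (show x < x + e by linarith))
      have hyb := hy.trans_le (min_le_left _ _)
      have hye := hy.trans_le (min_le_right _ _)
      obtain ⟨s, hxs, hsy, -, -, hs⟩ :=
        P.exists_isArgmax_between hx.1 hxy hyb.le (hinc y hxy hyb.le)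
      refine hball (y := s) ?_ (by rw [hs hyb, sub_self])
      rw [Real.dist_eq, abs_of_pos (by linarith)]
      linarith
    have hd := P.hasDerivAt_cumul x
    rw [hzero, zero_mul] at hd ⊢
    rw [hasDerivAt_iff_isLittleO, Asymptotics.isLittleO_iff] at hd
    rw [hasDerivWithinAt_iff_isLittleO, Asymptotics.isLittleO_iff]
    intro c hc
    obtain ⟨e, he, hball⟩ := Metric.eventually_nhds_iff.mp (hd (half_pos hc))
    filter_upwards [self_mem_nhdsWithin, mem_nhdsWithin_of_mem_nhds (Iio_mem_nhds hx.2),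
      mem_nhdsWithin_of_mem_nhds (Metric.ball_mem_nhds x he)] with y hxy hyb hye
    rcases (mem_Ici.mp hxy).eq_or_lt with h | hxy
    · subst h; simp
    obtain ⟨s, hxs, hsy, -, hgap, -⟩ :=
      P.exists_isArgmax_between hx.1 hxy (le_of_lt hyb) (hinc y hxy (le_of_lt hyb))
    have b1 := hball (y := y) hye
    have b2 := hball (y := s) (by
      rw [Metric.mem_ball, Real.dist_eq, abs_of_pos (by linarith)] at hye
      rw [Real.dist_eq, abs_of_pos (by linarith)]
      linarith)
    simp only [smul_zero, sub_zero, Real.norm_eq_abs] at b1 b2 ⊢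
    rw [abs_of_pos (show 0 < y - x by linarith)] at b1 ⊢
    rw [abs_of_pos (show 0 < s - x by linarith)] at b2
    rw [hgap, hgapx, sub_zero]
    have : P.cumul y - P.cumul s = (P.cumul y - P.cumul x) - (P.cumul s - P.cumul x) := by ring
    rw [this]
    refine (abs_sub _ _).trans ?_
    nlinarith

theorem gap_a : P.gap P.a = 0 := by
  have ha : P.a ∈ Icc P.a P.b := left_mem_Icc.mpr P.hab.le
  obtain ⟨s, hs, h⟩ := P.exists_isArgmax_left ha
  have : s = P.a := le_antisymm hs h.1.1
  subst this
  rw [P.gap_eq ha h, sub_self]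

theorem gap_b : P.gap P.b = 0 := by
  have hb : P.b ∈ Icc P.a P.b := right_mem_Icc.mpr P.hab.le
  obtain ⟨s, hs, h⟩ := P.exists_isArgmax_right hb
  have : s = P.b := le_antisymm h.1.2 hs
  rw [P.gap_eq hb h, this, sub_self]

/-- Both sides vanish at a and have the same right derivative. This carries the construction: the
right side is visibly nonpositive, vanishes at b, and is zero at any point that maximizes at its own
level. -/
theorem cumul_eq_gap {x : ℝ} (hx : x ∈ Icc P.a P.b) : P.cumul x = P.gap x := by
  refine eq_of_has_deriv_right_eq (f' := fun x => (P.S x - P.alloc x) * P.f x)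
    (fun y _ => (P.hasDerivAt_cumul y).hasDerivWithinAt)
    (fun y hy => P.hasDerivWithinAt_gap hy)
    (fun y _ => (P.hasDerivAt_cumul y).continuousAt.continuousWithinAt)
    P.continuous_gap.continuousOn ?_ x hx
  rw [P.gap_a]
  simp [cumul]

/-- No point of [x, y] maximizes at its own level, since `gap` would vanish there. Let s' be a
maximizer at level w(x) to the right of x. If s' ≤ y, then w is constant on [x, s') and by
continuity at s', so s' maximizes at its own level, which is excluded. Hence s' > y and w does not
change up to y. -/
theorem sol_eq_of_cumul_neg {x y : ℝ} (hx : x ∈ Icc P.a P.b) (hxy : x < y)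
    (h : ∀ t ∈ Icc x y, P.cumul t < 0) : P.sol x = P.sol y := by
  obtain ⟨s, hsx, hs⟩ := P.exists_isArgmax_left hx
  obtain ⟨s', hs'x, hs'⟩ := P.exists_isArgmax_right hx
  have hnot : ∀ t ∈ Icc x y, P.sol t = P.sol x → t ≠ s' := by
    rintro t ht hsol rfl
    have htI : t ∈ Icc P.a P.b := hs'.1
    have := h t ht
    rw [P.cumul_eq_gap htI, P.gap_eq htI (hsol.symm ▸ hs'), sub_self] at this
    exact lt_irrefl _ this
  rcases lt_or_ge y s' with hlt | hge
  · exact (P.sol_eq hs hs' (hsx.trans hxy.le) hlt).symm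
  · exfalso
    have hxs' : x < s' := lt_of_le_of_ne hs'x fun heq => hnot x ⟨le_rfl, hxy.le⟩ rfl heq
    have hclos : s' ∈ closure (Ico x s') := by
      rw [closure_Ico hxs'.ne]; exact right_mem_Icc.mpr hxs'.le
    have hcs : IsClosed {t | P.solExt t = P.sol x} :=
      isClosed_eq P.continuous_solExt continuous_const
    have : s' ∈ {t | P.solExt t = P.sol x} := by
      refine closure_minimal (fun t ht => ?_) hcs hclos
      have htI : t ∈ Icc P.a P.b := ⟨hx.1.trans ht.1, ht.2.le.trans hs'.1.2⟩
      show P.solExt t = P.sol x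
      rw [P.solExt_eq htI]
      exact P.sol_eq hs hs' (hsx.trans ht.1) ht.2
    have hsol : P.sol s' = P.sol x := by rw [← P.solExt_eq hs'.1]; exact this
    exact hnot s' ⟨hs'x, hge⟩ hsol rfl

/-- At a constant level the allocation increases because D(·, l) does. If the level rises from x to
y, take the right maximizer s' at the level of x and the left maximizer r at the level of y. Then s'
≤ r and alloc(x) ≤ S(s') ≤ S(r) = alloc(r) ≤ alloc(y). As x < y, one of the moves x to s', s' to r,
r to y is strict, and so is its inequality. -/
theorem alloc_lt {x y : ℝ} (hx : x ∈ Ioo P.a P.b) (hy : y ∈ Ioo P.a P.b) (hxy : x < y)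
    (hSm : StrictMonoOn P.S (Icc P.a P.b))
    (hDm : ∀ l, StrictMonoOn (fun x => P.D x l) (Icc P.a P.b)) : P.alloc x < P.alloc y := by
  have hxI := Ioo_subset_Icc_self hx
  have hyI := Ioo_subset_Icc_self hy
  have hle : ∀ u ∈ Icc P.a P.b, ∀ v ∈ Icc P.a P.b, u ≤ v → P.sol u = P.sol v →
      P.alloc u ≤ P.alloc v ∧ (u < v → P.alloc u < P.alloc v) := by
    intro u hu v hv huv h
    rw [alloc, alloc, P.solExt_eq hu, P.solExt_eq hv, h]
    exact ⟨(hDm _).monotoneOn hu hv huv, fun h => hDm _ hu hv h⟩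
  rcases (P.sol_mono hx.1.le hxy.le).eq_or_lt with heq | hlt
  · exact (hle x hxI y hyI hxy.le heq).2 hxy
  obtain ⟨s, hsx, hs⟩ := P.exists_isArgmax_left hxI
  obtain ⟨s', hs'x, hs'⟩ := P.exists_isArgmax_right hxI
  obtain ⟨r, hry, hr⟩ := P.exists_isArgmax_left hyI
  obtain ⟨r', hr'y, hr'⟩ := P.exists_isArgmax_right hyI
  have hsr : s' ≤ r := hs'.le_of_lt hr hlt
  have hs'I : s' ∈ Ioo P.a P.b := ⟨hx.1.trans_le hs'x, (hsr.trans hry).trans_lt hy.2⟩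
  have hrI : r ∈ Ioo P.a P.b := ⟨hs'I.1.trans_le hsr, hry.trans_lt hy.2⟩
  have hsolr : P.sol r = P.sol y := by
    rcases hry.eq_or_lt with h | h
    · rw [h]
    · exact P.sol_eq hr hr' le_rfl (h.trans_le hr'y)
  have e1 : P.S s' = P.D s' (P.sol x) := hs'.eq_of_mem_Ioo hs'I
  have e2 : P.alloc r = P.S r := P.alloc_eq_of_isArgmax hrI (hsolr.symm ▸ hr)
  have i1 : P.alloc x ≤ P.S s' := by
    rw [e1, alloc, P.solExt_eq hxI]
    exact (hDm _).monotoneOn hxI (Ioo_subset_Icc_self hs'I) hs'x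
  have i2 : P.S s' ≤ P.S r := hSm.monotoneOn (Ioo_subset_Icc_self hs'I) (Ioo_subset_Icc_self hrI) hsr
  have i3 := hle r (Ioo_subset_Icc_self hrI) y hyI hry hsolr
  rcases hs'x.eq_or_lt with h1 | h1
  · rcases hsr.eq_or_lt with h2 | h2
    · have := i3.2 (by rw [← h2, ← h1]; exact hxy)
      linarith
    · have := hSm (Ioo_subset_Icc_self hs'I) (Ioo_subset_Icc_self hrI) h2
      linarith [i3.1]
  · have : P.alloc x < P.S s' := by
      rw [e1, alloc, P.solExt_eq hxI]
      exact hDm _ hxI (Ioo_subset_Icc_self hs'I) h1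
    linarith [i3.1]

theorem alloc_strictMonoOn (hSm : StrictMonoOn P.S (Icc P.a P.b))
    (hDm : ∀ l, StrictMonoOn (fun x => P.D x l) (Icc P.a P.b)) :
    StrictMonoOn P.alloc (Icc P.a P.b) := by
  have hm : ∀ x ∈ Icc P.a P.b, ∀ y ∈ Ioo P.a P.b, x < y → P.alloc x ≤ P.alloc y := by
    intro x hx y hy hxy
    have hcl : x ∈ closure (Ioo x y) := by
      rw [closure_Ioo hxy.ne]; exact left_mem_Icc.mpr hxy.le
    have hc : IsClosed {t | P.alloc t ≤ P.alloc y} := isClosed_le P.continuous_alloc continuous_const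
    refine closure_minimal (fun t ht => ?_) hc hcl
    exact (P.alloc_lt ⟨hx.1.trans_lt ht.1, ht.2.trans hy.2⟩ hy ht.2 hSm hDm).le
  have hm' : ∀ x ∈ Ioo P.a P.b, ∀ y ∈ Icc P.a P.b, x < y → P.alloc x ≤ P.alloc y := by
    intro x hx y hy hxy
    have hcl : y ∈ closure (Ioo x y) := by
      rw [closure_Ioo hxy.ne]; exact right_mem_Icc.mpr hxy.le
    have hc : IsClosed {t | P.alloc x ≤ P.alloc t} := isClosed_le continuous_const P.continuous_alloc
    refine closure_minimal (fun t ht => ?_) hc hcl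
    exact (P.alloc_lt hx ⟨hx.1.trans ht.1, ht.2.trans_le hy.2⟩ ht.1 hSm hDm).le
  intro x hx y hy hxy
  -- At an endpoint the limit gives only a weak inequality; the strict one comes from two interior
  -- points in between.
  obtain ⟨u, hxu, huy⟩ := exists_between hxy
  obtain ⟨v, huv, hvy⟩ := exists_between huy
  have huI : u ∈ Ioo P.a P.b := ⟨hx.1.trans_lt hxu, huy.trans_le hy.2⟩
  have hvI : v ∈ Ioo P.a P.b := ⟨huI.1.trans huv, hvy.trans_le hy.2⟩
  exact (hm x hx u huI hxu).trans_lt ((P.alloc_lt huI hvI huv hSm hDm).trans_le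
    (hm' v hvI y hy hvy))

theorem cumul_nonpos {x : ℝ} (hx : x ∈ Icc P.a P.b) : P.cumul x ≤ 0 := by
  rw [P.cumul_eq_gap hx]; exact P.gap_nonpos hx

theorem cumul_a : P.cumul P.a = 0 := by simp [cumul]

theorem cumul_b : P.cumul P.b = 0 := by
  rw [P.cumul_eq_gap (right_mem_Icc.mpr P.hab.le), P.gap_b]

/-- Otherwise `cumul`, which starts at zero, would turn positive right of a. Together with
`alloc_b_le` this keeps the matching inside the range of worker types. -/
theorem le_alloc_a : P.S P.a ≤ P.alloc P.a := by
  by_contra h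
  have h0 : 0 < P.S P.a - P.alloc P.a := by linarith [not_le.mp h]
  have hev : ∀ᶠ t in nhds P.a, 0 < P.S t - P.alloc t :=
    (P.hS.sub P.continuous_alloc).continuousAt.eventually (lt_mem_nhds h0)
  obtain ⟨e, he, hball⟩ := Metric.eventually_nhds_iff.mp hev
  obtain ⟨y, hxy, hy⟩ := exists_between (lt_min P.hab (show P.a < P.a + e by linarith))
  have hyb := hy.trans_le (min_le_left _ _)
  have hye := hy.trans_le (min_le_right _ _)
  have hpos : 0 < ∫ t in P.a..y, (P.S t - P.alloc t) * P.f t := by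
    refine intervalIntegral.intervalIntegral_pos_of_pos_on
      (P.continuous_cumul_integrand.intervalIntegrable _ _) (fun t ht => ?_) hxy
    refine mul_pos (hball ?_) (P.hf0 t ⟨ht.1.le, (ht.2.trans hyb).le⟩)
    rw [Real.dist_eq, abs_of_pos (by linarith [ht.1])]
    linarith [ht.2]
  rw [← P.cumul_sub, P.cumul_a] at hpos
  linarith [P.cumul_nonpos ⟨hxy.le, hyb.le⟩]

theorem alloc_b_le : P.alloc P.b ≤ P.S P.b := by
  by_contra h
  have h0 : 0 < P.alloc P.b - P.S P.b := by linarith [not_le.mp h]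
  have hev : ∀ᶠ t in nhds P.b, 0 < P.alloc t - P.S t :=
    (P.continuous_alloc.sub P.hS).continuousAt.eventually (lt_mem_nhds h0)
  obtain ⟨e, he, hball⟩ := Metric.eventually_nhds_iff.mp hev
  obtain ⟨y, hy, hyb⟩ := exists_between (max_lt P.hab (show P.b - e < P.b by linarith))
  have hay := (le_max_left _ _).trans_lt hy
  have hey := (le_max_right _ _).trans_lt hy
  have hpos : 0 < ∫ t in y..P.b, -((P.S t - P.alloc t) * P.f t) := by
    refine intervalIntegral.intervalIntegral_pos_of_pos_on
      (P.continuous_cumul_integrand.neg.intervalIntegrable _ _) (fun t ht => ?_) hyb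
    have h1 : 0 < P.alloc t - P.S t := hball (by
      rw [Real.dist_eq, abs_of_neg (by linarith [ht.2])]
      linarith [ht.1])
    have h2 := P.hf0 t ⟨(hay.trans ht.1).le, ht.2.le⟩
    nlinarith
  rw [intervalIntegral.integral_neg, ← P.cumul_sub, P.cumul_b] at hpos
  linarith [P.cumul_nonpos ⟨hay.le, hyb.le⟩]

end IroningProblem

/-! ### Partial derivatives of the production function -/

theorem HasFDerivWithinAt.hasDerivWithinAt_snd {V : Type*} [NormedAddCommGroup V] [NormedSpace ℝ V]
    {Φ : ℝ × ℝ → V} {A : ℝ × ℝ →L[ℝ] V} {s t : Set ℝ} {x z : ℝ}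
    (h : HasFDerivWithinAt Φ A (s ×ˢ t) (x, z)) (hx : x ∈ s) :
    HasDerivWithinAt (fun u => Φ (x, u)) (A (0, 1)) t z := by
  have hd : HasDerivWithinAt (fun u : ℝ => (x, u)) ((0 : ℝ), (1 : ℝ)) t z :=
    (hasDerivWithinAt_const _ _ _).prodMk (hasDerivWithinAt_id _ _)
  exact h.comp_hasDerivWithinAt z hd fun u hu => mk_mem_prod hx hu

theorem HasFDerivWithinAt.hasDerivWithinAt_fst {V : Type*} [NormedAddCommGroup V] [NormedSpace ℝ V]
    {Φ : ℝ × ℝ → V} {A : ℝ × ℝ →L[ℝ] V} {s t : Set ℝ} {x z : ℝ}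
    (h : HasFDerivWithinAt Φ A (s ×ˢ t) (x, z)) (hz : z ∈ t) :
    HasDerivWithinAt (fun u => Φ (u, z)) (A (1, 0)) s x := by
  have hd : HasDerivWithinAt (fun u : ℝ => (u, z)) ((1 : ℝ), (0 : ℝ)) s x :=
    (hasDerivWithinAt_id _ _).prodMk (hasDerivWithinAt_const _ _ _)
  exact h.comp_hasDerivWithinAt x hd fun u hu => mk_mem_prod hu hz

namespace Economy

variable {E : Economy}

theorem uniqueDiffOn_X (E : Economy) : UniqueDiffOn ℝ E.X := uniqueDiffOn_Icc E.x_lt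

theorem uniqueDiffOn_Y (E : Economy) : UniqueDiffOn ℝ E.Y := uniqueDiffOn_Icc E.y_lt

/-- The smoothness and sign assumptions on the production function. -/
structure Regular (E : Economy) : Prop where
  smooth : ContDiffOn ℝ 2 (fun w : ℝ × ℝ => E.v w.1 w.2) (E.X ×ˢ E.Y)
  vxz_pos : ∀ x ∈ E.X, ∀ z ∈ E.Y, 0 < E.vxz x z
  vzz_neg : ∀ x ∈ E.X, ∀ z ∈ E.Y, E.vzz x z < 0

/-- The full derivative of the production function. -/
noncomputable def dv (E : Economy) (p : ℝ × ℝ) : ℝ × ℝ →L[ℝ] ℝ :=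
  fderivWithin ℝ (fun w : ℝ × ℝ => E.v w.1 w.2) (E.X ×ˢ E.Y) p

namespace Regular

variable (h : E.Regular)
include h

theorem hasFDerivWithinAt {p : ℝ × ℝ} (hp : p ∈ E.X ×ˢ E.Y) :
    HasFDerivWithinAt (fun w : ℝ × ℝ => E.v w.1 w.2) (E.dv p) (E.X ×ˢ E.Y) p :=
  (h.smooth.differentiableOn (by norm_num) p hp).hasFDerivWithinAt

theorem contDiffOn_dv : ContDiffOn ℝ 1 E.dv (E.X ×ˢ E.Y) :=
  h.smooth.fderivWithin (E.uniqueDiffOn_X.prod E.uniqueDiffOn_Y) (by norm_num)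

theorem hasDerivWithinAt_vz {x z : ℝ} (hx : x ∈ E.X) (hz : z ∈ E.Y) :
    HasDerivWithinAt (fun t => E.v x t) (E.vz x z) E.Y z ∧ E.vz x z = E.dv (x, z) (0, 1) := by
  have h1 : HasDerivWithinAt (fun t => E.v x t) (E.dv (x, z) (0, 1)) E.Y z :=
    (h.hasFDerivWithinAt (p := (x, z)) ⟨hx, hz⟩).hasDerivWithinAt_snd hx
  have h2 : E.vz x z = E.dv (x, z) (0, 1) := h1.derivWithin (E.uniqueDiffOn_Y z hz)
  exact ⟨h2 ▸ h1, h2⟩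

theorem hasDerivWithinAt_vx {x z : ℝ} (hx : x ∈ E.X) (hz : z ∈ E.Y) :
    HasDerivWithinAt (fun s => E.v s z) (E.vx x z) E.X x ∧ E.vx x z = E.dv (x, z) (1, 0) := by
  have h1 : HasDerivWithinAt (fun s => E.v s z) (E.dv (x, z) (1, 0)) E.X x :=
    (h.hasFDerivWithinAt (p := (x, z)) ⟨hx, hz⟩).hasDerivWithinAt_fst hz
  have h2 : E.vx x z = E.dv (x, z) (1, 0) := h1.derivWithin (E.uniqueDiffOn_X x hx)
  exact ⟨h2 ▸ h1, h2⟩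

theorem continuousOn_vz : ContinuousOn (fun p : ℝ × ℝ => E.vz p.1 p.2) (E.X ×ˢ E.Y) := by
  refine ContinuousOn.congr (h.contDiffOn_dv.continuousOn.clm_apply
    (continuousOn_const (c := ((0 : ℝ), (1 : ℝ))))) fun p hp => ?_
  exact (h.hasDerivWithinAt_vz hp.1 hp.2).2

theorem continuousOn_vx : ContinuousOn (fun p : ℝ × ℝ => E.vx p.1 p.2) (E.X ×ˢ E.Y) := by
  refine ContinuousOn.congr (h.contDiffOn_dv.continuousOn.clm_apply
    (continuousOn_const (c := ((1 : ℝ), (0 : ℝ))))) fun p hp => ?_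
  exact (h.hasDerivWithinAt_vx hp.1 hp.2).2

theorem hasDerivWithinAt_vzz {x z : ℝ} (hx : x ∈ E.X) (hz : z ∈ E.Y) :
    HasDerivWithinAt (fun t => E.vz x t) (E.vzz x z) E.Y z := by
  have h1 := ((h.contDiffOn_dv.differentiableOn one_ne_zero (x, z)
    ⟨hx, hz⟩).hasFDerivWithinAt).hasDerivWithinAt_snd hx
  have h2 := h1.clm_apply (hasDerivWithinAt_const z E.Y ((0 : ℝ), (1 : ℝ)))
  have h3 := h2.congr (f₁ := fun t => E.vz x t)
    (fun t ht => (h.hasDerivWithinAt_vz hx ht).2) (h.hasDerivWithinAt_vz hx hz).2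
  have h4 := h3.derivWithin (E.uniqueDiffOn_Y z hz)
  rw [← h4] at h3
  exact h3

/-- Equality of mixed partial derivatives. -/
theorem hasDerivWithinAt_vxz {x z : ℝ} (hx : x ∈ E.X) (hz : z ∈ E.Y) :
    HasDerivWithinAt (fun s => E.vz s z) (E.vxz x z) E.X x := by
  have hd := (h.contDiffOn_dv.differentiableOn one_ne_zero (x, z) ⟨hx, hz⟩).hasFDerivWithinAt
  have h1 := (hd.hasDerivWithinAt_snd hx).clm_apply
    (hasDerivWithinAt_const z E.Y ((1 : ℝ), (0 : ℝ)))
  have h2 := h1.congr (f₁ := fun t => E.vx x t)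
    (fun t ht => (h.hasDerivWithinAt_vx hx ht).2) (h.hasDerivWithinAt_vx hx hz).2
  have h3 := h2.derivWithin (E.uniqueDiffOn_Y z hz)
  have k1 := (hd.hasDerivWithinAt_fst hz).clm_apply
    (hasDerivWithinAt_const x E.X ((0 : ℝ), (1 : ℝ)))
  have k2 := k1.congr (f₁ := fun s => E.vz s z)
    (fun s hs => (h.hasDerivWithinAt_vz hs hz).2) (h.hasDerivWithinAt_vz hx hz).2
  -- Symmetry of the second derivative holds at boundary points too, because they are limits of
  -- interior points of the rectangle.
  have hcl : (x, z) ∈ closure (interior (E.X ×ˢ E.Y)) := by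
    rw [interior_prod_eq, closure_prod_eq]
    simp only [X, Y, interior_Icc, closure_Ioo E.x_lt.ne, closure_Ioo E.y_lt.ne]
    exact ⟨hx, hz⟩
  have hsymm := (h.smooth (x, z) ⟨hx, hz⟩).isSymmSndFDerivWithinAt (by simp)
    (E.uniqueDiffOn_X.prod E.uniqueDiffOn_Y) hcl ⟨hx, hz⟩
  have heq := hsymm ((1 : ℝ), (0 : ℝ)) ((0 : ℝ), (1 : ℝ))
  have h4 : E.vxz x z = fderivWithin ℝ E.dv (E.X ×ˢ E.Y) (x, z) (1, 0) (0, 1) := by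
    unfold vxz
    rw [h3]
    simp only [map_zero, add_zero]
    exact heq.symm
  rw [h4]
  simpa using k2

theorem strictAntiOn_vz {x : ℝ} (hx : x ∈ E.X) : StrictAntiOn (E.vz x) E.Y := by
  refine strictAntiOn_of_deriv_neg (convex_Icc _ _)
    (fun z hz => (h.hasDerivWithinAt_vzz hx hz).continuousWithinAt) fun z hz => ?_
  replace hz : z ∈ interior (Icc E.ylo E.yhi) := hz
  rw [interior_Icc] at hz
  have hz' : z ∈ E.Y := Ioo_subset_Icc_self hz
  rw [((h.hasDerivWithinAt_vzz hx hz').hasDerivAt (Icc_mem_nhds hz.1 hz.2)).deriv]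
  exact h.vzz_neg x hx z hz'

theorem strictMonoOn_vz {z : ℝ} (hz : z ∈ E.Y) : StrictMonoOn (fun x => E.vz x z) E.X := by
  refine strictMonoOn_of_deriv_pos (convex_Icc _ _)
    (fun x hx => (h.hasDerivWithinAt_vxz hx hz).continuousWithinAt) fun x hx => ?_
  replace hx : x ∈ interior (Icc E.xlo E.xhi) := hx
  rw [interior_Icc] at hx
  have hx' : x ∈ E.X := Ioo_subset_Icc_self hx
  rw [((h.hasDerivWithinAt_vxz hx' hz).hasDerivAt (Icc_mem_nhds hx.1 hx.2)).deriv]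
  exact h.vxz_pos x hx' z hz

theorem exists_vz_slope {x z z' : ℝ} (hx : x ∈ E.X) (hz : z ∈ E.Y) (hz' : z' ∈ E.Y) (hlt : z < z') :
    ∃ t ∈ Ioo z z', E.v x z' - E.v x z = E.vz x t * (z' - z) := by
  have hsub : Icc z z' ⊆ E.Y := Icc_subset_Icc hz.1 hz'.2
  obtain ⟨t, ht, he⟩ := exists_hasDerivAt_eq_slope (fun t => E.v x t) (fun t => E.vz x t) hlt
    (fun t ht => (h.hasDerivWithinAt_vz hx (hsub ht)).1.continuousWithinAt.mono hsub)
    (fun t ht => (h.hasDerivWithinAt_vz hx (hsub (Ioo_subset_Icc_self ht))).1.hasDerivAt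
      (Icc_mem_nhds (hz.1.trans_lt ht.1) (ht.2.trans_le hz'.2)))
  refine ⟨t, ht, ?_⟩
  rw [he, div_mul_cancel₀]
  linarith

/-- Strict concavity in the workforce mean. -/
theorem v_lt_tangent {x z z' : ℝ} (hx : x ∈ E.X) (hz : z ∈ E.Y) (hz' : z' ∈ E.Y) (hne : z' ≠ z) :
    E.v x z' < E.v x z + E.vz x z * (z' - z) := by
  rcases lt_or_gt_of_ne hne with hlt | hlt
  · obtain ⟨t, ht, he⟩ := h.exists_vz_slope hx hz' hz hlt
    have := h.strictAntiOn_vz hx ⟨hz'.1.trans ht.1.le, ht.2.le.trans hz.2⟩ hz ht.2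
    nlinarith
  · obtain ⟨t, ht, he⟩ := h.exists_vz_slope hx hz hz' hlt
    have := h.strictAntiOn_vz hx hz ⟨hz.1.trans ht.1.le, ht.2.le.trans hz'.2⟩ ht.1
    nlinarith

theorem exists_vx_slope {x x' z : ℝ} (hx : x ∈ E.X) (hx' : x' ∈ E.X) (hz : z ∈ E.Y) (hlt : x < x') :
    ∃ t ∈ Ioo x x', E.v x' z - E.v x z = E.vx t z * (x' - x) := by
  have hsub : Icc x x' ⊆ E.X := Icc_subset_Icc hx.1 hx'.2
  obtain ⟨t, ht, he⟩ := exists_hasDerivAt_eq_slope (fun t => E.v t z) (fun t => E.vx t z) hlt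
    (fun t ht => (h.hasDerivWithinAt_vx (hsub ht) hz).1.continuousWithinAt.mono hsub)
    (fun t ht => (h.hasDerivWithinAt_vx (hsub (Ioo_subset_Icc_self ht)) hz).1.hasDerivAt
      (Icc_mem_nhds (hx.1.trans_lt ht.1) (ht.2.trans_le hx'.2)))
  refine ⟨t, ht, ?_⟩
  rw [he, div_mul_cancel₀]
  linarith

end Regular

end Economy

/-! ### Distributions with a density on an interval -/

/-- The measure with density `f` on `[a, b]`. -/
noncomputable def densityMeasure (a b : ℝ) (f : ℝ → ℝ) : Measure ℝ :=
  (volume.restrict (Icc a b)).withDensity (fun x => ENNReal.ofReal (f x))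

/-- Nothing is assumed about f outside [a, b]; the clamped version is continuous, hence measurable,
on the whole line. -/
theorem densityMeasure_eq_clampExtend (a b : ℝ) (f : ℝ → ℝ) : densityMeasure a b f =
    (volume.restrict (Icc a b)).withDensity (fun x => ENNReal.ofReal (clampExtend a b f x)) := by
  refine withDensity_congr_ae ?_
  filter_upwards [ae_restrict_mem measurableSet_Icc] with x hx
  rw [clampExtend_eq hx]

theorem ae_densityMeasure_mem (a b : ℝ) (f : ℝ → ℝ) :
    ∀ᵐ x ∂(densityMeasure a b f), x ∈ Icc a b :=
  (withDensity_absolutelyContinuous _ _).ae_le (ae_restrict_mem measurableSet_Icc)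

/-- `f` is a continuous positive probability density on `[a, b]`. -/
structure IsDensityOn (a b : ℝ) (f : ℝ → ℝ) : Prop where
  lt : a < b
  cont : ContinuousOn f (Icc a b)
  pos : ∀ x ∈ Icc a b, 0 < f x
  int : ∫ x in a..b, f x = 1

namespace IsDensityOn

variable {a b : ℝ} {f : ℝ → ℝ} (h : IsDensityOn a b f)
include h

theorem intervalIntegrable {c d : ℝ} (hc : c ∈ Icc a b) (hd : d ∈ Icc a b) :
    IntervalIntegrable f volume c d :=
  (h.cont.mono (uIcc_subset_Icc hc hd)).intervalIntegrable

theorem integral_eq (φ : ℝ → ℝ) : ∫ x, φ x ∂(densityMeasure a b f) = ∫ x in a..b, φ x * f x := by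
  rw [densityMeasure_eq_clampExtend, integral_withDensity_eq_integral_toReal_smul
    (continuous_clampExtend h.lt.le h.cont).measurable.ennreal_ofReal
    (Filter.Eventually.of_forall fun x => ENNReal.ofReal_lt_top),
    intervalIntegral.integral_of_le h.lt.le, ← integral_Icc_eq_integral_Ioc]
  refine setIntegral_congr_fun measurableSet_Icc fun x hx => ?_
  simp only [clampExtend_eq hx, smul_eq_mul]
  rw [ENNReal.toReal_ofReal (h.pos x hx).le, mul_comm]

theorem isProbabilityMeasure : IsProbabilityMeasure (densityMeasure a b f) := by
  constructor
  rw [densityMeasure, withDensity_apply _ MeasurableSet.univ, Measure.restrict_univ,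
    ← ofReal_integral_eq_lintegral_ofReal, integral_Icc_eq_integral_Ioc,
    ← intervalIntegral.integral_of_le h.lt.le, h.int, ENNReal.ofReal_one]
  · exact h.cont.integrableOn_Icc
  · filter_upwards [ae_restrict_mem measurableSet_Icc] with x hx
    exact (h.pos x hx).le

theorem measureReal_eq {A : Set ℝ} (hA : MeasurableSet A) :
    (densityMeasure a b f).real A = ∫ x in a..b, A.indicator f x := by
  rw [← integral_indicator_one hA, h.integral_eq]
  congr 1
  ext x
  by_cases hx : x ∈ A <;> simp [hx]

theorem intervalIntegral_eq (φ : ℝ → ℝ) {x : ℝ} (hx : x ∈ Icc a b) :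
    ∫ t in a..x, φ t ∂(densityMeasure a b f) = ∫ t in a..x, φ t * f t := by
  rw [intervalIntegral.integral_of_le hx.1, ← integral_indicator measurableSet_Ioc, h.integral_eq,
    intervalIntegral.integral_of_le h.lt.le, intervalIntegral.integral_of_le hx.1]
  have : (fun t => (Ioc a x).indicator φ t * f t) = (Ioc a x).indicator fun t => φ t * f t := by
    ext t
    by_cases ht : t ∈ Ioc a x <;> simp [ht]
  rw [this, setIntegral_indicator measurableSet_Ioc,
    inter_eq_self_of_subset_right (Ioc_subset_Ioc_right hx.2)]

theorem cdf_eq {x : ℝ} (hx : x ∈ Icc a b) : cdf (densityMeasure a b f) x = ∫ t in a..x, f t := by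
  have := h.isProbabilityMeasure
  rw [cdf_eq_real, h.measureReal_eq measurableSet_Iic, intervalIntegral.integral_of_le h.lt.le,
    intervalIntegral.integral_of_le hx.1, setIntegral_indicator measurableSet_Iic]
  congr 2
  ext t
  simp only [mem_inter_iff, mem_Ioc, mem_Iic]
  exact ⟨fun ht => ⟨ht.1.1, ht.2⟩, fun ht => ⟨⟨ht.1, ht.2.trans hx.2⟩, ht.2⟩⟩

theorem cdf_left : cdf (densityMeasure a b f) a = 0 := by
  rw [h.cdf_eq (left_mem_Icc.mpr h.lt.le), intervalIntegral.integral_same]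

theorem cdf_right : cdf (densityMeasure a b f) b = 1 := by
  rw [h.cdf_eq (right_mem_Icc.mpr h.lt.le), h.int]

theorem continuousOn_cdf : ContinuousOn (cdf (densityMeasure a b f)) (Icc a b) :=
  (continuousOn_primitive h.lt.le (h.intervalIntegrable (left_mem_Icc.mpr h.lt.le)
    (right_mem_Icc.mpr h.lt.le))).congr fun _ hx => h.cdf_eq hx

theorem strictMonoOn_cdf : StrictMonoOn (cdf (densityMeasure a b f)) (Icc a b) := by
  intro x hx y hy hxy
  have ha := left_mem_Icc.mpr h.lt.le
  rw [h.cdf_eq hx, h.cdf_eq hy, ← intervalIntegral.integral_add_adjacent_intervals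
    (h.intervalIntegrable ha hx) (h.intervalIntegrable hx hy)]
  have := intervalIntegral.intervalIntegral_pos_of_pos_on (h.intervalIntegrable hx hy)
    (fun t ht => h.pos t ⟨hx.1.trans ht.1.le, ht.2.le.trans hy.2⟩) hxy
  linarith

theorem exists_cdf_eq {c : ℝ} (hc : c ∈ Icc (0 : ℝ) 1) :
    ∃ x ∈ Icc a b, cdf (densityMeasure a b f) x = c := by
  have := intermediate_value_Icc h.lt.le h.continuousOn_cdf
  rw [h.cdf_left, h.cdf_right] at this
  exact this hc

theorem measureReal_le {A B : Set ℝ} (hAB : ∀ x ∈ Icc a b, x ∈ A → x ∈ B) :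
    (densityMeasure a b f).real A ≤ (densityMeasure a b f).real B := by
  have := h.isProbabilityMeasure
  refine ENNReal.toReal_mono (measure_ne_top _ _) (measure_mono_ae ?_)
  filter_upwards [ae_densityMeasure_mem a b f] with x hx
  exact hAB x hx

theorem measureReal_Iic_eq_zero {x : ℝ} (hx : x ≤ a) :
    (densityMeasure a b f).real (Iic x) = 0 := by
  have := h.isProbabilityMeasure
  refine le_antisymm ?_ measureReal_nonneg
  calc (densityMeasure a b f).real (Iic x) ≤ (densityMeasure a b f).real (Iic a) :=
        measureReal_mono (Iic_subset_Iic.mpr hx)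
    _ = 0 := by rw [← cdf_eq_real, h.cdf_left]

theorem measure_Ioo_pos {x y : ℝ} (hx : x ∈ Icc a b) (hy : y ∈ Icc a b) (hxy : x < y) :
    0 < densityMeasure a b f (Ioo x y) := by
  have := h.isProbabilityMeasure
  obtain ⟨c, hxc, hcy⟩ := exists_between hxy
  have hc : c ∈ Icc a b := ⟨hx.1.trans hxc.le, hcy.le.trans hy.2⟩
  have h1 : cdf (densityMeasure a b f) x < cdf (densityMeasure a b f) c :=
    h.strictMonoOn_cdf hx hc hxc
  rw [cdf_eq_real, cdf_eq_real] at h1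
  have h2 : (densityMeasure a b f).real (Iic c) ≤
      (densityMeasure a b f).real (Iic x) + (densityMeasure a b f).real (Ioo x y) := by
    refine (measureReal_mono (fun t ht => ?_)).trans (measureReal_union_le _ _)
    rcases le_or_gt t x with htx | htx
    · exact Or.inl htx
    · exact Or.inr ⟨htx, lt_of_le_of_lt ht hcy⟩
  have h3 : 0 < (densityMeasure a b f).real (Ioo x y) := by linarith
  exact (ENNReal.toReal_pos_iff.mp h3).1

end IsDensityOn

/-- The integrated cdf of a distribution on `[a, b]`. -/
theorem integral_cdf_eq {μ : Measure ℝ} [IsProbabilityMeasure μ] {a b : ℝ}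
    (hμ : ∀ᵐ z ∂μ, z ∈ Icc a b) {y : ℝ} (hy : a ≤ y) :
    ∫ t in a..y, cdf μ t = ∫ z, max (y - z) 0 ∂μ := by
  have hm : MeasurableSet {p : ℝ × ℝ | p.2 ≤ p.1} := measurableSet_le measurable_snd measurable_fst
  have h1 : ∀ t, cdf μ t = ∫ z, (if z ≤ t then (1 : ℝ) else 0) ∂μ := by
    intro t
    rw [cdf_eq_real, ← integral_indicator_one measurableSet_Iic]
    congr 1
  have h2 : ∀ z ∈ Icc a b, ∫ t in a..y, (if z ≤ t then (1 : ℝ) else 0) = max (y - z) 0 := by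
    intro z hz
    rw [intervalIntegral.integral_of_le hy]
    have : (fun t => if z ≤ t then (1 : ℝ) else 0) = (Ici z).indicator fun _ => 1 := by
      ext t; simp [indicator]
    rw [this, setIntegral_indicator measurableSet_Ici]
    simp only [integral_const, smul_eq_mul, mul_one, measureReal_restrict_apply_univ]
    -- The half-open interval omits its left end, so the intersection has a different shape when z =
    -- a.
    rcases hz.1.eq_or_lt with haz | haz
    · subst haz
      have : Ioc a y ∩ Ici a = Ioc a y := by
        ext t; simp only [mem_inter_iff, mem_Ioc, mem_Ici]; constructor
        · exact fun h => h.1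
        · exact fun h => ⟨h, h.1.le⟩
      rw [this, Real.volume_real_Ioc_of_le hy, max_eq_left]
      linarith
    · have : Ioc a y ∩ Ici z = Icc z y := by
        ext t; simp only [mem_inter_iff, mem_Ioc, mem_Ici, mem_Icc]; constructor
        · exact fun h => ⟨h.2, h.1.2⟩
        · exact fun h => ⟨⟨haz.trans_le h.1, h.2⟩, h.1⟩
      rw [this, Real.volume_real_Icc]
  have hint : Integrable (Function.uncurry fun t z : ℝ => if z ≤ t then (1 : ℝ) else 0)
      ((volume.restrict (uIoc a y)).prod μ) := by
    have : IsFiniteMeasure (volume.restrict (uIoc a y)) := ⟨by simp [uIoc]⟩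
    refine ((integrable_const (1 : ℝ)).indicator hm).congr (Filter.Eventually.of_forall fun p => ?_)
    simp only [Function.uncurry, indicator, mem_ofPred_eq]
  simp_rw [h1]
  rw [intervalIntegral_integral_swap hint]
  refine integral_congr_ae ?_
  filter_upwards [hμ] with z hz
  exact h2 z hz

/-! ### Quantile matchings and majorization -/

namespace Economy

variable (E : Economy)

theorem F_eq : E.F = densityMeasure E.xlo E.xhi E.f := rfl

theorem G_eq : E.G = densityMeasure E.ylo E.yhi E.g := rfl

theorem isDensityOn_f : IsDensityOn E.xlo E.xhi E.f := ⟨E.x_lt, E.f_cont, E.f_pos, E.f_int⟩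

theorem isDensityOn_g : IsDensityOn E.ylo E.yhi E.g := ⟨E.y_lt, E.g_cont, E.g_pos, E.g_int⟩

instance : IsProbabilityMeasure E.F := E.isDensityOn_f.isProbabilityMeasure

instance : IsProbabilityMeasure E.G := E.isDensityOn_g.isProbabilityMeasure

theorem xlo_mem : E.xlo ∈ E.X := left_mem_Icc.mpr E.x_lt.le

theorem xhi_mem : E.xhi ∈ E.X := right_mem_Icc.mpr E.x_lt.le

theorem ylo_mem : E.ylo ∈ E.Y := left_mem_Icc.mpr E.y_lt.le

theorem yhi_mem : E.yhi ∈ E.Y := right_mem_Icc.mpr E.y_lt.le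

theorem ae_mem_X : ∀ᵐ x ∂E.F, x ∈ E.X := ae_densityMeasure_mem _ _ _

variable {E}

/-- T(x) is admissible in the infimum because T ≤ T(x) on the types up to x. For z < T(x),
continuity gives y < x with z < T(y), so the law of T puts mass at most F(y) < F(x) on (-∞, z]. The
lowest type is treated separately. -/
theorem quantileMatching_map {T : ℝ → ℝ} (hT : Continuous T) (hm : MonotoneOn T E.X)
    (hY : MapsTo T E.X E.Y) {x : ℝ} (hx : x ∈ E.X) : E.quantileMatching (E.F.map T) x = T x := by
  have hprob : IsProbabilityMeasure (E.F.map T) :=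
    Measure.isProbabilityMeasure_map hT.measurable.aemeasurable
  have hcdf : ∀ z, cdf (E.F.map T) z = E.F.real (T ⁻¹' Iic z) := fun z => by
    rw [cdf_eq_real, map_measureReal_apply hT.measurable measurableSet_Iic]
  have hbdd : BddBelow {z | z ∈ E.Y ∧ cdf E.F x ≤ cdf (E.F.map T) z ∧ 0 < cdf (E.F.map T) z} :=
    ⟨E.ylo, fun z hz => hz.1.1⟩
  have hge : ∀ y ∈ E.X, cdf E.F y ≤ cdf (E.F.map T) (T y) := by
    intro y hy
    rw [hcdf, cdf_eq_real]
    refine E.isDensityOn_f.measureReal_le fun t ht hty => ?_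
    exact hm ht hy hty
  have hmono := E.isDensityOn_f.strictMonoOn_cdf
  rw [← F_eq] at hmono
  have hlo : cdf E.F E.xlo = 0 := E.isDensityOn_f.cdf_left
  have hin : ∀ y ∈ E.X, x ≤ y → E.xlo < y →
      T y ∈ {z | z ∈ E.Y ∧ cdf E.F x ≤ cdf (E.F.map T) z ∧ 0 < cdf (E.F.map T) z} := by
    intro y hy hxy hlt
    refine ⟨hY hy, (monotone_cdf _ hxy).trans (hge y hy), lt_of_lt_of_le ?_ (hge y hy)⟩
    rw [← hlo]
    exact hmono E.xlo_mem hy hlt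
  unfold quantileMatching
  apply le_antisymm
  · rcases hx.1.eq_or_lt with h | h
    -- At x = xlo the condition F(x) ≤ cdf is void and T(x) itself may carry no mass. The values
    -- T(t) for t > xlo are admissible, and t tends to xlo.
    · have hcl : x ∈ closure (Ioo x E.xhi) := by
        rw [closure_Ioo (h ▸ E.x_lt.ne)]; exact left_mem_Icc.mpr hx.2
      have hc : IsClosed {t | sInf {z | z ∈ E.Y ∧ cdf E.F x ≤ cdf (E.F.map T) z ∧
          0 < cdf (E.F.map T) z} ≤ T t} := isClosed_le continuous_const hT
      refine closure_minimal (fun t ht => ?_) hc hcl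
      exact csInf_le hbdd (hin t ⟨hx.1.trans ht.1.le, ht.2.le⟩ ht.1.le (h ▸ ht.1))
    · exact csInf_le hbdd (hin x hx le_rfl h)
  · refine le_csInf ⟨_, hin E.xhi E.xhi_mem hx.2 E.x_lt⟩ ?_
    rintro z ⟨-, hz1, hz2⟩
    by_contra hlt
    rw [not_le] at hlt
    rcases hx.1.eq_or_lt with h | h
    · have : E.F.real (T ⁻¹' Iic z) ≤ E.F.real (Iic E.xlo) := by
        refine E.isDensityOn_f.measureReal_le fun t ht htz => ?_
        exfalso
        have := hm hx ht (h ▸ ht.1)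
        exact absurd (lt_of_lt_of_le hlt this) (not_lt.mpr htz)
      rw [hcdf] at hz2
      rw [← cdf_eq_real, hlo] at this
      linarith
    · have hev : ∀ᶠ t in nhds x, z < T t := hT.continuousAt.eventually (lt_mem_nhds hlt)
      obtain ⟨e, he, hball⟩ := Metric.eventually_nhds_iff.mp hev
      obtain ⟨y, hy1, hy2⟩ := exists_between (max_lt h (show x - e < x by linarith))
      have hay := (le_max_left _ _).trans_lt hy1
      have hey := (le_max_right _ _).trans_lt hy1
      have hyX : y ∈ E.X := ⟨hay.le, hy2.le.trans hx.2⟩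
      have hzy : z < T y := hball (by rw [Real.dist_eq, abs_of_neg (by linarith)]; linarith)
      have : E.F.real (T ⁻¹' Iic z) ≤ E.F.real (Iic y) := by
        refine E.isDensityOn_f.measureReal_le fun t ht htz => ?_
        by_contra hty
        have := hm hyX ht (not_le.mp hty).le
        exact absurd (lt_of_lt_of_le hzy this) (not_lt.mpr htz)
      rw [hcdf] at hz1
      rw [← cdf_eq_real] at this
      linarith [hmono hyX hx hy2]

/-- Strict monotonicity and continuity of both cdfs let G(T(x)) = F(x) define T. By
`quantileMatching_map` this T is S on X, so the infimum defining S inherits continuity, strict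
monotonicity and the end values. -/
theorem exists_quantile_coupling (E : Economy) : ∃ T : ℝ → ℝ, Continuous T ∧ StrictMonoOn T E.X ∧
    MapsTo T E.X E.Y ∧ T E.xlo = E.ylo ∧ T E.xhi = E.yhi ∧ E.F.map T = E.G := by
  have hF := E.isDensityOn_f
  have hG := E.isDensityOn_g
  have hex : ∀ x, ∃ y, x ∈ E.X → y ∈ E.Y ∧ cdf E.G y = cdf E.F x := by
    intro x
    obtain ⟨y, hy, he⟩ := hG.exists_cdf_eq (c := cdf E.F x) ⟨cdf_nonneg _ _, cdf_le_one _ _⟩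
    exact ⟨y, fun _ => ⟨hy, he⟩⟩
  choose T0 hT0 using hex
  have hmG : StrictMonoOn (cdf E.G) E.Y := hG.strictMonoOn_cdf
  have hmF : StrictMonoOn (cdf E.F) E.X := hF.strictMonoOn_cdf
  have hmono : StrictMonoOn T0 E.X := by
    intro x hx y hy hxy
    rw [← hmG.lt_iff_lt (hT0 x hx).1 (hT0 y hy).1, (hT0 x hx).2, (hT0 y hy).2]
    exact hmF hx hy hxy
  have hcont : ContinuousOn T0 E.X := by
    have hcF : ContinuousOn (cdf E.F) E.X := hF.continuousOn_cdf
    intro x hx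
    refine tendsto_order.mpr ⟨fun l hl => ?_, fun l hl => ?_⟩
    · rcases lt_or_ge l E.ylo with h | h
      · filter_upwards [self_mem_nhdsWithin] with y hy
        exact h.trans_le (hT0 y hy).1.1
      · have hlY : l ∈ E.Y := ⟨h, hl.le.trans (hT0 x hx).1.2⟩
        have hlt : cdf E.G l < cdf E.F x := by
          rw [← (hT0 x hx).2]; exact hmG hlY (hT0 x hx).1 hl
        filter_upwards [self_mem_nhdsWithin, (hcF x hx).eventually (lt_mem_nhds hlt)] with y hy hy'
        rw [← hmG.lt_iff_lt hlY (hT0 y hy).1, (hT0 y hy).2]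
        exact hy'
    · rcases lt_or_ge E.yhi l with h | h
      · filter_upwards [self_mem_nhdsWithin] with y hy
        exact (hT0 y hy).1.2.trans_lt h
      · have hlY : l ∈ E.Y := ⟨(hT0 x hx).1.1.trans hl.le, h⟩
        have hlt : cdf E.F x < cdf E.G l := by
          rw [← (hT0 x hx).2]; exact hmG (hT0 x hx).1 hlY hl
        filter_upwards [self_mem_nhdsWithin, (hcF x hx).eventually (gt_mem_nhds hlt)] with y hy hy'
        rw [← hmG.lt_iff_lt (hT0 y hy).1 hlY, (hT0 y hy).2]
        exact hy'
  have hcT : Continuous (clampExtend E.xlo E.xhi T0) := continuous_clampExtend E.x_lt.le hcont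
  have heq : ∀ x ∈ E.X, clampExtend E.xlo E.xhi T0 x = T0 x := fun x hx => clampExtend_eq hx
  refine ⟨clampExtend E.xlo E.xhi T0, hcT, hmono.congr fun x hx => (heq x hx).symm,
    fun x hx => by rw [heq x hx]; exact (hT0 x hx).1, ?_, ?_, ?_⟩
  · rw [heq _ E.xlo_mem]
    refine hmG.injOn (hT0 _ E.xlo_mem).1 E.ylo_mem ?_
    rw [(hT0 _ E.xlo_mem).2, E.G_eq, hG.cdf_left, E.F_eq, hF.cdf_left]
  · rw [heq _ E.xhi_mem]
    refine hmG.injOn (hT0 _ E.xhi_mem).1 E.yhi_mem ?_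
    rw [(hT0 _ E.xhi_mem).2, E.G_eq, hG.cdf_right, E.F_eq, hF.cdf_right]
  · have : IsProbabilityMeasure (E.F.map (clampExtend E.xlo E.xhi T0)) :=
      Measure.isProbabilityMeasure_map hcT.measurable.aemeasurable
    refine Measure.ext_of_Iic _ _ fun z => ?_
    rw [← measureReal_eq_measureReal_iff, map_measureReal_apply hcT.measurable measurableSet_Iic]
    rcases lt_or_ge z E.ylo with h | h
    · have h1 : E.F.real (clampExtend E.xlo E.xhi T0 ⁻¹' Iic z) ≤ E.F.real (Iic E.xlo) := by
        refine hF.measureReal_le fun t ht htz => ?_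
        exfalso
        have := (hT0 t ht).1.1
        rw [mem_preimage, mem_Iic, heq t ht] at htz
        linarith
      have h2 : E.G.real (Iic z) = 0 := hG.measureReal_Iic_eq_zero h.le
      have h3 : E.F.real (Iic E.xlo) = 0 := hF.measureReal_Iic_eq_zero le_rfl
      rw [h2]
      exact le_antisymm (h3 ▸ h1) measureReal_nonneg
    · have hz' : min z E.yhi ∈ E.Y := ⟨le_min h E.y_lt.le, min_le_right _ _⟩
      obtain ⟨x, hx, hxz⟩ := hF.exists_cdf_eq (c := cdf E.G (min z E.yhi))
        ⟨cdf_nonneg _ _, cdf_le_one _ _⟩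
      have hTx : T0 x = min z E.yhi := by
        refine hmG.injOn (hT0 x hx).1 hz' ?_
        rw [(hT0 x hx).2, ← hxz]
        rfl
      have e1 : E.G.real (Iic z) = E.G.real (Iic (min z E.yhi)) := by
        refine le_antisymm (hG.measureReal_le fun t ht htz => ?_) (measureReal_mono
          (Iic_subset_Iic.mpr (min_le_left _ _)))
        exact le_min htz ht.2
      have e2 : E.F.real (clampExtend E.xlo E.xhi T0 ⁻¹' Iic z) = E.F.real (Iic x) := by
        refine le_antisymm (hF.measureReal_le fun t ht htz => ?_)
          (hF.measureReal_le fun t ht htx => ?_)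
        · rw [mem_preimage, mem_Iic, heq t ht] at htz
          rw [mem_Iic, ← hmono.le_iff_le ht hx, hTx]
          exact le_min htz (hT0 t ht).1.2
        · rw [mem_preimage, mem_Iic, heq t ht]
          have := (hmono.le_iff_le ht hx).mpr htx
          rw [hTx] at this
          exact this.trans (min_le_left _ _)
      rw [e1, e2, ← cdf_eq_real, ← cdf_eq_real, ← hxz]
      rfl

/-- The segregation matching, extended continuously to the whole line. -/
noncomputable def segExt (E : Economy) : ℝ → ℝ := clampExtend E.xlo E.xhi E.S

theorem segExt_eq {x : ℝ} (hx : x ∈ E.X) : E.segExt x = E.S x := clampExtend_eq hx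

theorem exists_eqOn_S (E : Economy) : ∃ T : ℝ → ℝ, (Continuous T ∧ StrictMonoOn T E.X ∧
    MapsTo T E.X E.Y ∧ T E.xlo = E.ylo ∧ T E.xhi = E.yhi ∧ E.F.map T = E.G) ∧ EqOn E.S T E.X := by
  obtain ⟨T, hc, hm, hY, hlo, hhi, hmap⟩ := E.exists_quantile_coupling
  refine ⟨T, ⟨hc, hm, hY, hlo, hhi, hmap⟩, fun x hx => ?_⟩
  rw [S, ← hmap]
  exact quantileMatching_map hc hm.monotoneOn hY hx

theorem strictMonoOn_S (E : Economy) : StrictMonoOn E.S E.X := by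
  obtain ⟨T, h, he⟩ := E.exists_eqOn_S
  exact h.2.1.congr he.symm

theorem mapsTo_S (E : Economy) : MapsTo E.S E.X E.Y := by
  obtain ⟨T, h, he⟩ := E.exists_eqOn_S
  exact h.2.2.1.congr he.symm

theorem continuousOn_S (E : Economy) : ContinuousOn E.S E.X := by
  obtain ⟨T, h, he⟩ := E.exists_eqOn_S
  exact h.1.continuousOn.congr he

theorem S_xlo (E : Economy) : E.S E.xlo = E.ylo := by
  obtain ⟨T, h, he⟩ := E.exists_eqOn_S
  rw [he E.xlo_mem, h.2.2.2.1]

theorem S_xhi (E : Economy) : E.S E.xhi = E.yhi := by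
  obtain ⟨T, h, he⟩ := E.exists_eqOn_S
  rw [he E.xhi_mem, h.2.2.2.2.1]

theorem continuous_segExt (E : Economy) : Continuous E.segExt :=
  continuous_clampExtend E.x_lt.le E.continuousOn_S

theorem mapsTo_segExt (E : Economy) : MapsTo E.segExt E.X E.Y :=
  E.mapsTo_S.congr fun _ hx => (segExt_eq hx).symm

theorem map_segExt (E : Economy) : E.F.map E.segExt = E.G := by
  obtain ⟨T, h, he⟩ := E.exists_eqOn_S
  rw [← h.2.2.2.2.2]
  refine Measure.map_congr ?_
  filter_upwards [E.ae_mem_X] with x hx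
  rw [segExt_eq hx, he hx]

theorem ae_map_mem_Y {T : ℝ → ℝ} (hT : Continuous T) (hY : MapsTo T E.X E.Y) :
    ∀ᵐ z ∂(E.F.map T), z ∈ E.Y := by
  have hY' : MeasurableSet {z | z ∈ E.Y} := measurableSet_Icc
  rw [ae_map_iff hT.measurable.aemeasurable hY']
  filter_upwards [E.ae_mem_X] with x hx
  exact hY hx

theorem integral_map_matching {T : ℝ → ℝ} (hT : Continuous T) (hY : MapsTo T E.X E.Y) {φ : ℝ → ℝ}
    (hφ : ContinuousOn φ E.Y) :
    ∫ z, φ z ∂(E.F.map T) = ∫ x in E.xlo..E.xhi, φ (T x) * E.f x := by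
  have hc := continuous_clampExtend E.y_lt.le hφ
  have h1 : ∫ z, φ z ∂(E.F.map T) = ∫ z, clampExtend E.ylo E.yhi φ z ∂(E.F.map T) := by
    refine integral_congr_ae ?_
    filter_upwards [ae_map_mem_Y hT hY] with z hz
    exact (clampExtend_eq hz).symm
  rw [h1, integral_map hT.measurable.aemeasurable hc.aestronglyMeasurable, E.F_eq,
    E.isDensityOn_f.integral_eq]
  refine intervalIntegral.integral_congr fun x hx => ?_
  rw [uIcc_of_le E.x_lt.le] at hx
  rw [clampExtend_eq (hY hx)]

/-- The cumulated excess of a matching over the segregation matching. -/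
noncomputable def excess (E : Economy) (T : ℝ → ℝ) (x : ℝ) : ℝ :=
  ∫ t in E.xlo..x, (T t - E.S t) * E.f t

theorem intervalIntegrable_mul_f {T : ℝ → ℝ} (hm : MonotoneOn T E.X) {x y : ℝ} (hx : x ∈ E.X)
    (hy : y ∈ E.X) : IntervalIntegrable (fun t => T t * E.f t) volume x y := by
  have hsub : uIcc x y ⊆ Icc E.xlo E.xhi := uIcc_subset_Icc hx hy
  exact (hm.mono hsub).intervalIntegrable.mul_continuousOn (E.f_cont.mono hsub)

theorem intervalIntegrable_excess {T : ℝ → ℝ} (hm : MonotoneOn T E.X) {x y : ℝ} (hx : x ∈ E.X)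
    (hy : y ∈ E.X) : IntervalIntegrable (fun t => (T t - E.S t) * E.f t) volume x y := by
  simp_rw [sub_mul]
  exact (intervalIntegrable_mul_f hm hx hy).sub
    (intervalIntegrable_mul_f E.strictMonoOn_S.monotoneOn hx hy)

theorem excess_eq {T : ℝ → ℝ} (hm : MonotoneOn T E.X) {x : ℝ} (hx : x ∈ E.X) :
    E.excess T x = (∫ t in E.xlo..x, T t ∂E.F) - ∫ t in E.xlo..x, E.S t ∂E.F := by
  rw [E.F_eq, E.isDensityOn_f.intervalIntegral_eq _ hx, E.isDensityOn_f.intervalIntegral_eq _ hx,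
    ← intervalIntegral.integral_sub (intervalIntegrable_mul_f hm E.xlo_mem hx)
      (intervalIntegrable_mul_f E.strictMonoOn_S.monotoneOn E.xlo_mem hx)]
  simp_rw [excess, sub_mul]

theorem isFeasible_iff {T : ℝ → ℝ} (hm : MonotoneOn T E.X) :
    E.IsFeasible T ↔ (∀ x ∈ E.X, 0 ≤ E.excess T x) ∧ E.excess T E.xhi = 0 := by
  unfold IsFeasible
  refine and_congr (forall₂_congr fun x hx => ?_) ?_
  · rw [excess_eq hm hx, sub_nonneg]
  · rw [excess_eq hm E.xhi_mem, sub_eq_zero]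

theorem mem_compressionSet_iff {T : ℝ → ℝ} (hm : MonotoneOn T E.X) {x : ℝ} :
    x ∈ E.compressionSet T ↔ x ∈ E.X ∧ 0 < E.excess T x := by
  unfold compressionSet
  rw [mem_ofPred_eq]
  refine and_congr_right fun hx => ?_
  rw [excess_eq hm hx, sub_pos]

theorem mem_segregationSet_iff {T : ℝ → ℝ} (hm : MonotoneOn T E.X) {x : ℝ} :
    x ∈ E.segregationSet T ↔ x ∈ E.X ∧ E.excess T x = 0 := by
  unfold segregationSet
  rw [mem_ofPred_eq]
  refine and_congr_right fun hx => ?_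
  rw [excess_eq hm hx, sub_eq_zero]

theorem integral_cdf_map {T : ℝ → ℝ} (hT : Continuous T) (hY : MapsTo T E.X E.Y) {y : ℝ}
    (hy : E.ylo ≤ y) : ∫ t in E.ylo..y, cdf (E.F.map T) t =
      ∫ x in E.xlo..E.xhi, max (y - T x) 0 * E.f x := by
  have : IsProbabilityMeasure (E.F.map T) :=
    Measure.isProbabilityMeasure_map hT.measurable.aemeasurable
  rw [integral_cdf_eq (ae_map_mem_Y hT hY) hy]
  exact integral_map_matching (φ := fun z => max (y - z) 0) hT hY (by fun_prop)

theorem intervalIntegrable_of_continuousOn {φ : ℝ → ℝ} (hφ : ContinuousOn φ E.X) {x y : ℝ}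
    (hx : x ∈ E.X) (hy : y ∈ E.X) : IntervalIntegrable (fun t => φ t * E.f t) volume x y := by
  have hsub : uIcc x y ⊆ Icc E.xlo E.xhi := uIcc_subset_Icc hx hy
  exact ((hφ.mul E.f_cont).mono hsub).intervalIntegrable

theorem integral_const_sub {T : ℝ → ℝ} (hT : ContinuousOn T E.X) {x : ℝ} (hx : x ∈ E.X) (y : ℝ) :
    ∫ t in E.xlo..x, (y - T t) * E.f t =
      (∫ t in E.xlo..x, y * E.f t) - ∫ t in E.xlo..x, T t * E.f t := by
  rw [← intervalIntegral.integral_sub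
    (intervalIntegrable_of_continuousOn continuousOn_const E.xlo_mem hx)
    (intervalIntegrable_of_continuousOn hT E.xlo_mem hx)]
  simp_rw [sub_mul]

theorem excess_eq_sub {T : ℝ → ℝ} (hm : MonotoneOn T E.X) {x : ℝ} (hx : x ∈ E.X) :
    E.excess T x = (∫ t in E.xlo..x, T t * E.f t) - ∫ t in E.xlo..x, E.S t * E.f t := by
  rw [← intervalIntegral.integral_sub (intervalIntegrable_mul_f hm E.xlo_mem hx)
      (intervalIntegrable_mul_f E.strictMonoOn_S.monotoneOn E.xlo_mem hx)]
  simp_rw [excess, sub_mul]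

/-- With `integral_max_eq`, this exhibits ∫ max(y - T, 0) dF as the maximum over x of ∫ (y - T) dF
up to x, attained where T crosses y. It is the conjugacy between integrated cdfs and integrated
quantile functions. -/
theorem integral_max_ge {T : ℝ → ℝ} (hT : ContinuousOn T E.X) {x : ℝ} (hx : x ∈ E.X) (y : ℝ) :
    ∫ t in E.xlo..x, (y - T t) * E.f t ≤ ∫ t in E.xlo..E.xhi, max (y - T t) 0 * E.f t := by
  have hc : ContinuousOn (fun t => max (y - T t) 0) E.X :=
    (continuousOn_const.sub hT).sup continuousOn_const
  have h1 : ∫ t in E.xlo..x, (y - T t) * E.f t ≤ ∫ t in E.xlo..x, max (y - T t) 0 * E.f t := by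
    refine intervalIntegral.integral_mono_on hx.1
      (intervalIntegrable_of_continuousOn (continuousOn_const.sub hT) E.xlo_mem hx)
      (intervalIntegrable_of_continuousOn hc E.xlo_mem hx) fun t ht => ?_
    exact mul_le_mul_of_nonneg_right (le_max_left _ _) (E.f_pos t ⟨ht.1, ht.2.trans hx.2⟩).le
  have h2 := intervalIntegral.integral_add_adjacent_intervals
    (intervalIntegrable_of_continuousOn hc E.xlo_mem hx)
    (intervalIntegrable_of_continuousOn hc hx E.xhi_mem)
  have h3 : 0 ≤ ∫ t in x..E.xhi, max (y - T t) 0 * E.f t :=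
    intervalIntegral.integral_nonneg hx.2 fun t ht =>
      mul_nonneg (le_max_right _ _) (E.f_pos t ⟨hx.1.trans ht.1, ht.2⟩).le
  linarith

theorem integral_max_eq {T : ℝ → ℝ} (hT : ContinuousOn T E.X) {c : ℝ} (hc : c ∈ E.X) {y : ℝ}
    (h1 : ∀ t ∈ E.X, t < c → T t ≤ y) (h2 : ∀ t ∈ E.X, c < t → y ≤ T t) :
    ∫ t in E.xlo..E.xhi, max (y - T t) 0 * E.f t = ∫ t in E.xlo..c, (y - T t) * E.f t := by
  have hcont : ContinuousOn (fun t => max (y - T t) 0) E.X :=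
    (continuousOn_const.sub hT).sup continuousOn_const
  have e := intervalIntegral.integral_add_adjacent_intervals
    (intervalIntegrable_of_continuousOn hcont E.xlo_mem hc)
    (intervalIntegrable_of_continuousOn hcont hc E.xhi_mem)
  have e1 : ∫ t in E.xlo..c, max (y - T t) 0 * E.f t = ∫ t in E.xlo..c, (y - T t) * E.f t := by
    rw [intervalIntegral.integral_of_le hc.1, intervalIntegral.integral_of_le hc.1,
      integral_Ioc_eq_integral_Ioo, integral_Ioc_eq_integral_Ioo]
    refine setIntegral_congr_fun measurableSet_Ioo fun t ht => ?_
    rw [max_eq_left]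
    linarith [h1 t ⟨ht.1.le, ht.2.le.trans hc.2⟩ ht.2]
  have e2 : ∫ t in c..E.xhi, max (y - T t) 0 * E.f t = 0 := by
    rw [intervalIntegral.integral_of_le hc.2, integral_Ioc_eq_integral_Ioo]
    rw [setIntegral_congr_fun (g := fun _ => 0) measurableSet_Ioo fun t ht => ?_]
    · simp
    · simp only
      rw [max_eq_right, zero_mul]
      linarith [h2 t ⟨hc.1.trans ht.1.le, ht.2.le⟩ ht.1]
  rw [← e, e1, e2, add_zero]

/-- Majorization in terms of quantile functions. -/
theorem majorizes_iff_isFeasible {T : ℝ → ℝ} (hT : Continuous T) (hm : MonotoneOn T E.X)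
    (hY : MapsTo T E.X E.Y) :
    Majorizes E.ylo E.yhi (E.F.map T) E.G ↔ E.IsFeasible T := by
  rw [isFeasible_iff hm]
  have hTc : ContinuousOn T E.X := hT.continuousOn
  have hSc := E.continuousOn_S
  have hG : ∀ y, E.ylo ≤ y → ∫ t in E.ylo..y, cdf E.G t =
      ∫ x in E.xlo..E.xhi, max (y - E.S x) 0 * E.f x := by
    intro y hy
    rw [← E.map_segExt, integral_cdf_map E.continuous_segExt E.mapsTo_segExt hy]
    refine intervalIntegral.integral_congr fun x hx => ?_
    rw [uIcc_of_le E.x_lt.le] at hx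
    rw [segExt_eq hx]
  have hend : ∫ t in E.ylo..E.yhi, cdf (E.F.map T) t = (∫ t in E.ylo..E.yhi, cdf E.G t) ↔
      E.excess T E.xhi = 0 := by
    rw [hG _ E.y_lt.le, integral_cdf_map hT hY E.y_lt.le,
      integral_max_eq hTc E.xhi_mem (fun t ht _ => (hY ht).2)
        (fun t ht h => absurd ht.2 (not_le.mpr h)),
      integral_max_eq hSc E.xhi_mem (fun t ht _ => (E.mapsTo_S ht).2)
        (fun t ht h => absurd ht.2 (not_le.mpr h)),
      integral_const_sub hTc E.xhi_mem, integral_const_sub hSc E.xhi_mem,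
      excess_eq_sub hm E.xhi_mem]
    constructor <;> intro h <;> linarith
  unfold Majorizes
  rw [hend]
  -- Conjugacy reverses the order. In one direction y = S(x) is chosen, so that S crosses y at x; in
  -- the other, the integrals are cut at the point c where T crosses y.
  refine and_congr_left fun _ => ⟨fun h x hx => ?_, fun h y hy => ?_⟩
  · have h1 := h (E.S x) (E.mapsTo_S hx)
    rw [hG _ (E.mapsTo_S hx).1, integral_cdf_map hT hY (E.mapsTo_S hx).1,
      integral_max_eq hSc hx
        (fun t ht htx => E.strictMonoOn_S.monotoneOn ht hx htx.le)
        (fun t ht htx => E.strictMonoOn_S.monotoneOn hx ht htx.le)] at h1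
    have h2 := (integral_max_ge hTc hx (E.S x)).trans h1
    rw [integral_const_sub hTc hx, integral_const_sub hSc hx] at h2
    rw [excess_eq_sub hm hx]
    linarith
  · obtain ⟨c, hc, hc1, hc2⟩ := exists_threshold_of_monotone E.x_lt.le
      (monotone_clampExtend E.x_lt.le hm) y
    rw [hG y hy.1, integral_cdf_map hT hY hy.1,
      integral_max_eq hTc hc
        (fun t ht htc => by have := hc1 t ht htc; rwa [clampExtend_eq ht] at this)
        (fun t ht htc => by have := hc2 t ht htc; rw [clampExtend_eq ht] at this; exact this.le)]
    refine le_trans ?_ (integral_max_ge hSc hc y)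
    rw [integral_const_sub hTc hc, integral_const_sub hSc hc]
    have := h c hc
    rw [excess_eq_sub hm hc] at this
    linarith

end Economy

/-! ### Marginally sorted matchings -/

namespace Economy

variable {E : Economy}

theorem continuousOn_excess {T : ℝ → ℝ} (hm : MonotoneOn T E.X) : ContinuousOn (E.excess T) E.X :=
  continuousOn_primitive E.x_lt.le (intervalIntegrable_excess hm E.xlo_mem E.xhi_mem)

theorem excess_xlo (T : ℝ → ℝ) : E.excess T E.xlo = 0 := by simp [excess]

/-- The endpoints are the zeros of the continuous function `excess` nearest to x on the left and to
y on the right. They exist because it vanishes at both ends of X. -/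
theorem exists_compressionInterval {T : ℝ → ℝ} (hm : MonotoneOn T E.X)
    (h0 : ∀ x ∈ E.X, 0 ≤ E.excess T x) (h1 : E.excess T E.xhi = 0) {x y : ℝ} (hx : x ∈ E.X)
    (hy : y ∈ E.X) (hxy : x ≤ y) (hpos : ∀ t ∈ Icc x y, 0 < E.excess T t) :
    ∃ a b, E.IsCompressionInterval T a b ∧ a < x ∧ y < b := by
  have hcl : IsClosed (Icc E.xlo E.xhi ∩ E.excess T ⁻¹' {0}) :=
    (continuousOn_excess hm).preimage_isClosed_of_isClosed isClosed_Icc isClosed_singleton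
  have hA : IsCompact (Icc E.xlo x ∩ (Icc E.xlo E.xhi ∩ E.excess T ⁻¹' {0})) :=
    isCompact_Icc.inter_right hcl
  have hB : IsCompact (Icc y E.xhi ∩ (Icc E.xlo E.xhi ∩ E.excess T ⁻¹' {0})) :=
    isCompact_Icc.inter_right hcl
  have hAne : (Icc E.xlo x ∩ (Icc E.xlo E.xhi ∩ E.excess T ⁻¹' {0})).Nonempty :=
    ⟨E.xlo, ⟨le_rfl, hx.1⟩, E.xlo_mem, excess_xlo T⟩
  have hBne : (Icc y E.xhi ∩ (Icc E.xlo E.xhi ∩ E.excess T ⁻¹' {0})).Nonempty :=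
    ⟨E.xhi, ⟨hy.2, le_rfl⟩, E.xhi_mem, h1⟩
  have ha := hA.sSup_mem hAne
  have hb := hB.sInf_mem hBne
  have hle := fun t ht => le_csSup hA.bddAbove (a := t) ht
  have hge := fun t ht => csInf_le hB.bddBelow (a := t) ht
  generalize sSup (Icc E.xlo x ∩ (Icc E.xlo E.xhi ∩ E.excess T ⁻¹' {0})) = a at ha hle
  generalize sInf (Icc y E.xhi ∩ (Icc E.xlo E.xhi ∩ E.excess T ⁻¹' {0})) = b at hb hge
  have ha0 : E.excess T a = 0 := ha.2.2
  have hb0 : E.excess T b = 0 := hb.2.2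
  have hax : a < x := lt_of_le_of_ne ha.1.2 fun h => by
    have := hpos x ⟨le_rfl, hxy⟩
    rw [← h, ha0] at this
    exact lt_irrefl _ this
  have hyb : y < b := lt_of_le_of_ne hb.1.1 fun h => by
    have := hpos y ⟨hxy, le_rfl⟩
    rw [h, hb0] at this
    exact lt_irrefl _ this
  refine ⟨a, b, ⟨hax.trans_le (hxy.trans hyb.le), fun t ht => ?_,
    (mem_segregationSet_iff hm).mpr ⟨ha.2.1, ha0⟩, (mem_segregationSet_iff hm).mpr ⟨hb.2.1, hb0⟩⟩,
    hax, hyb⟩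
  have htX : t ∈ E.X := ⟨ha.2.1.1.trans ht.1.le, ht.2.le.trans hb.2.1.2⟩
  refine (mem_compressionSet_iff hm).mpr ⟨htX, lt_of_le_of_ne (h0 t htX) fun h => ?_⟩
  rcases le_or_gt t x with htx | htx
  · exact absurd (hle t ⟨⟨htX.1, htx⟩, htX, h.symm⟩) (not_le.mpr ht.1)
  rcases le_or_gt y t with hyt | hyt
  · exact absurd (hge t ⟨⟨hyt, htX.2⟩, htX, h.symm⟩) (not_le.mpr ht.2)
  · exact absurd h.symm (hpos t ⟨htx.le, hyt.le⟩).ne'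

/-- Replaces maximal intervals by pairs of points with positive excess in between, the form in which
the monotone-weight lemmas apply with k = (T - S) f. -/
theorem isMarginallySorted_iff {T : ℝ → ℝ} : E.IsMarginallySorted T ↔
    MapsTo T E.X E.Y ∧ MonotoneOn T E.X ∧ ((∀ x ∈ E.X, 0 ≤ E.excess T x) ∧ E.excess T E.xhi = 0) ∧
    MonotoneOn (fun x => E.vz x (T x)) E.X ∧
    ∀ x ∈ E.X, ∀ y ∈ E.X, x < y → (∀ t ∈ Icc x y, 0 < E.excess T t) →
      E.vz x (T x) = E.vz y (T y) := by
  unfold IsMarginallySorted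
  refine and_congr_right fun _ => and_congr_right fun hm => ?_
  rw [isFeasible_iff hm]
  refine and_congr_right fun hf => and_congr_right fun hw => ⟨fun h x hx y hy hxy hpos => ?_,
    fun h a b hab => ?_⟩
  · obtain ⟨a, b, hab, hax, hyb⟩ := exists_compressionInterval hm hf.1 hf.2 hx hy hxy.le hpos
    exact h a b hab x ⟨hax, hxy.trans hyb⟩ y ⟨hax.trans hxy, hyb⟩
  · have key : ∀ x ∈ Ioo a b, ∀ y ∈ Ioo a b, x < y → E.vz x (T x) = E.vz y (T y) := by
      intro x hx y hy hxy
      have hin : ∀ t ∈ Icc x y, t ∈ E.X ∧ 0 < E.excess T t := fun t ht =>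
        (mem_compressionSet_iff hm).mp (hab.2.1 ⟨hx.1.trans_le ht.1, ht.2.trans_lt hy.2⟩)
      exact h x (hin x ⟨le_rfl, hxy.le⟩).1 y (hin y ⟨hxy.le, le_rfl⟩).1 hxy fun t ht => (hin t ht).2
    intro x hx y hy
    rcases lt_trichotomy x y with hlt | heq | hgt
    · exact key x hx y hy hlt
    · rw [heq]
    · exact (key y hy x hx hgt).symm

theorem excess_sub {T T' : ℝ → ℝ} {w : ℝ → ℝ} (hw : MonotoneOn w E.X) (hT : MonotoneOn T E.X)
    (hT' : MonotoneOn T' E.X) :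
    ∫ x in E.xlo..E.xhi, w x * ((T' x - T x) * E.f x) =
      (∫ x in E.xlo..E.xhi, w x * ((T' x - E.S x) * E.f x)) -
        ∫ x in E.xlo..E.xhi, w x * ((T x - E.S x) * E.f x) := by
  rw [← intervalIntegral.integral_sub
    (hw.intervalIntegrable_mul E.x_lt.le (intervalIntegrable_excess hT' E.xlo_mem E.xhi_mem))
    (hw.intervalIntegrable_mul E.x_lt.le (intervalIntegrable_excess hT E.xlo_mem E.xhi_mem))]
  congr 1
  ext x
  ring

theorem intervalIntegrable_diff {T T' : ℝ → ℝ} (hT : MonotoneOn T E.X)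
    (hT' : MonotoneOn T' E.X) {x y : ℝ} (hx : x ∈ E.X) (hy : y ∈ E.X) :
    IntervalIntegrable (fun t => (T' t - T t) * E.f t) volume x y := by
  simp_rw [sub_mul]
  exact (intervalIntegrable_mul_f hT' hx hy).sub (intervalIntegrable_mul_f hT hx hy)

/-- The first-order condition for maximizing ∫ v(x, T(x)) dF over feasible matchings: the increasing
weight v_z(x, T(x)) integrates to zero against T - S and to at most zero against T' - S. -/
theorem IsMarginallySorted.integral_le {T T' : ℝ → ℝ} (h : E.IsMarginallySorted T)
    (h' : E.IsMarginallySorted T') :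
    ∫ x in E.xlo..E.xhi, E.vz x (T x) * ((T' x - T x) * E.f x) ≤ 0 := by
  rw [isMarginallySorted_iff] at h h'
  obtain ⟨-, hm, hf, hw, hc⟩ := h
  obtain ⟨-, hm', hf', -, -⟩ := h'
  rw [excess_sub hw hm hm']
  have h1 := integral_monotone_mul_nonpos E.x_lt.le hw
    (intervalIntegrable_excess hm' E.xlo_mem E.xhi_mem) hf'.2 hf'.1
  have h2 := integral_monotone_mul_eq_zero E.x_lt.le hw
    (intervalIntegrable_excess hm E.xlo_mem E.xhi_mem) hf.2 hf.1 hc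
  rw [h2, sub_zero]
  exact h1

theorem Regular.continuousOn_vz_left (hE : E.Regular) {z : ℝ} (hz : z ∈ E.Y) :
    ContinuousOn (fun x => E.vz x z) E.X := fun _ hx =>
  (hE.hasDerivWithinAt_vxz hx hz).continuousWithinAt

/-- The two variational inequalities add up to ∫ (v_z(x, T) - v_z(x, T'))(T' - T) dF ≤ 0. As v_z
decreases strictly in z, the integrand is nonnegative and positive wherever T ≠ T'. -/
theorem IsMarginallySorted.exists_eq (hE : E.Regular) {T T' : ℝ → ℝ} (h : E.IsMarginallySorted T)
    (h' : E.IsMarginallySorted T') {c d : ℝ} (hc : c ∈ E.X) (hd : d ∈ E.X) (hcd : c < d) :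
    ∃ x ∈ Ioo c d, T x = T' x := by
  by_contra hne
  have hne : ∀ x ∈ Ioo c d, T x ≠ T' x := fun x hx he => hne ⟨x, hx, he⟩
  have i1 := h.integral_le h'
  have i2 := h'.integral_le h
  obtain ⟨hY, hm, -, hw, -⟩ := h
  obtain ⟨hY', hm', -, hw', -⟩ := h'
  have hint : ∀ {x y}, x ∈ E.X → y ∈ E.X → x ≤ y → IntervalIntegrable
      (fun t => (E.vz t (T t) - E.vz t (T' t)) * ((T' t - T t) * E.f t)) volume x y := by
    intro x y hx hy hxy
    simp_rw [sub_mul (E.vz _ _)]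
    have hsub : Icc x y ⊆ E.X := Icc_subset_Icc hx.1 hy.2
    exact ((hw.mono hsub).intervalIntegrable_mul hxy (intervalIntegrable_diff hm hm' hx hy)).sub
      ((hw'.mono hsub).intervalIntegrable_mul hxy (intervalIntegrable_diff hm hm' hx hy))
  have hsum : ∫ t in E.xlo..E.xhi, (E.vz t (T t) - E.vz t (T' t)) * ((T' t - T t) * E.f t) ≤ 0 := by
    have e : ∀ t, (E.vz t (T t) - E.vz t (T' t)) * ((T' t - T t) * E.f t) =
        E.vz t (T t) * ((T' t - T t) * E.f t) + E.vz t (T' t) * ((T t - T' t) * E.f t) :=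
      fun t => by ring
    simp_rw [e]
    rw [intervalIntegral.integral_add
      (hw.intervalIntegrable_mul E.x_lt.le (intervalIntegrable_diff hm hm' E.xlo_mem E.xhi_mem))
      (hw'.intervalIntegrable_mul E.x_lt.le (intervalIntegrable_diff hm' hm E.xlo_mem E.xhi_mem))]
    linarith
  have hnn : ∀ t ∈ E.X, T t ≠ T' t →
      0 < (E.vz t (T t) - E.vz t (T' t)) * ((T' t - T t) * E.f t) := by
    intro t ht hne
    rcases lt_or_gt_of_ne hne with hlt | hlt
    · have := hE.strictAntiOn_vz ht (hY ht) (hY' ht) hlt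
      exact mul_pos (by linarith) (mul_pos (by linarith) (E.f_pos t ht))
    · have := hE.strictAntiOn_vz ht (hY' ht) (hY ht) hlt
      exact mul_pos_of_neg_of_neg (by linarith)
        (mul_neg_of_neg_of_pos (by linarith) (E.f_pos t ht))
  have hnn' : ∀ t ∈ E.X, 0 ≤ (E.vz t (T t) - E.vz t (T' t)) * ((T' t - T t) * E.f t) := by
    intro t ht
    by_cases he : T t = T' t
    · rw [he]; simp
    · exact (hnn t ht he).le
  have p1 := intervalIntegral.intervalIntegral_pos_of_pos_on (hint hc hd hcd.le)
    (fun t ht => hnn t ⟨hc.1.trans ht.1.le, ht.2.le.trans hd.2⟩ (hne t ht)) hcd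
  have p2 : 0 ≤ ∫ t in E.xlo..c, (E.vz t (T t) - E.vz t (T' t)) * ((T' t - T t) * E.f t) :=
    intervalIntegral.integral_nonneg hc.1 fun t ht => hnn' t ⟨ht.1, ht.2.trans hc.2⟩
  have p3 : 0 ≤ ∫ t in d..E.xhi, (E.vz t (T t) - E.vz t (T' t)) * ((T' t - T t) * E.f t) :=
    intervalIntegral.integral_nonneg hd.2 fun t ht => hnn' t ⟨hd.1.trans ht.1, ht.2⟩
  have s1 := intervalIntegral.integral_add_adjacent_intervals
    (hint E.xlo_mem hc hc.1) (hint hc hd hcd.le)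
  have s2 := intervalIntegral.integral_add_adjacent_intervals
    (hint E.xlo_mem hd hd.1) (hint hd E.xhi_mem hd.2)
  linarith

/-- No continuity is available yet. Suppose T(x) < T'(x), and let y > x be a nearby point of
agreement. Then v_z(y, T(y)) ≥ v_z(x, T(x)) > v_z(y, T'(x)) ≥ v_z(y, T'(y)), using sorting for T,
closeness of y, and monotonicity of T'. At the top firm y is taken on the left and the roles are
exchanged. -/
theorem IsMarginallySorted.not_lt (hE : E.Regular) {T T' : ℝ → ℝ} (h : E.IsMarginallySorted T)
    (h' : E.IsMarginallySorted T') {x : ℝ} (hx : x ∈ E.X) : ¬ T x < T' x := by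
  intro hlt
  have hY := h.1
  have hY' := h'.1
  have hm := h.2.1
  have hm' := h'.2.1
  have hw := h.2.2.2.1
  have hw' := h'.2.2.2.1
  have hvz := hE.strictAntiOn_vz hx (hY hx) (hY' hx) hlt
  rcases hx.2.lt_or_eq with hxb | hxb
  · obtain ⟨e, he, hball⟩ := Metric.mem_nhdsWithin_iff.mp
      ((hE.continuousOn_vz_left (hY' hx) x hx).eventually (gt_mem_nhds hvz))
    have hd : min E.xhi (x + e) ∈ E.X :=
      ⟨le_min E.x_lt.le (by linarith [hx.1]), min_le_left _ _⟩
    obtain ⟨y, hy, heq⟩ := h.exists_eq hE h' hx hd (lt_min hxb (by linarith))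
    have hyX : y ∈ E.X := ⟨hx.1.trans hy.1.le, hy.2.le.trans hd.2⟩
    have h1 : E.vz y (T' x) < E.vz x (T x) := hball ⟨by
      rw [Metric.mem_ball, Real.dist_eq, abs_of_pos (by linarith [hy.1])]
      linarith [hy.2.trans_le (min_le_right _ _)], hyX⟩
    have h2 : E.vz x (T x) ≤ E.vz y (T y) := hw hx hyX hy.1.le
    have h3 : E.vz y (T' y) ≤ E.vz y (T' x) :=
      (hE.strictAntiOn_vz hyX).antitoneOn (hY' hx) (hY' hyX) (hm' hx hyX hy.1.le)
    rw [heq] at h2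
    linarith
  · obtain ⟨e, he, hball⟩ := Metric.mem_nhdsWithin_iff.mp
      ((hE.continuousOn_vz_left (hY hx) x hx).eventually (lt_mem_nhds hvz))
    have hxa : E.xlo < x := hxb ▸ E.x_lt
    have hc : max E.xlo (x - e) ∈ E.X :=
      ⟨le_max_left _ _, max_le E.x_lt.le (by linarith [hx.2])⟩
    obtain ⟨y, hy, heq⟩ := h.exists_eq hE h' hc hx (max_lt hxa (by linarith))
    have hyX : y ∈ E.X := ⟨hc.1.trans hy.1.le, hy.2.le.trans hx.2⟩
    have h1 : E.vz x (T' x) < E.vz y (T x) := hball ⟨by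
      rw [Metric.mem_ball, Real.dist_eq, abs_of_neg (by linarith [hy.2])]
      linarith [(le_max_right _ _).trans_lt hy.1], hyX⟩
    have h2 : E.vz y (T' y) ≤ E.vz x (T' x) := hw' hyX hx hy.2.le
    have h3 : E.vz y (T x) ≤ E.vz y (T y) :=
      (hE.strictAntiOn_vz hyX).antitoneOn (hY hyX) (hY hx) (hm hyX hx hy.2.le)
    rw [heq] at h3
    linarith

/-- There is at most one marginally sorted matching. -/
theorem IsMarginallySorted.eqOn (hE : E.Regular) {T T' : ℝ → ℝ} (h : E.IsMarginallySorted T)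
    (h' : E.IsMarginallySorted T') : EqOn T T' E.X := fun _ hx =>
  le_antisymm (le_of_not_gt (h'.not_lt hE h hx)) (le_of_not_gt (h.not_lt hE h' hx))

theorem IsMarginallySorted.congr {T T' : ℝ → ℝ} (h : E.IsMarginallySorted T) (he : EqOn T' T E.X) :
    E.IsMarginallySorted T' := by
  rw [isMarginallySorted_iff] at h ⊢
  have hex : ∀ x ∈ E.X, E.excess T' x = E.excess T x := by
    intro x hx
    refine intervalIntegral.integral_congr fun t ht => ?_
    rw [uIcc_of_le hx.1] at ht
    rw [he ⟨ht.1, ht.2.trans hx.2⟩]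
  obtain ⟨hY, hm, ⟨hf, hf'⟩, hw, hc⟩ := h
  refine ⟨hY.congr he.symm, hm.congr he.symm, ⟨fun x hx => hex x hx ▸ hf x hx,
    hex _ E.xhi_mem ▸ hf'⟩, hw.congr fun x hx => by simp only [he hx], ?_⟩
  intro x hx y hy hxy hpos
  rw [he hx, he hy]
  exact hc x hx y hy hxy fun t ht => by
    rw [← hex t ⟨hx.1.trans ht.1, ht.2.trans hy.2⟩]; exact hpos t ht

end Economy

/-! ### Existence of a marginally sorted matching -/

/-- A parametric family of decreasing bijections has a jointly continuous inverse. -/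
theorem exists_continuous_inverse {m : ℝ → ℝ → ℝ} (hm : Continuous (Function.uncurry m))
    (hanti : ∀ x, StrictAnti (m x)) (hsurj : ∀ x, Function.Surjective (m x)) :
    ∃ D : ℝ → ℝ → ℝ, Continuous (Function.uncurry D) ∧ ∀ x l, m x (D x l) = l := by
  choose D hD using hsurj
  refine ⟨D, continuous_iff_continuousAt.mpr ?_, hD⟩
  rintro ⟨x, l⟩
  refine tendsto_order.mpr ⟨fun z hz => ?_, fun z hz => ?_⟩
  · have h1 : l < m x z := by
      have := hanti x (show z < D x l from hz)
      rwa [hD] at this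
    have hc : Continuous fun p : ℝ × ℝ => m p.1 z - p.2 :=
      (hm.comp (continuous_fst.prodMk continuous_const)).sub continuous_snd
    filter_upwards [hc.continuousAt.eventually (lt_mem_nhds (show 0 < m (x, l).1 z - (x, l).2 by
      simpa using h1))] with p hp
    refine (hanti p.1).lt_iff_gt.mp ?_
    show m p.1 (D p.1 p.2) < m p.1 z
    rw [hD]
    linarith
  · have h1 : m x z < l := by
      have := hanti x (show D x l < z from hz)
      rwa [hD] at this
    have hc : Continuous fun p : ℝ × ℝ => p.2 - m p.1 z :=
      continuous_snd.sub (hm.comp (continuous_fst.prodMk continuous_const))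
    filter_upwards [hc.continuousAt.eventually (lt_mem_nhds (show 0 < (x, l).2 - m (x, l).1 z by
      simpa using h1))] with p hp
    refine (hanti p.1).lt_iff_gt.mp ?_
    show m p.1 z < m p.1 (D p.1 p.2)
    rw [hD]
    linarith

namespace Economy

variable {E : Economy}

/-- The marginal product `v_z`, extended to a decreasing bijection of the line in `z`. -/
noncomputable def vzExt (E : Economy) (x z : ℝ) : ℝ :=
  E.vz (max E.xlo (min x E.xhi)) (max E.ylo (min z E.yhi)) - (z - max E.ylo (min z E.yhi))

theorem vzExt_eq {x z : ℝ} (hx : x ∈ E.X) (hz : z ∈ E.Y) : E.vzExt x z = E.vz x z := by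
  rw [vzExt, clamp_eq hx, clamp_eq hz, sub_self, sub_zero]

namespace Regular

variable (hE : E.Regular)
include hE

theorem continuous_vzExt : Continuous (Function.uncurry E.vzExt) := by
  have h1 : Continuous fun p : ℝ × ℝ => (max E.xlo (min p.1 E.xhi), max E.ylo (min p.2 E.yhi)) := by
    fun_prop
  have h2 : Continuous fun p : ℝ × ℝ =>
      E.vz (max E.xlo (min p.1 E.xhi)) (max E.ylo (min p.2 E.yhi)) :=
    hE.continuousOn_vz.comp_continuous h1 fun p =>
      ⟨clamp_mem E.x_lt.le p.1, clamp_mem E.y_lt.le p.2⟩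
  exact h2.sub (by fun_prop)

theorem strictAnti_vzExt (x : ℝ) : StrictAnti (E.vzExt x) := by
  intro z z' hlt
  have hx : max E.xlo (min x E.xhi) ∈ E.X := clamp_mem E.x_lt.le x
  have hz : max E.ylo (min z E.yhi) ∈ E.Y := clamp_mem E.y_lt.le z
  have hz' : max E.ylo (min z' E.yhi) ∈ E.Y := clamp_mem E.y_lt.le z'
  have hle : max E.ylo (min z E.yhi) ≤ max E.ylo (min z' E.yhi) :=
    max_le_max le_rfl (min_le_min hlt.le le_rfl)
  have hlip : max E.ylo (min z' E.yhi) - max E.ylo (min z E.yhi) ≤ z' - z := by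
    have h1 : min z' E.yhi - min z E.yhi ≤ z' - z := by
      rcases min_cases z' E.yhi with h | h <;> rcases min_cases z E.yhi with h' | h' <;> linarith
    rcases max_cases E.ylo (min z' E.yhi) with h | h <;>
      rcases max_cases E.ylo (min z E.yhi) with h' | h' <;> linarith
  unfold vzExt
  rcases hle.eq_or_lt with h | h
  · rw [h]; linarith
  · have := hE.strictAntiOn_vz hx hz hz' h
    linarith

theorem surjective_vzExt (x : ℝ) : Function.Surjective (E.vzExt x) := by
  intro l
  have hc : Continuous (E.vzExt x) :=
    hE.continuous_vzExt.comp (continuous_const.prodMk continuous_id)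
  have hylo := E.y_lt.le
  set x' := max E.xlo (min x E.xhi) with hx'
  have h1 : l ≤ E.vzExt x (min E.ylo (E.ylo + E.vz x' E.ylo - l)) := by
    have e : max E.ylo (min (min E.ylo (E.ylo + E.vz x' E.ylo - l)) E.yhi) = E.ylo :=
      max_eq_left ((min_le_left _ _).trans (min_le_left _ _))
    rw [vzExt, e, ← hx']
    linarith [min_le_right E.ylo (E.ylo + E.vz x' E.ylo - l)]
  have h2 : E.vzExt x (max E.yhi (E.yhi + E.vz x' E.yhi - l)) ≤ l := by
    have e : max E.ylo (min (max E.yhi (E.yhi + E.vz x' E.yhi - l)) E.yhi) = E.yhi := by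
      rw [min_eq_right (le_max_left _ _), max_eq_right hylo]
    rw [vzExt, e, ← hx']
    linarith [le_max_right E.yhi (E.yhi + E.vz x' E.yhi - l)]
  exact mem_range_of_exists_le_of_exists_ge hc ⟨_, h2⟩ ⟨_, h1⟩

theorem vzExt_lt {x x' : ℝ} (hx : x ∈ E.X) (hx' : x' ∈ E.X) (hlt : x < x') (z : ℝ) :
    E.vzExt x z < E.vzExt x' z := by
  unfold vzExt
  rw [clamp_eq hx, clamp_eq hx']
  have := hE.strictMonoOn_vz (clamp_mem E.y_lt.le z) hx hx' hlt
  simp only at this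
  linarith

/-- The isotonic regression is run with data S and with D(x, ·) inverse to v_z(x, ·). Its level
function is then v_z along the allocation, and the excess is minus `cumul`. -/
theorem exists_isMarginallySorted :
    ∃ T : ℝ → ℝ, Continuous T ∧ StrictMonoOn T E.X ∧ E.IsMarginallySorted T := by
  obtain ⟨D, hD, hinv⟩ := exists_continuous_inverse hE.continuous_vzExt hE.strictAnti_vzExt
    hE.surjective_vzExt
  have hDlt : ∀ x z l, E.vzExt x z < l ↔ D x l < z := fun x z l => by
    have := (hE.strictAnti_vzExt x).lt_iff_gt (a := z) (b := D x l)
    rwa [hinv] at this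
  have hltD : ∀ x z l, l < E.vzExt x z ↔ z < D x l := fun x z l => by
    have := (hE.strictAnti_vzExt x).lt_iff_gt (a := D x l) (b := z)
    rwa [hinv] at this
  have hDinv : ∀ x z, D x (E.vzExt x z) = z := fun x z =>
    (hE.strictAnti_vzExt x).injective (hinv _ _)
  have hcS : Continuous fun t => E.vzExt t (E.segExt t) :=
    hE.continuous_vzExt.comp (continuous_id.prodMk E.continuous_segExt)
  obtain ⟨lo, hlo⟩ := (isCompact_Icc (a := E.xlo) (b := E.xhi)).bddBelow_image hcS.continuousOn
  obtain ⟨hi, hhi⟩ := (isCompact_Icc (a := E.xlo) (b := E.xhi)).bddAbove_image hcS.continuousOn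
  -- The constants lo and hi bound v_z(x, S(x)) on X; the margin of one makes the inequalities
  -- against S strict.
  let P : IroningProblem :=
    { a := E.xlo
      b := E.xhi
      hab := E.x_lt
      f := clampExtend E.xlo E.xhi E.f
      S := E.segExt
      D := D
      lo := lo - 1
      hi := hi + 1
      hf := continuous_clampExtend E.x_lt.le E.f_cont
      hS := E.continuous_segExt
      hD := hD
      hf0 := fun x hx => by rw [clampExtend_eq hx]; exact E.f_pos x hx
      hDanti := fun x l l' hl => by rw [← hDlt, hinv]; exact hl
      hlo := fun x hx => by
        rw [← hltD]
        linarith [hlo (mem_image_of_mem (fun t => E.vzExt t (E.segExt t)) hx)]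
      hhi := fun x hx => by
        rw [← hDlt]
        linarith [hhi (mem_image_of_mem (fun t => E.vzExt t (E.segExt t)) hx)] }
  have hSm : StrictMonoOn P.S (Icc P.a P.b) :=
    E.strictMonoOn_S.congr fun x hx => (segExt_eq hx).symm
  have hDm : ∀ l, StrictMonoOn (fun x => P.D x l) (Icc P.a P.b) := fun l x hx y hy hxy => by
    show D x l < D y l
    rw [← hltD]
    have := hE.vzExt_lt hx hy hxy (D x l)
    rwa [hinv] at this
  have hmono := P.alloc_strictMonoOn hSm hDm
  have hY : MapsTo P.alloc E.X E.Y := by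
    intro x hx
    have h1 : E.ylo ≤ P.alloc E.xlo := by
      have h : E.segExt E.xlo ≤ P.alloc E.xlo := P.le_alloc_a
      rwa [segExt_eq E.xlo_mem, E.S_xlo] at h
    have h2 : P.alloc E.xhi ≤ E.yhi := by
      have h : P.alloc E.xhi ≤ E.segExt E.xhi := P.alloc_b_le
      rwa [segExt_eq E.xhi_mem, E.S_xhi] at h
    exact ⟨h1.trans (hmono.monotoneOn E.xlo_mem hx hx.1),
      (hmono.monotoneOn hx E.xhi_mem hx.2).trans h2⟩
  have hw : ∀ x ∈ E.X, E.vz x (P.alloc x) = P.solExt x := by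
    intro x hx
    rw [← vzExt_eq hx (hY hx)]
    exact hinv _ _
  have hex : ∀ x ∈ E.X, E.excess P.alloc x = - P.cumul x := by
    intro x hx
    rw [IroningProblem.cumul, ← intervalIntegral.integral_neg]
    refine intervalIntegral.integral_congr fun t ht => ?_
    rw [uIcc_of_le hx.1] at ht
    have htX : t ∈ E.X := ⟨ht.1, ht.2.trans hx.2⟩
    show (P.alloc t - E.S t) * E.f t = -((E.segExt t - P.alloc t) * clampExtend E.xlo E.xhi E.f t)
    rw [segExt_eq htX, clampExtend_eq htX]
    ring
  refine ⟨P.alloc, P.continuous_alloc, hmono, isMarginallySorted_iff.mpr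
    ⟨hY, hmono.monotoneOn, ⟨fun x hx => ?_, ?_⟩, ?_, ?_⟩⟩
  · rw [hex x hx]
    linarith [P.cumul_nonpos hx]
  · rw [hex _ E.xhi_mem, neg_eq_zero]
    exact P.cumul_b
  · exact (P.monotone_solExt.monotoneOn E.X).congr fun x hx => (hw x hx).symm
  · intro x hx y hy hxy hpos
    rw [hw x hx, hw y hy, P.solExt_eq hx, P.solExt_eq hy]
    refine P.sol_eq_of_cumul_neg hx hxy fun t ht => ?_
    have := hpos t ht
    rw [hex t ⟨hx.1.trans ht.1, ht.2.trans hy.2⟩] at this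
    linarith

end Regular

end Economy

/-! ### Equilibrium assignments -/

namespace Economy

variable {E : Economy}

theorem measure_F_pos {U : Set ℝ} (hU : IsOpen U) {x : ℝ} (hx : x ∈ E.X) (hxU : x ∈ U) :
    0 < E.F U := by
  obtain ⟨e, he, hball⟩ := Metric.isOpen_iff.mp hU x hxU
  rw [Real.ball_eq_Ioo] at hball
  have hc : max E.xlo (x - e) ∈ E.X := ⟨le_max_left _ _, max_le E.x_lt.le (by linarith [hx.2])⟩
  have hd : min E.xhi (x + e) ∈ E.X := ⟨le_min E.x_lt.le (by linarith [hx.1]), min_le_left _ _⟩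
  have hlt : max E.xlo (x - e) < min E.xhi (x + e) :=
    max_lt (lt_min E.x_lt (by linarith [hx.1])) (lt_min (by linarith [hx.2]) (by linarith))
  refine lt_of_lt_of_le (E.isDensityOn_f.measure_Ioo_pos hc hd hlt)
    (measure_mono ((Ioo_subset_Ioo (le_max_right _ _) (min_le_right _ _)).trans hball))

theorem measurable_graph {T : ℝ → ℝ} (hT : Continuous T) : Measurable fun x : ℝ => (x, T x) :=
  measurable_id.prodMk hT.measurable

theorem support_inducedAssignment {T : ℝ → ℝ} (hT : Continuous T) :
    (E.inducedAssignment T).support = {w | w.1 ∈ E.X ∧ w.2 = T w.1} := by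
  have hcl : IsClosed {w : ℝ × ℝ | w.1 ∈ E.X ∧ w.2 = T w.1} :=
    (isClosed_Icc.preimage continuous_fst).inter
      (isClosed_eq continuous_snd (hT.comp continuous_fst))
  apply Subset.antisymm
  · refine Measure.support_subset_of_isClosed hcl ?_
    have : ∀ᵐ w ∂(E.inducedAssignment T), w.1 ∈ E.X ∧ w.2 = T w.1 := by
      rw [inducedAssignment, ae_map_iff (measurable_graph hT).aemeasurable hcl.measurableSet]
      filter_upwards [E.ae_mem_X] with x hx
      exact ⟨hx, rfl⟩
    exact this
  · rintro ⟨x, z⟩ ⟨hx, hz⟩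
    simp only at hx hz
    subst hz
    rw [Measure.mem_support_iff_forall]
    intro U hU
    obtain ⟨V, hVU, hV, hxV⟩ := mem_nhds_iff.mp hU
    refine lt_of_lt_of_le ?_ (measure_mono hVU)
    rw [inducedAssignment, Measure.map_apply (measurable_graph hT) hV.measurableSet]
    exact measure_F_pos (hV.preimage (continuous_id.prodMk hT)) hx hxV

theorem snd_inducedAssignment {T : ℝ → ℝ} (hT : Continuous T) :
    (E.inducedAssignment T).snd = E.F.map T := by
  rw [inducedAssignment, Measure.snd, Measure.map_map measurable_snd (measurable_graph hT)]
  rfl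

theorem fst_inducedAssignment {T : ℝ → ℝ} (hT : Continuous T) :
    (E.inducedAssignment T).fst = E.F := by
  rw [inducedAssignment, Measure.fst, Measure.map_map measurable_fst (measurable_graph hT)]
  exact Measure.map_id

/-- First-order condition: at an optimal workforce, the marginal product is a wage subgradient. -/
theorem Regular.vz_subgradient (hE : E.Regular) {q : ℝ → ℝ} (hq : ConvexOn ℝ E.Y q) {x z : ℝ}
    (hx : x ∈ E.X) (hz : z ∈ E.Y) (hmax : ∀ y ∈ E.Y, E.v x y - q y ≤ E.v x z - q z) {y : ℝ}
    (hy : y ∈ E.Y) : E.vz x z * (y - z) ≤ q y - q z := by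
  have hφ : ∀ t ∈ Icc (0 : ℝ) 1, z + t * (y - z) ∈ E.Y := fun t ht => by
    have : z + t * (y - z) = (1 - t) • z + t • y := by simp only [smul_eq_mul]; ring
    rw [this]
    exact hq.1 hz hy (by linarith [ht.2]) ht.1 (by ring)
  have hd0 : HasDerivWithinAt (fun t : ℝ => z + t * (y - z)) (y - z) (Icc 0 1) 0 := by
    simpa using (((hasDerivAt_id (0 : ℝ)).mul_const (y - z)).const_add z).hasDerivWithinAt
  have hd1 : HasDerivWithinAt (fun t => E.v x t) (E.vz x z) E.Y (z + 0 * (y - z)) := by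
    have := (hE.hasDerivWithinAt_vz hx hz).1
    simpa using this
  have hd2 := hd1.comp (0 : ℝ) hd0 hφ
  have hd3 : HasDerivWithinAt (fun t : ℝ => t * (q y - q z)) (q y - q z) (Icc 0 1) 0 := by
    simpa using ((hasDerivAt_id (0 : ℝ)).mul_const (q y - q z)).hasDerivWithinAt
  have hd := hd2.sub hd3
  -- The wage is replaced by its chord from z to y, which lies above it and is differentiable. The
  -- maximum at t = 0 is kept, and working on a segment covers the case where z is an endpoint of Y.
  have hloc : IsLocalMaxOn ((fun t => E.v x t) ∘ (fun t : ℝ => z + t * (y - z)) -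
      fun t : ℝ => t * (q y - q z)) (Icc 0 1) 0 := by
    filter_upwards [self_mem_nhdsWithin] with t ht
    simp only [Pi.sub_apply, Function.comp_apply, zero_mul, add_zero, sub_zero]
    have h1 := hmax _ (hφ t ht)
    have h2 := hq.2 hz hy (show 0 ≤ 1 - t by linarith [ht.2]) ht.1 (by ring)
    have e : (1 - t) • z + t • y = z + t * (y - z) := by simp only [smul_eq_mul]; ring
    rw [e] at h2
    simp only [smul_eq_mul] at h2
    linarith
  have hcone : (1 : ℝ) ∈ posTangentConeAt (Icc (0 : ℝ) 1) 0 := by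
    exact mem_posTangentConeAt_of_segment_subset (x := (0 : ℝ)) (y := 1) (s := Icc 0 1)
      (by rw [zero_add, segment_eq_Icc zero_le_one])
  have := hloc.hasFDerivWithinAt_nonpos hd.hasFDerivWithinAt hcone
  simp at this
  linarith

namespace IsCompetitiveEquilibrium

variable {J : Measure (ℝ × ℝ)} {p q : ℝ → ℝ}

theorem continuousOn_q (h : E.IsCompetitiveEquilibrium J p q) : ContinuousOn q E.Y := by
  obtain ⟨K, hK⟩ := h.2.2.1
  exact hK.continuousOn

theorem subgradient (hE : E.Regular) (h : E.IsCompetitiveEquilibrium J p q) {x z : ℝ}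
    (hx : x ∈ E.X) (hz : z ∈ E.Y) (he : p x + q z = E.v x z) {y : ℝ} (hy : y ∈ E.Y) :
    E.vz x z * (y - z) ≤ q y - q z :=
  hE.vz_subgradient h.2.2.2.2.2.1 hx hz
    (fun t ht => by linarith [h.2.2.2.2.1 x hx t ht]) hy

theorem optimal_unique (hE : E.Regular) (h : E.IsCompetitiveEquilibrium J p q) {x z z' : ℝ}
    (hx : x ∈ E.X) (hz : z ∈ E.Y) (hz' : z' ∈ E.Y) (he : p x + q z = E.v x z)
    (he' : p x + q z' = E.v x z') : z' = z := by
  by_contra hne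
  have h1 := hE.v_lt_tangent hx hz hz' hne
  have h2 := h.subgradient hE hx hz he hz'
  linarith

/-- Subgradients of a convex wage increase with skill. If z' < z for x < x', the marginal products
satisfy v_z(x', z') > v_z(x, z') > v_z(x, z), a larger subgradient at the lower skill. -/
theorem optimal_mono (hE : E.Regular) (h : E.IsCompetitiveEquilibrium J p q) {x x' z z' : ℝ}
    (hx : x ∈ E.X) (hx' : x' ∈ E.X) (hz : z ∈ E.Y) (hz' : z' ∈ E.Y) (he : p x + q z = E.v x z)
    (he' : p x' + q z' = E.v x' z') (hlt : x < x') : z ≤ z' := by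
  by_contra hne
  rw [not_le] at hne
  have h1 := h.subgradient hE hx hz he hz'
  have h2 := h.subgradient hE hx' hz' he' hz
  have h3 := hE.strictAntiOn_vz hx hz' hz hne
  have h4 := hE.strictMonoOn_vz hz' hx hx' hlt
  simp only at h4
  nlinarith

theorem support_subset (h : E.IsCompetitiveEquilibrium J p q) : J.support ⊆ E.X ×ˢ E.Y := by
  refine Measure.support_subset_of_isClosed (isClosed_Icc.prod isClosed_Icc) ?_
  rw [mem_ae_iff]
  exact h.1.2.1

/-- The projection of the compact support is closed. Its complement has F-measure zero, whereas
every open set meeting X has positive F-measure. -/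
theorem exists_mem_support (h : E.IsCompetitiveEquilibrium J p q) {x : ℝ} (hx : x ∈ E.X) :
    ∃ z, (x, z) ∈ J.support := by
  by_contra hne
  have hK : IsCompact J.support :=
    (isCompact_Icc.prod isCompact_Icc).of_isClosed_subset Measure.isClosed_support h.support_subset
  have hU : IsOpen (Prod.fst '' J.support)ᶜ := (hK.image continuous_fst).isClosed.isOpen_compl
  have hxU : x ∈ (Prod.fst '' J.support)ᶜ := by
    rintro ⟨⟨x', z⟩, hmem, rfl⟩
    exact hne ⟨z, hmem⟩
  have hpos := measure_F_pos hU hx hxU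
  rw [← h.1.2.2.1, Measure.fst_apply hU.measurableSet] at hpos
  have : J (Prod.fst ⁻¹' (Prod.fst '' J.support)ᶜ) ≤ J J.supportᶜ := by
    refine measure_mono fun w hw hws => hw ⟨w, hws, rfl⟩
  rw [Measure.measure_compl_support] at this
  exact absurd hpos (not_lt.mpr this)

/-- In a competitive equilibrium, firms are matched to workforce means by a continuous increasing
function. -/
theorem exists_matching (hE : E.Regular) (h : E.IsCompetitiveEquilibrium J p q) :
    ∃ T : ℝ → ℝ, Continuous T ∧ MonotoneOn T E.X ∧ MapsTo T E.X E.Y ∧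
      J = E.inducedAssignment T := by
  have hex : ∀ x, ∃ z, x ∈ E.X → (x, z) ∈ J.support := fun x => by
    by_cases hx : x ∈ E.X
    · obtain ⟨z, hz⟩ := h.exists_mem_support hx
      exact ⟨z, fun _ => hz⟩
    · exact ⟨0, fun h => absurd h hx⟩
  choose T0 hT0 using hex
  have hY : MapsTo T0 E.X E.Y := fun x hx => (h.support_subset (hT0 x hx)).2
  have heq : ∀ w ∈ J.support, w.2 = T0 w.1 := by
    rintro ⟨x, z⟩ hw
    have hxz := h.support_subset hw
    exact h.optimal_unique hE hxz.1 (hY hxz.1) hxz.2 (h.2.2.2.1 _ _ (hT0 x hxz.1))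
      (h.2.2.2.1 _ _ hw)
  have hmono : MonotoneOn T0 E.X := by
    intro x hx y hy hxy
    rcases hxy.eq_or_lt with hxy | hxy
    · rw [hxy]
    · exact h.optimal_mono hE hx hy (hY hx) (hY hy) (h.2.2.2.1 _ _ (hT0 x hx))
        (h.2.2.2.1 _ _ (hT0 y hy)) hxy
  have hcont : ContinuousOn T0 E.X := by
    intro x hx
    -- Closed-graph argument: values of T0 along a sequence have convergent subsequences, and each
    -- limit is identified because the support is closed and is a graph.
    rw [ContinuousWithinAt, Filter.tendsto_iff_seq_tendsto]
    intro u hu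
    have hu1 : Filter.Tendsto u Filter.atTop (nhds x) := hu.mono_right nhdsWithin_le_nhds
    have hu2 : ∀ᶠ n in Filter.atTop, u n ∈ E.X := hu.eventually self_mem_nhdsWithin
    refine Filter.tendsto_of_subseq_tendsto fun ns hns => ?_
    obtain ⟨z, -, φ, hφ, hlim⟩ := isCompact_Icc.tendsto_subseq' (s := E.Y)
      (x := fun n => T0 (u (ns n)))
      ((hns.eventually hu2).mono fun n hn => hY hn).frequently
    refine ⟨φ, ?_⟩
    have hmem : (x, z) ∈ J.support := by
      refine Measure.isClosed_support.mem_of_tendsto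
        ((hu1.comp (hns.comp hφ.tendsto_atTop)).prodMk_nhds hlim) ?_
      filter_upwards [(hns.comp hφ.tendsto_atTop).eventually hu2] with n hn
      exact hT0 _ hn
    have : z = T0 x := heq _ hmem
    rw [← this]
    exact hlim
  have hT : Continuous (clampExtend E.xlo E.xhi T0) := continuous_clampExtend E.x_lt.le hcont
  refine ⟨clampExtend E.xlo E.xhi T0, hT, (monotone_clampExtend E.x_lt.le hmono).monotoneOn _,
    hY.congr fun x hx => (clampExtend_eq hx).symm, ?_⟩
  -- J is carried by its support, hence by the graph, so it is the image of its first marginal.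
  have h1 : J.map (fun w => (w.1, clampExtend E.xlo E.xhi T0 w.1)) = J := by
    conv_rhs => rw [← Measure.map_id (μ := J)]
    refine Measure.map_congr ?_
    filter_upwards [Measure.support_mem_ae (μ := J)] with w hw
    refine Prod.ext rfl ?_
    show clampExtend E.xlo E.xhi T0 w.1 = w.2
    rw [clampExtend_eq (h.support_subset hw).1, heq w hw]
  rw [inducedAssignment, ← h.1.2.2.1, Measure.fst,
    Measure.map_map (measurable_graph hT) measurable_fst]
  exact h1.symm

/-! ### Consequences of equilibrium for the induced matching -/

section Induced

variable {T : ℝ → ℝ}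

theorem zero_profit (h : E.IsCompetitiveEquilibrium (E.inducedAssignment T) p q)
    (hT : Continuous T) {x : ℝ} (hx : x ∈ E.X) : p x + q (T x) = E.v x (T x) := by
  refine h.2.2.2.1 x (T x) ?_
  rw [support_inducedAssignment hT]
  exact ⟨hx, rfl⟩

theorem integral_wages (h : E.IsCompetitiveEquilibrium (E.inducedAssignment T) p q)
    (hT : Continuous T) (hY : MapsTo T E.X E.Y) :
    ∫ x in E.xlo..E.xhi, (q (E.S x) - q (T x)) * E.f x = 0 := by
  have hw := h.2.2.2.2.2.2
  rw [snd_inducedAssignment hT, ← E.map_segExt, integral_map_matching hT hY h.continuousOn_q,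
    integral_map_matching E.continuous_segExt E.mapsTo_segExt h.continuousOn_q] at hw
  have e : ∫ x in E.xlo..E.xhi, q (E.segExt x) * E.f x = ∫ x in E.xlo..E.xhi, q (E.S x) * E.f x := by
    refine intervalIntegral.integral_congr fun x hx => ?_
    rw [uIcc_of_le E.x_lt.le] at hx
    rw [segExt_eq hx]
  rw [e] at hw
  simp_rw [sub_mul]
  rw [intervalIntegral.integral_sub
    (intervalIntegrable_of_continuousOn (φ := fun x => q (E.S x))
      (h.continuousOn_q.comp E.continuousOn_S E.mapsTo_S) E.xlo_mem E.xhi_mem)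
    (intervalIntegrable_of_continuousOn (φ := fun x => q (T x))
      (h.continuousOn_q.comp hT.continuousOn hY) E.xlo_mem E.xhi_mem), hw, sub_self]

theorem monotoneOn_vz (hE : E.Regular) (h : E.IsCompetitiveEquilibrium (E.inducedAssignment T) p q)
    (hT : Continuous T) (hm : MonotoneOn T E.X) (hY : MapsTo T E.X E.Y) :
    MonotoneOn (fun x => E.vz x (T x)) E.X := by
  intro x hx y hy hxy
  rcases hxy.eq_or_lt with rfl | hlt
  · exact le_rfl
  simp only
  rcases (hm hx hy hxy).eq_or_lt with heq | hTlt
  · rw [← heq]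
    exact (hE.strictMonoOn_vz (hY hx) hx hy hlt).le
  · have h1 := h.subgradient hE hx (hY hx) (h.zero_profit hT hx) (hY hy)
    have h2 := h.subgradient hE hy (hY hy) (h.zero_profit hT hy) (hY hx)
    by_contra hne
    rw [not_le] at hne
    nlinarith

/-- The subgradient inequality from T(x) to S(x), integrated over firms; the wage differences cancel
because the wage bills under the two distributions agree. With `integral_monotone_mul_nonpos` this
forces the equality case. -/
theorem integral_vz_le (hE : E.Regular) (h : E.IsCompetitiveEquilibrium (E.inducedAssignment T) p q)
    (hT : Continuous T) (hY : MapsTo T E.X E.Y) :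
    0 ≤ ∫ x in E.xlo..E.xhi, E.vz x (T x) * ((T x - E.S x) * E.f x) := by
  have hc : ContinuousOn (fun x => E.vz x (T x) * (T x - E.S x)) E.X :=
    (hE.continuousOn_vz.comp (f := fun x => (x, T x)) (by fun_prop) fun x hx => ⟨hx, hY hx⟩).mul
      (hT.continuousOn.sub E.continuousOn_S)
  have hc' : ContinuousOn (fun x => q (E.S x) - q (T x)) E.X :=
    (h.continuousOn_q.comp E.continuousOn_S E.mapsTo_S).sub
      (h.continuousOn_q.comp hT.continuousOn hY)
  have hle : ∫ x in E.xlo..E.xhi, -((E.vz x (T x) * (T x - E.S x)) * E.f x) ≤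
      ∫ x in E.xlo..E.xhi, (q (E.S x) - q (T x)) * E.f x := by
    refine intervalIntegral.integral_mono_on E.x_lt.le
      (intervalIntegrable_of_continuousOn hc E.xlo_mem E.xhi_mem).neg
      (intervalIntegrable_of_continuousOn hc' E.xlo_mem E.xhi_mem) fun x hx => ?_
    have h1 := h.subgradient hE hx (hY hx) (h.zero_profit hT hx) (E.mapsTo_S hx)
    nlinarith [E.f_pos x hx]
  rw [h.integral_wages hT hY, intervalIntegral.integral_neg] at hle
  simp_rw [← mul_assoc]
  linarith

theorem isMarginallySorted (hE : E.Regular)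
    (h : E.IsCompetitiveEquilibrium (E.inducedAssignment T) p q)
    (hT : Continuous T) (hm : MonotoneOn T E.X) (hY : MapsTo T E.X E.Y) :
    E.IsMarginallySorted T := by
  have hf : E.IsFeasible T := by
    rw [← majorizes_iff_isFeasible hT hm hY, ← snd_inducedAssignment hT]
    exact h.1.2.2.2
  rw [isFeasible_iff hm] at hf
  have hw := h.monotoneOn_vz hE hT hm hY
  refine isMarginallySorted_iff.mpr ⟨hY, hm, hf, hw, fun x hx y hy hxy hpos => ?_⟩
  exact eq_of_integral_monotone_mul_eq_zero E.x_lt.le hw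
    (intervalIntegrable_excess hm E.xlo_mem E.xhi_mem) hf.2 hf.1 (h.integral_vz_le hE hT hY)
    hx hy hxy hpos

/-- Wages are linear between the workforce mean of a firm and its segregation quantile. -/
theorem wage_eq (hE : E.Regular)
    (h : E.IsCompetitiveEquilibrium (E.inducedAssignment T) p q)
    (hT : Continuous T) (hm : MonotoneOn T E.X) (hY : MapsTo T E.X E.Y) {x : ℝ} (hx : x ∈ E.X) :
    q (E.S x) - q (T x) = E.vz x (T x) * (E.S x - T x) := by
  have hsub : ∀ t ∈ E.X, E.vz t (T t) * (E.S t - T t) ≤ q (E.S t) - q (T t) := fun t ht =>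
    h.subgradient hE ht (hY ht) (h.zero_profit hT ht) (E.mapsTo_S ht)
  by_contra hne
  have hlt := lt_of_le_of_ne (hsub x hx) (Ne.symm hne)
  have hf : E.IsFeasible T := by
    rw [← majorizes_iff_isFeasible hT hm hY, ← snd_inducedAssignment hT]
    exact h.1.2.2.2
  rw [isFeasible_iff hm] at hf
  have hc : ContinuousOn (fun x => E.vz x (T x) * (T x - E.S x)) E.X :=
    (hE.continuousOn_vz.comp (f := fun x => (x, T x)) (by fun_prop) fun x hx => ⟨hx, hY hx⟩).mul
      (hT.continuousOn.sub E.continuousOn_S)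
  have hc' : ContinuousOn (fun x => q (E.S x) - q (T x)) E.X :=
    (h.continuousOn_q.comp E.continuousOn_S E.mapsTo_S).sub
      (h.continuousOn_q.comp hT.continuousOn hY)
  -- The slack in the subgradient inequality is continuous and nonnegative. Its integral is ∫ v_z(x,
  -- T)(T - S) dF, which is also at most zero, so it cannot be positive anywhere.
  have hpos : 0 < ∫ t in E.xlo..E.xhi,
      ((q (E.S t) - q (T t)) + E.vz t (T t) * (T t - E.S t)) * E.f t := by
    refine intervalIntegral.integral_pos E.x_lt ((hc'.add hc).mul E.f_cont) (fun t ht => ?_)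
      ⟨x, hx, mul_pos (by linarith) (E.f_pos x hx)⟩
    have ht' : t ∈ E.X := Ioc_subset_Icc_self ht
    exact mul_nonneg (by linarith [hsub t ht']) (E.f_pos t ht').le
  simp_rw [add_mul] at hpos
  rw [intervalIntegral.integral_add
    (intervalIntegrable_of_continuousOn hc' E.xlo_mem E.xhi_mem)
    (intervalIntegrable_of_continuousOn hc E.xlo_mem E.xhi_mem), h.integral_wages hT hY] at hpos
  have hle := integral_monotone_mul_nonpos E.x_lt.le (h.monotoneOn_vz hE hT hm hY)
    (intervalIntegrable_excess hm E.xlo_mem E.xhi_mem) hf.2 hf.1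
  simp_rw [← mul_assoc] at hle
  linarith

/-- Envelope theorem by squeezing: each firm could hire the other's workforce mean, which bounds the
profit increment on both sides by values of v_x. -/
theorem profit_eq (hE : E.Regular)
    (h : E.IsCompetitiveEquilibrium (E.inducedAssignment T) p q)
    (hT : Continuous T) (hY : MapsTo T E.X E.Y) {x : ℝ} (hx : x ∈ E.X) :
    p x - p E.xlo = ∫ s in E.xlo..x, E.vx s (T s) := by
  refine sub_eq_integral_of_squeeze (b := E.xhi) (ρ := fun t s => E.vx t (T s)) ?_ ?_ hx
  · exact hE.continuousOn_vx.comp (f := fun w : ℝ × ℝ => (w.1, T w.2)) (by fun_prop)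
      fun w hw => ⟨hw.1, hY hw.2⟩
  · intro s hs t ht hst
    obtain ⟨c, hc, he⟩ := hE.exists_vx_slope hs ht (hY hs) hst
    obtain ⟨d, hd, he'⟩ := hE.exists_vx_slope hs ht (hY ht) hst
    refine ⟨c, Ioo_subset_Icc_self hc, d, Ioo_subset_Icc_self hd, ?_, ?_⟩
    · rw [← he]
      linarith [h.2.2.2.2.1 t ht (T s) (hY hs), h.zero_profit hT hs]
    · rw [← he']
      linarith [h.2.2.2.2.1 s hs (T t) (hY ht), h.zero_profit hT ht]

end Induced

end IsCompetitiveEquilibrium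

/-! ### The inverse matching and the necessity of the price formulas -/

section Inverse

variable {T : ℝ → ℝ}

theorem inverseMatching_spec (hT : Continuous T) {y : ℝ} (hy : y ∈ Icc (T E.xlo) (T E.xhi)) :
    E.inverseMatching T y ∈ E.X ∧ T (E.inverseMatching T y) = y := by
  have hmem : y ∈ T '' E.X := intermediate_value_Icc E.x_lt.le hT.continuousOn hy
  obtain ⟨x, hx, he⟩ := hmem
  have hex : ∃ a ∈ E.X, T a = y := ⟨x, hx, he⟩
  exact ⟨Function.invFunOn_mem hex, Function.invFunOn_eq hex⟩

theorem inverseMatching_apply (hT : Continuous T) (hs : StrictMonoOn T E.X) {x : ℝ} (hx : x ∈ E.X) :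
    E.inverseMatching T (T x) = x := by
  have hy : T x ∈ Icc (T E.xlo) (T E.xhi) :=
    ⟨hs.monotoneOn E.xlo_mem hx hx.1, hs.monotoneOn hx E.xhi_mem hx.2⟩
  obtain ⟨h1, h2⟩ := inverseMatching_spec hT hy
  exact hs.injOn h1 hx h2

theorem continuousOn_inverseMatching (hT : Continuous T) (hs : StrictMonoOn T E.X) :
    ContinuousOn (E.inverseMatching T) (Icc (T E.xlo) (T E.xhi)) :=
  StrictMonoOn.continuousOn_rightInverse hs fun _ hy => inverseMatching_spec hT hy

theorem Regular.continuousOn_wage_slope (hE : E.Regular) (hT : Continuous T)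
    (hs : StrictMonoOn T E.X) (hY : MapsTo T E.X E.Y) :
    ContinuousOn (fun y => E.vz (E.inverseMatching T y) y) (Icc (T E.xlo) (T E.xhi)) := by
  refine hE.continuousOn_vz.comp (f := fun y => (E.inverseMatching T y, y))
    ((continuousOn_inverseMatching hT hs).prodMk continuousOn_id) fun y hy => ?_
  obtain ⟨h1, h2⟩ := inverseMatching_spec hT hy
  exact ⟨h1, h2 ▸ hY h1⟩

end Inverse

theorem convexOn_le_affine {s : Set ℝ} {q : ℝ → ℝ} (hq : ConvexOn ℝ s q) {u y z m : ℝ} (hu : u ∈ s)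
    (hz : z ∈ s) (huy : u ≤ y) (hyz : y ≤ z) (huz : u < z) (he : q u - q z = m * (u - z)) :
    q y ≤ q z + m * (y - z) := by
  have hpos : 0 < z - u := by linarith
  have h := hq.2 hu hz (show 0 ≤ (z - y) / (z - u) from div_nonneg (by linarith) hpos.le)
    (show 0 ≤ (y - u) / (z - u) from div_nonneg (by linarith) hpos.le) (by field_simp; ring)
  have e1 : ((z - y) / (z - u)) • u + ((y - u) / (z - u)) • z = y := by
    simp only [smul_eq_mul]; field_simp; ring
  rw [e1] at h
  have e2 : ((z - y) / (z - u)) • q u + ((y - u) / (z - u)) • q z = q z + m * (y - z) := by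
    have : q u = q z + m * (u - z) := by linarith
    rw [this]
    simp only [smul_eq_mul]; field_simp; ring
  rwa [e2] at h

theorem IsCompetitiveEquilibrium.envelopePrices {T p q : ℝ → ℝ} (hE : E.Regular)
    (h : E.IsCompetitiveEquilibrium (E.inducedAssignment T) p q)
    (hT : Continuous T) (hs : StrictMonoOn T E.X) (hY : MapsTo T E.X E.Y) :
    E.EnvelopePrices T p q (p E.xlo) := by
  have hm := hs.monotoneOn
  refine ⟨fun x hx => ?_, fun y hy => ?_, fun y hy => ?_, fun y hy => ?_⟩
  · rw [← h.profit_eq hE hT hY hx]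
    ring
  · have hsub : ∀ t ∈ Icc (T E.xlo) (T E.xhi), ∀ u ∈ Icc (T E.xlo) (T E.xhi),
        E.vz (E.inverseMatching T t) t * (u - t) ≤ q u - q t := by
      intro t ht u hu
      obtain ⟨h1, h2⟩ := inverseMatching_spec hT ht
      have hz := h.zero_profit hT h1
      rw [h2] at hz
      exact h.subgradient hE h1 (h2 ▸ hY h1) hz
        ⟨(hY E.xlo_mem).1.trans hu.1, hu.2.trans (hY E.xhi_mem).2⟩
    have := sub_eq_integral_of_subgradient (hE.continuousOn_wage_slope hT hs hY) hsub hy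
    rw [← this]
    linarith [h.zero_profit hT E.xlo_mem]
  -- Below T(xlo) the subgradient bounds the wage from below. Since S(xlo) = ylo, `wage_eq` gives
  -- the chord from ylo the same slope, and convexity bounds the wage from above. The upper tail is
  -- symmetric.
  · have hyY : y ∈ E.Y := ⟨hy.1, hy.2.le.trans (hY E.xlo_mem).2⟩
    have h1 := h.subgradient hE E.xlo_mem (hY E.xlo_mem) (h.zero_profit hT E.xlo_mem) hyY
    have h2 := h.wage_eq hE hT hm hY E.xlo_mem
    rw [E.S_xlo] at h2
    have h3 := convexOn_le_affine h.2.2.2.2.2.1 E.ylo_mem (hY E.xlo_mem) hy.1 hy.2.le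
      (hy.1.trans_lt hy.2) h2
    linarith
  · have hyY : y ∈ E.Y := ⟨(hY E.xhi_mem).1.trans hy.1.le, hy.2⟩
    have h1 := h.subgradient hE E.xhi_mem (hY E.xhi_mem) (h.zero_profit hT E.xhi_mem) hyY
    have h2 := h.wage_eq hE hT hm hY E.xhi_mem
    rw [E.S_xhi] at h2
    have h3 := convexOn_le_affine (m := E.vz E.xhi (T E.xhi)) h.2.2.2.2.2.1 (hY E.xhi_mem)
      E.yhi_mem hy.1.le hy.2 (hy.1.trans_le hy.2) (by linarith)
    linarith

end Economy

/-! ### Equilibrium prices of a marginally sorted matching -/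

namespace Economy

variable {E : Economy} {T : ℝ → ℝ}

/-- The slope of the equilibrium wage function. -/
noncomputable def wageSlope (E : Economy) (T : ℝ → ℝ) (y : ℝ) : ℝ :=
  clampExtend (T E.xlo) (T E.xhi) (fun z => E.vz (E.inverseMatching T z) z) y

/-- An equilibrium wage function. -/
noncomputable def wage (E : Economy) (T : ℝ → ℝ) (y : ℝ) : ℝ :=
  ∫ t in (T E.xlo)..y, E.wageSlope T t

theorem exists_wageSlope_eq (hT : Continuous T) (hs : StrictMonoOn T E.X) (y : ℝ) :
    ∃ x ∈ E.X, T x = max (T E.xlo) (min y (T E.xhi)) ∧ E.wageSlope T y = E.vz x (T x) := by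
  obtain ⟨h1, h2⟩ := inverseMatching_spec hT
    (clamp_mem (hs.monotoneOn E.xlo_mem E.xhi_mem E.x_lt.le) y)
  refine ⟨_, h1, h2, ?_⟩
  rw [h2]
  rfl

theorem wageSlope_apply (hT : Continuous T) (hs : StrictMonoOn T E.X) {x : ℝ} (hx : x ∈ E.X) :
    E.wageSlope T (T x) = E.vz x (T x) := by
  have hm := hs.monotoneOn
  rw [wageSlope, clampExtend_eq ⟨hm E.xlo_mem hx hx.1, hm hx E.xhi_mem hx.2⟩,
    inverseMatching_apply hT hs hx]

theorem continuous_wageSlope (hE : E.Regular) (hT : Continuous T) (hs : StrictMonoOn T E.X)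
    (hY : MapsTo T E.X E.Y) : Continuous (E.wageSlope T) :=
  continuous_clampExtend (hs.monotoneOn E.xlo_mem E.xhi_mem E.x_lt.le)
    (hE.continuousOn_wage_slope hT hs hY)

theorem monotone_wageSlope (hT : Continuous T) (hs : StrictMonoOn T E.X)
    (hw : MonotoneOn (fun x => E.vz x (T x)) E.X) : Monotone (E.wageSlope T) := by
  intro y z hyz
  obtain ⟨x, hx, h1, h2⟩ := exists_wageSlope_eq hT hs y
  obtain ⟨x', hx', h1', h2'⟩ := exists_wageSlope_eq hT hs z
  rw [h2, h2']
  refine hw hx hx' ?_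
  rw [← hs.le_iff_le hx hx', h1, h1']
  exact max_le_max le_rfl (min_le_min hyz le_rfl)

theorem wage_sub (hc : Continuous (E.wageSlope T)) (y z : ℝ) :
    E.wage T z - E.wage T y = ∫ t in y..z, E.wageSlope T t :=
  intervalIntegral.integral_interval_sub_left (hc.intervalIntegrable _ _)
    (hc.intervalIntegrable _ _)

theorem wageSlope_mul_le (hc : Continuous (E.wageSlope T)) (hmono : Monotone (E.wageSlope T))
    (y z : ℝ) : E.wageSlope T y * (z - y) ≤ E.wage T z - E.wage T y := by
  have key : ∀ a b c : ℝ, ∫ _ in a..b, c = c * (b - a) := fun a b c => by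
    rw [intervalIntegral.integral_const, smul_eq_mul, mul_comm]
  rcases le_total y z with h | h
  · rw [wage_sub hc, ← key]
    exact intervalIntegral.integral_mono_on h intervalIntegrable_const
      (hc.intervalIntegrable _ _) fun t ht => hmono ht.1
  · have : E.wage T y - E.wage T z ≤ E.wageSlope T y * (y - z) := by
      rw [wage_sub hc, ← key]
      exact intervalIntegral.integral_mono_on h (hc.intervalIntegrable _ _)
        intervalIntegrable_const fun t ht => hmono ht.2
    linarith

theorem convexOn_wage (hc : Continuous (E.wageSlope T)) (hmono : Monotone (E.wageSlope T)) :
    ConvexOn ℝ E.Y (E.wage T) := by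
  refine ⟨convex_Icc _ _, fun x _ y _ a b ha hb hab => ?_⟩
  have h1 := mul_le_mul_of_nonneg_left (wageSlope_mul_le hc hmono (a • x + b • y) x) ha
  have h2 := mul_le_mul_of_nonneg_left (wageSlope_mul_le hc hmono (a • x + b • y) y) hb
  have h3 : a * (E.wageSlope T (a • x + b • y) * (x - (a • x + b • y))) +
      b * (E.wageSlope T (a • x + b • y) * (y - (a • x + b • y))) = 0 := by
    have hb' : b = 1 - a := by linarith
    simp only [smul_eq_mul]
    subst hb'
    ring
  have h4 : a * E.wage T (a • x + b • y) + b * E.wage T (a • x + b • y) =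
      E.wage T (a • x + b • y) := by rw [← add_mul, hab, one_mul]
  simp only [smul_eq_mul] at *
  linarith

theorem lipschitzOnWith_of_abs_le {s : Set ℝ} {φ : ℝ → ℝ} {C : ℝ}
    (h : ∀ x ∈ s, ∀ y ∈ s, φ y - φ x ≤ C * |y - x|) : ∃ K, LipschitzOnWith K φ s := by
  refine ⟨C.toNNReal, LipschitzOnWith.of_dist_le_mul fun x hx y hy => ?_⟩
  rw [Real.dist_eq, Real.dist_eq, abs_le]
  have h1 := h x hx y hy
  have h2 := h y hy x hx
  rw [abs_sub_comm y x] at h1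
  have h3 : C * |x - y| ≤ C.toNNReal * |x - y| :=
    mul_le_mul_of_nonneg_right (Real.le_coe_toNNReal C) (abs_nonneg _)
  constructor <;> linarith

theorem exists_lipschitzOnWith_wage (hc : Continuous (E.wageSlope T)) :
    ∃ K, LipschitzOnWith K (E.wage T) E.Y := by
  obtain ⟨C, hC⟩ := (isCompact_Icc (a := E.ylo) (b := E.yhi)).exists_bound_of_continuousOn
    hc.continuousOn
  refine lipschitzOnWith_of_abs_le (C := C) fun x hx y hy => ?_
  rw [wage_sub hc]
  refine (le_abs_self _).trans ?_
  refine intervalIntegral.norm_integral_le_of_norm_le_const fun t ht => hC t ?_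
  exact uIcc_subset_Icc hx hy (uIoc_subset_uIcc ht)

/-- An equilibrium profit function. -/
noncomputable def profit (E : Economy) (T : ℝ → ℝ) (x : ℝ) : ℝ := E.v x (T x) - E.wage T (T x)

theorem le_profit_add_wage (hE : E.Regular) (hT : Continuous T) (hs : StrictMonoOn T E.X)
    (hY : MapsTo T E.X E.Y) (hw : MonotoneOn (fun x => E.vz x (T x)) E.X) {x z : ℝ} (hx : x ∈ E.X)
    (hz : z ∈ E.Y) : E.v x z ≤ E.profit T x + E.wage T z := by
  have hc := continuous_wageSlope hE hT hs hY
  have h1 := wageSlope_mul_le hc (monotone_wageSlope hT hs hw) (T x) z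
  rw [wageSlope_apply hT hs hx] at h1
  rw [profit]
  by_cases hne : z = T x
  · rw [hne]; linarith
  · linarith [hE.v_lt_tangent hx (hY hx) hz hne]

/-- The profit is the maximum over z of v(x, z) minus the wage, attained at T(x). A maximum of
functions of x with a common Lipschitz constant, here a bound on v_x, inherits that constant. -/
theorem exists_lipschitzOnWith_profit (hE : E.Regular) (hY : MapsTo T E.X E.Y)
    (hle : ∀ x ∈ E.X, ∀ z ∈ E.Y, E.v x z ≤ E.profit T x + E.wage T z) :
    ∃ K, LipschitzOnWith K (E.profit T) E.X := by
  obtain ⟨C, hC⟩ := ((isCompact_Icc (a := E.xlo) (b := E.xhi)).prod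
    (isCompact_Icc (a := E.ylo) (b := E.yhi))).exists_bound_of_continuousOn hE.continuousOn_vx
  have hv : ∀ x ∈ E.X, ∀ y ∈ E.X, ∀ z ∈ E.Y, E.v y z - E.v x z ≤ C * |y - x| := by
    intro x hx y hy z hz
    rcases lt_trichotomy x y with hlt | rfl | hlt
    · obtain ⟨t, ht, he⟩ := hE.exists_vx_slope hx hy hz hlt
      have hb := hC (t, z) ⟨⟨hx.1.trans ht.1.le, ht.2.le.trans hy.2⟩, hz⟩
      rw [he, abs_of_pos (by linarith)]
      exact mul_le_mul_of_nonneg_right ((le_abs_self _).trans hb) (by linarith)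
    · simp
    · obtain ⟨t, ht, he⟩ := hE.exists_vx_slope hy hx hz hlt
      have hb := hC (t, z) ⟨⟨hy.1.trans ht.1.le, ht.2.le.trans hx.2⟩, hz⟩
      have hb' : -E.vx t z ≤ C := (neg_le_abs _).trans hb
      rw [abs_of_neg (by linarith)]
      nlinarith
  refine lipschitzOnWith_of_abs_le (C := C) fun x hx y hy => ?_
  have h1 := hle x hx (T y) (hY hy)
  have h2 := hv x hx y hy (T y) (hY hy)
  have h3 : E.profit T y = E.v y (T y) - E.wage T (T y) := rfl
  linarith

/-- Where the constraint binds, the matching is segregating. -/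
theorem eq_S_of_excess_eq_zero (hT : Continuous T) (hf : ∀ x ∈ E.X, 0 ≤ E.excess T x) {x : ℝ}
    (hx : x ∈ Ioo E.xlo E.xhi) (h0 : E.excess T x = 0) : T x = E.S x := by
  have hcf : ContinuousOn (fun t => (T t - E.S t) * E.f t) E.X :=
    (hT.continuousOn.sub E.continuousOn_S).mul E.f_cont
  have hnhds : E.X ∈ nhds x := Icc_mem_nhds hx.1 hx.2
  have hxX : x ∈ E.X := Ioo_subset_Icc_self hx
  have hd : HasDerivAt (E.excess T) ((T x - E.S x) * E.f x) x := by
    refine intervalIntegral.integral_hasDerivAt_right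
      (hcf.mono (uIcc_subset_Icc E.xlo_mem hxX)).intervalIntegrable ?_ (hcf.continuousAt hnhds)
    exact hcf.stronglyMeasurableAtFilter_nhdsWithin measurableSet_Icc x |>.filter_mono
      (by rw [nhdsWithin_eq_nhds.mpr hnhds])
  have hmin : IsLocalMin (E.excess T) x := by
    filter_upwards [hnhds] with t ht
    rw [h0]
    exact hf t ht
  rcases mul_eq_zero.mp (hmin.hasDerivAt_eq_zero hd) with h | h
  · linarith
  · exact absurd h (E.f_pos x hxX).ne'

/-- Either the constraint binds at x and T(x) = S(x), or x lies in a compression interval (a, b) on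
which v_z(t, T(t)) is constant. In the second case T(x) and S(x) both lie in the range of skills
where the wage has this constant slope. -/
theorem wage_S_sub (hE : E.Regular) (hT : Continuous T) (hs : StrictMonoOn T E.X)
    (h : E.IsMarginallySorted T) {x : ℝ} (hx : x ∈ Ioo E.xlo E.xhi) :
    E.wage T (E.S x) - E.wage T (T x) = E.vz x (T x) * (E.S x - T x) := by
  have h' := isMarginallySorted_iff.mp h
  obtain ⟨hY, hm, ⟨hf, hf1⟩, hw, -⟩ := h'
  have hcs := continuous_wageSlope hE hT hs hY
  have hxX : x ∈ E.X := Ioo_subset_Icc_self hx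
  rcases (hf x hxX).eq_or_lt with h0 | hpos
  · rw [eq_S_of_excess_eq_zero hT hf hx h0.symm]
    ring
  obtain ⟨a, b, hab, hax, hxb⟩ := exists_compressionInterval hm hf hf1 hxX hxX le_rfl
    (fun t ht => by rw [le_antisymm ht.2 ht.1]; exact hpos)
  have haX := (mem_segregationSet_iff hm).mp hab.2.2.1
  have hbX := (mem_segregationSet_iff hm).mp hab.2.2.2
  have hconst : ∀ t ∈ Icc a b, E.vz t (T t) = E.vz x (T x) := by
    have hwc : ContinuousOn (fun t => E.vz t (T t)) (Icc a b) :=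
      (hE.continuousOn_vz.comp (f := fun x => (x, T x)) (by fun_prop)
        fun x hx => ⟨hx, hY hx⟩).mono (Icc_subset_Icc haX.1.1 hbX.1.2)
    have hcl : IsClosed (Icc a b ∩ (fun t => E.vz t (T t)) ⁻¹' {E.vz x (T x)}) :=
      hwc.preimage_isClosed_of_isClosed isClosed_Icc isClosed_singleton
    have hsub : Ioo a b ⊆ Icc a b ∩ (fun t => E.vz t (T t)) ⁻¹' {E.vz x (T x)} := fun t ht =>
      ⟨Ioo_subset_Icc_self ht, h.2.2.2.2 a b hab t ht x ⟨hax, hxb⟩⟩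
    intro t ht
    rw [← closure_Ioo hab.1.ne] at ht
    exact (closure_minimal hsub hcl ht).2
  have hsl : ∀ y ∈ uIcc (T x) (E.S x), E.wageSlope T y = E.vz x (T x) := by
    intro y hy
    obtain ⟨t, ht, h1, h2⟩ := exists_wageSlope_eq hT hs y
    rw [h2]
    refine hconst t ⟨?_, ?_⟩
    -- At an interior endpoint a, T(a) = S(a) bounds both T(x) and S(x) from below. If a = xlo
    -- nothing is needed, since the slope is extended as a constant beyond T(xlo). The endpoint b is
    -- treated alike.
    · rcases haX.1.1.eq_or_lt with he | hlt
      · rw [← he]; exact ht.1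
      · have hTa := eq_S_of_excess_eq_zero hT hf ⟨hlt, hax.trans hx.2⟩ haX.2
        rw [← hs.le_iff_le haX.1 ht, h1]
        refine le_max_of_le_right (le_min ?_ (hm haX.1 E.xhi_mem haX.1.2))
        refine le_trans (le_inf (hm haX.1 hxX hax.le) ?_) hy.1
        rw [hTa]
        exact E.strictMonoOn_S.monotoneOn haX.1 hxX hax.le
    · rcases hbX.1.2.eq_or_lt with he | hlt
      · rw [he]; exact ht.2
      · have hTb := eq_S_of_excess_eq_zero hT hf ⟨hx.1.trans hxb, hlt⟩ hbX.2
        rw [← hs.le_iff_le ht hbX.1, h1]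
        refine max_le (hm E.xlo_mem hbX.1 hbX.1.1) ((min_le_left _ _).trans ?_)
        refine le_trans hy.2 (sup_le (hm hxX hbX.1 hxb.le) ?_)
        rw [hTb]
        exact E.strictMonoOn_S.monotoneOn hxX hbX.1 hxb.le
  rw [wage_sub hcs, intervalIntegral.integral_congr (g := fun _ => E.vz x (T x)) hsl,
    intervalIntegral.integral_const, smul_eq_mul, mul_comm]

theorem integral_wage_eq (hE : E.Regular) (hT : Continuous T) (hs : StrictMonoOn T E.X)
    (h : E.IsMarginallySorted T) :
    ∫ x in E.xlo..E.xhi, E.wage T (T x) * E.f x =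
      ∫ x in E.xlo..E.xhi, E.wage T (E.S x) * E.f x := by
  have h' := isMarginallySorted_iff.mp h
  obtain ⟨hY, hm, ⟨hf, hf1⟩, hw, hc⟩ := h'
  obtain ⟨K, hK⟩ := exists_lipschitzOnWith_wage (continuous_wageSlope hE hT hs hY)
  have h0 := integral_monotone_mul_eq_zero E.x_lt.le hw
    (intervalIntegrable_excess hm E.xlo_mem E.xhi_mem) hf1 hf hc
  have h1 : ∫ x in E.xlo..E.xhi, (E.wage T (T x) - E.wage T (E.S x)) * E.f x =
      ∫ x in E.xlo..E.xhi, E.vz x (T x) * ((T x - E.S x) * E.f x) := by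
    rw [intervalIntegral.integral_of_le E.x_lt.le, intervalIntegral.integral_of_le E.x_lt.le,
      integral_Ioc_eq_integral_Ioo, integral_Ioc_eq_integral_Ioo]
    refine setIntegral_congr_fun measurableSet_Ioo fun x hx => ?_
    have := wage_S_sub hE hT hs h hx
    have e : E.wage T (T x) - E.wage T (E.S x) = E.vz x (T x) * (T x - E.S x) := by linarith
    simp only [e]
    ring
  rw [h0] at h1
  simp_rw [sub_mul] at h1
  rw [intervalIntegral.integral_sub
    (intervalIntegrable_of_continuousOn (φ := fun x => E.wage T (T x))
      (hK.continuousOn.comp hT.continuousOn hY) E.xlo_mem E.xhi_mem)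
    (intervalIntegrable_of_continuousOn (φ := fun x => E.wage T (E.S x))
      (hK.continuousOn.comp E.continuousOn_S E.mapsTo_S) E.xlo_mem E.xhi_mem)] at h1
  linarith

theorem integral_G_eq {φ : ℝ → ℝ} (hφ : ContinuousOn φ E.Y) :
    ∫ y, φ y ∂E.G = ∫ x in E.xlo..E.xhi, φ (E.S x) * E.f x := by
  rw [← E.map_segExt, integral_map_matching E.continuous_segExt E.mapsTo_segExt hφ]
  refine intervalIntegral.integral_congr fun x hx => ?_
  rw [uIcc_of_le E.x_lt.le] at hx
  rw [segExt_eq hx]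

theorem isAssignment_inducedAssignment (hT : Continuous T) (h : E.IsMarginallySorted T) :
    E.IsAssignment (E.inducedAssignment T) := by
  refine ⟨Measure.isProbabilityMeasure_map (measurable_graph hT).aemeasurable, ?_,
    fst_inducedAssignment hT, ?_⟩
  · have hR : MeasurableSet (E.X ×ˢ E.Y) := measurableSet_Icc.prod measurableSet_Icc
    have hX : E.F E.Xᶜ = 0 := mem_ae_iff.mp E.ae_mem_X
    rw [inducedAssignment, Measure.map_apply (measurable_graph hT) hR.compl]
    exact measure_mono_null (fun x hx hxX => hx ⟨hxX, h.1 hxX⟩) hX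
  · rw [snd_inducedAssignment hT]
    exact (majorizes_iff_isFeasible hT h.2.1 h.1).mpr h.2.2.1

/-- A marginally sorted matching is supported by competitive prices. -/
theorem isCompetitiveEquilibrium_profit_wage (hE : E.Regular) (hT : Continuous T)
    (hs : StrictMonoOn T E.X) (h : E.IsMarginallySorted T) :
    E.IsCompetitiveEquilibrium (E.inducedAssignment T) (E.profit T) (E.wage T) := by
  have hY := h.1
  have hw := h.2.2.2.1
  have hc := continuous_wageSlope hE hT hs hY
  have hle := fun x hx z hz => le_profit_add_wage hE hT hs hY hw (x := x) (z := z) hx hz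
  have hL := exists_lipschitzOnWith_wage hc
  refine ⟨isAssignment_inducedAssignment hT h, exists_lipschitzOnWith_profit hE hY hle, hL,
    fun x z hxz => ?_, hle, convexOn_wage hc (monotone_wageSlope hT hs hw), ?_⟩
  · rw [support_inducedAssignment hT] at hxz
    obtain ⟨-, he⟩ := hxz
    simp only at he
    rw [he, profit]
    ring
  · obtain ⟨K, hK⟩ := hL
    rw [snd_inducedAssignment hT, integral_map_matching hT hY hK.continuousOn,
      integral_G_eq hK.continuousOn]
    exact integral_wage_eq hE hT hs h

theorem IsCompetitiveEquilibrium.shift {p q p' q' : ℝ → ℝ} {d : ℝ}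
    (h : E.IsCompetitiveEquilibrium (E.inducedAssignment T) p q) (hT : Continuous T)
    (hY : MapsTo T E.X E.Y) (hp : ∀ x ∈ E.X, p' x = p x + d) (hq : ∀ y ∈ E.Y, q' y = q y - d) :
    E.IsCompetitiveEquilibrium (E.inducedAssignment T) p' q' := by
  have hcq := h.continuousOn_q
  have hsub := h.support_subset
  obtain ⟨hJ, ⟨K, hK⟩, ⟨L, hL⟩, h1, h2, h3, h4⟩ := h
  have hL' : LipschitzOnWith L q' E.Y := by
    intro x hx y hy
    rw [hq x hx, hq y hy, edist_sub_right]
    exact hL hx hy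
  refine ⟨hJ, ⟨K, fun x hx y hy => ?_⟩, ⟨L, hL'⟩, fun x z hxz => ?_, fun x hx z hz => ?_,
    ⟨h3.1, fun x hx y hy a b ha hb hab => ?_⟩, ?_⟩
  · rw [hp x hx, hp y hy, edist_add_right]
    exact hK hx hy
  · rw [hp x (hsub hxz).1, hq z (hsub hxz).2]
    linarith [h1 x z hxz]
  · rw [hp x hx, hq z hz]
    linarith [h2 x hx z hz]
  · rw [hq x hx, hq y hy, hq _ (h3.1 hx hy ha hb hab)]
    have := h3.2 hx hy ha hb hab
    have e : a * d + b * d = d := by rw [← add_mul, hab, one_mul]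
    simp only [smul_eq_mul] at *
    linarith
  · rw [snd_inducedAssignment hT, integral_map_matching hT hY hcq, integral_G_eq hcq] at h4
    rw [snd_inducedAssignment hT, integral_map_matching hT hY hL'.continuousOn,
      integral_G_eq hL'.continuousOn]
    have key : ∀ R : ℝ → ℝ, ContinuousOn R E.X → MapsTo R E.X E.Y →
        ∫ x in E.xlo..E.xhi, q' (R x) * E.f x =
          (∫ x in E.xlo..E.xhi, q (R x) * E.f x) - ∫ x in E.xlo..E.xhi, d * E.f x := by
      intro R hR hRY
      rw [← intervalIntegral.integral_sub
        (intervalIntegrable_of_continuousOn (φ := fun x => q (R x)) (hcq.comp hR hRY)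
          E.xlo_mem E.xhi_mem)
        (intervalIntegrable_of_continuousOn (φ := fun _ => d) continuousOn_const
          E.xlo_mem E.xhi_mem)]
      refine intervalIntegral.integral_congr fun x hx => ?_
      rw [uIcc_of_le E.x_lt.le] at hx
      rw [hq _ (hRY hx)]
      ring
    rw [key T hT.continuousOn hY, key E.S E.continuousOn_S E.mapsTo_S, h4]

/-- The formulas leave only the constant free, so one supported pair of prices gives all of them by
shifting. -/
theorem EnvelopePrices.eq_add {p q p' q' : ℝ → ℝ} {c c' : ℝ}
    (hs : StrictMonoOn T E.X) (h : E.EnvelopePrices T p q c) (h' : E.EnvelopePrices T p' q' c') :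
    (∀ x ∈ E.X, p' x = p x + (c' - c)) ∧ ∀ y ∈ E.Y, q' y = q y - (c' - c) := by
  have hm := hs.monotoneOn E.xlo_mem E.xhi_mem E.x_lt.le
  have hmid : ∀ y ∈ Icc (T E.xlo) (T E.xhi), q' y = q y - (c' - c) := fun y hy => by
    rw [h.2.1 y hy, h'.2.1 y hy]; ring
  refine ⟨fun x hx => by rw [h.1 x hx, h'.1 x hx]; ring, fun y hy => ?_⟩
  rcases lt_or_ge y (T E.xlo) with h1 | h1
  · rw [h.2.2.1 y ⟨hy.1, h1⟩, h'.2.2.1 y ⟨hy.1, h1⟩, hmid _ ⟨le_rfl, hm⟩]; ring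
  rcases le_or_gt y (T E.xhi) with h2 | h2
  · exact hmid y ⟨h1, h2⟩
  · rw [h.2.2.2 y ⟨h2, hy.2⟩, h'.2.2.2 y ⟨h2, hy.2⟩, hmid _ ⟨hm, le_rfl⟩]; ring

end Economy

/-! ### The main theorem -/

theorem theorem3 (E : Economy)
    (hv : ContDiffOn ℝ 2 (fun w : ℝ × ℝ => E.v w.1 w.2) (E.X ×ˢ E.Y))
    (hxz : ∀ x ∈ E.X, ∀ z ∈ E.Y, 0 < E.vxz x z)
    (hzz : ∀ x ∈ E.X, ∀ z ∈ E.Y, E.vzz x z < 0) :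
    ∃ T : ℝ → ℝ,
      -- existence and uniqueness of the equilibrium matching
      E.IsEquilibriumMatching T ∧
      (∀ T' : ℝ → ℝ, E.IsEquilibriumMatching T' → EqOn T' T E.X) ∧
      -- in every equilibrium, each firm `x` hires exactly the workforce mean `T x`
      (∀ J : Measure (ℝ × ℝ), (∃ p q, E.IsCompetitiveEquilibrium J p q) ↔
        J = E.inducedAssignment T) ∧
      (E.inducedAssignment T).support = {w | w.1 ∈ E.X ∧ w.2 = T w.1} ∧
      -- continuity and strict monotonicity
      MapsTo T E.X E.Y ∧ ContinuousOn T E.X ∧ StrictMonoOn T E.X ∧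
      -- characterization of the equilibrium matching
      (∀ T' : ℝ → ℝ, E.IsMarginallySorted T' ↔ EqOn T' T E.X) ∧
      -- equilibrium prices
      (∀ p q : ℝ → ℝ, E.IsCompetitiveEquilibrium (E.inducedAssignment T) p q ↔
        ∃ c : ℝ, E.EnvelopePrices T p q c) := by
  have hE : E.Regular := ⟨hv, hxz, hzz⟩
  obtain ⟨T, hT, hs, h⟩ := hE.exists_isMarginallySorted
  have hY := h.1
  have hCE := Economy.isCompetitiveEquilibrium_profit_wage hE hT hs h
  have hquant : ∀ x ∈ E.X, E.quantileMatching (E.inducedAssignment T).snd x = T x := by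
    intro x hx
    rw [Economy.snd_inducedAssignment hT]
    exact Economy.quantileMatching_map hT hs.monotoneOn hY hx
  have hJ : ∀ (J : Measure (ℝ × ℝ)) (p q : ℝ → ℝ), E.IsCompetitiveEquilibrium J p q →
      J = E.inducedAssignment T := by
    intro J p q hJ
    -- Any equilibrium is induced by some marginally sorted T', which equals T on X. F is carried by
    -- X, so the assignments coincide.
    obtain ⟨T', hT', hm', hY', rfl⟩ := hJ.exists_matching hE
    have heq : EqOn T' T E.X := (hJ.isMarginallySorted hE hT' hm' hY').eqOn hE h
    refine Measure.map_congr ?_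
    filter_upwards [E.ae_mem_X] with x hx
    rw [heq hx]
  refine ⟨T, ⟨_, _, _, hCE, fun x hx => (hquant x hx).symm⟩, ?_, fun J => ⟨?_, ?_⟩,
    Economy.support_inducedAssignment hT, hY, hT.continuousOn, hs,
    fun T' => ⟨fun h' => h'.eqOn hE h, fun he => h.congr he⟩, fun p q => ⟨fun h' => ?_, ?_⟩⟩
  · rintro T' ⟨J, p, q, hJ', hT'⟩ x hx
    rw [hT' x hx, hJ J p q hJ', hquant x hx]
  · rintro ⟨p, q, hJ'⟩
    exact hJ J p q hJ'
  · rintro rfl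
    exact ⟨_, _, hCE⟩
  · exact ⟨_, h'.envelopePrices hE hT hs hY⟩
  -- The constructed prices satisfy the formulas with their own constant; the given ones are a shift
  -- of them.
  · rintro ⟨c, hc⟩
    obtain ⟨hp, hq⟩ := (hCE.envelopePrices hE hT hs hY).eq_add hs hc
    exact hCE.shift hT hY hp hq
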